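/- **Model.** Let $L\ge 2$ be even. Consider a wire of $L$ sites with spinless fermion operators $c_j$, $N_w=\sum_j c_j^\dagger c_j$, coupled to a superconductor with Hilbert space spanned by the orthonormal states $|p\rangle$, $p\in\mathbb Z$, where $\hat n|p\rangle=p|p\rangle$ and $e^{\pm i\hat\phi}|p\rangle=|p\pm1\rangle$. For real $t,\Delta,\mu,n_c$ with $\Delta\neq0$ and $|\mu|<t$, and for $\mathcal E_c\ge0$, $E_c=\mathcal E_c/L$, let $$H_{0,\mu}=-\tfrac t2\sum_{j=1}^{L-1}(c_j^\dagger c_{j+1}+\mathrm{h.c.})-\tfrac\Delta2\sum_{j=1}^{L-1}(c_jc_{j+1}e^{i\hat\phi}+\mathrm{h.c.})-\mu\big(N_w-\tfrac L2\big),\qquad H_\mu=H_{0,\mu}+4E_c(\hat n-n_c)^2 .$$ Both commute with $N=N_w+2\hat n$. Fix $M\in\mathbb Z$. Let $f^{(M)}(\mu)$ be the expectation value of $N_w$ in the ground state of $H_{0,\mu}$ in the sector $N=M$, and let $\delta^{(M)}_{0,\mu}$ be the difference of the two lowest eigenvalues (with multiplicity) of $H_{0,\mu}$ in that sector. **Majorana-like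 operators.** For $\Delta>0$ put $A_j=-i(c_j-c_j^\dagger e^{-i\hat\phi})$ and $B_j=c_j+c_j^\dagger e^{-i\hat\phi}$; for $\Delta<0$ replace $c_j$ by $-ic_j$ and $c_j^\dagger$ by $ic_j^\dagger$ in these formulas. The operators $\Gamma_{\ell,\mu}=\sum_ju_jA_j$ and $\Gamma_{r,\mu}=\sum_jv_jB_j$, with real unit vectors $u,v$, are those satisfying $[H_{0,\mu},\Gamma_{\ell,\mu}]=i\varepsilon\,\Gamma_{r,\mu}$ and $[H_{0,\mu},\Gamma_{r,\mu}]=-i\varepsilon\,\Gamma_{\ell,\mu}$ with real $\varepsilon$ of the smallest possible absolute value, and with signs such that $u_1>0$ and $v_L>0$. **Theorem 4.** Suppose that $\big|\mu+2E_c\big(M-2n_c-f^{(M)}(\mu)\big)\big|<t$. Then there is a unique $\mu'\in(-t,t)$ with $\mu'+2E_cf^{(M)}(\mu')=\mu+2E_c(M-2n_c)$ (so that in the $M$-particle sector $H_\mu=H_{0,\mu'}+E_c(N_w-f^{(M)}(\mu'))^2+\text{const}$). If moreover $$\mathcal E_c\Big(\frac12+\frac8L\Big)<\delta^{(M)}_{0,\mu'},$$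 then $H_\mu$ has a unique ground state $\psi$ (normalized, up to a phase) in the $M$-particle sector, $\Gamma_{\ell,\mu'}$ and $\Gamma_{r,\mu'}$ exist and are unique, and $\langle\psi|i\Gamma_{\ell,\mu'}^\dagger\Gamma_{r,\mu'}|\psi\rangle$ is real and satisfies $$(-1)^M\langle\psi|\,i\,\Gamma_{\ell,\mu'}^\dagger\Gamma_{r,\mu'}\,|\psi\rangle\;\ge\;1-\frac{2\,\mathcal E_c\left(\frac12+\frac8L\right)}{\delta^{(M)}_{0,\mu'}} .$$ -/

import Mathlib

noncomputable section

namespace Wire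

/-- Basis states `|S, p⟩`: `S` is the set of occupied sites of a wire with `L` sites, and the
integer `p` is the eigenvalue of the Cooper-pair number operator of the superconductor. -/
abbrev Conf (L : ℕ) : Type := Finset (Fin L) × ℤ

/-- Finite linear combinations of the orthonormal basis `|S, p⟩` of the Hilbert space
(Fock space of the wire) ⊗ `ℓ²(ℤ)`. All operators below are defined on this dense subspace and
map it to itself. A sector of fixed total particle number has finite dimension, so all the
vectors of such a sector lie in this space. -/
abbrev State (L : ℕ) : Type := Conf L →₀ ℂ

/-- Linear operators on the (core of the) Hilbert space. -/
abbrev Op (L : ℕ) : Type := Module.End ℂ (State L)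

/-- Inner product in which the `|S, p⟩` are orthonormal, conjugate-linear on the left. -/
def inn {L : ℕ} (x y : State L) : ℂ := x.sum fun i a => (starRingEnd ℂ) a * y i

/-- The operator with prescribed values on the basis states. -/
def onBasis {L : ℕ} (f : Conf L → State L) : Op L := Finsupp.linearCombination ℂ f

/-- The fermionic sign `(-1)^{#(occupied sites to the left of j)}`. -/
def fsign {L : ℕ} (j : Fin L) (S : Finset (Fin L)) : ℂ := (-1) ^ (S.filter (· < j)).card

/-- Fermion annihilation operator `c_j`. -/
def ann {L : ℕ} (j : Fin L) : Op L :=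
  onBasis fun s => if j ∈ s.1 then Finsupp.single (s.1.erase j, s.2) (fsign j s.1) else 0

/-- Fermion creation operator `c_j†`. -/
def cre {L : ℕ} (j : Fin L) : Op L :=
  onBasis fun s => if j ∈ s.1 then 0 else Finsupp.single (insert j s.1, s.2) (fsign j s.1)

/-- Cooper-pair number operator `n`. -/
def pairNum (L : ℕ) : Op L := onBasis fun s => Finsupp.single s (s.2 : ℂ)

/-- The operator `e^{i k φ}`, `k ∈ ℤ`, where `φ` is the phase conjugate to `n`:
it raises the number of Cooper pairs by `k`. -/
def expPhase (L : ℕ) (k : ℤ) : Op L := onBasis fun s => Finsupp.single (s.1, s.2 + k) 1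

/-- Number of fermions on the wire, `N_w = ∑ c_j† c_j`. -/
def wireNum (L : ℕ) : Op L := ∑ j : Fin L, cre j * ann j

/-- Total particle number `N = N_w + 2 n`. -/
def totalNum (L : ℕ) : Op L := wireNum L + (2 : ℂ) • pairNum L

/-- The `M`-particle sector. -/
def sector (L : ℕ) (M : ℤ) : Submodule ℂ (State L) := (totalNum L).eigenspace (M : ℂ)

/-- The Hamiltonian `H_{0,μ}` of the open wire coupled to the superconductor, without charging
energy:
`-(t/2) ∑ (c_j† c_{j+1} + h.c.) - (Δ/2) ∑ (c_j c_{j+1} e^{iφ} + h.c.) - μ (N_w - L/2)`. -/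
def hamZero (L : ℕ) (t Δ μ : ℝ) : Op L :=
  (∑ j : Fin L, ∑ k : Fin L, if j.val + 1 = k.val then
      (-(t / 2 : ℝ) : ℂ) • (cre j * ann k + cre k * ann j)
        + (-(Δ / 2 : ℝ) : ℂ) •
            (ann j * ann k * expPhase L 1 + expPhase L (-1) * cre k * cre j)
    else 0)
  - (μ : ℂ) • (wireNum L - ((L : ℂ) / 2) • 1)

/-- The charging energy `4 E_c (n - n_c)²`, which in the `M`-particle sector is equal to
`E_c (N_w - (M - 2 n_c))²`. -/
def charging (L : ℕ) (Ec nc : ℝ) : Op L :=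
  ((4 * Ec : ℝ) : ℂ) • (pairNum L - (nc : ℂ) • 1) ^ 2

/-- The full Hamiltonian `H_μ = H_{0,μ} + V`. -/
def ham (L : ℕ) (t Δ μ Ec nc : ℝ) : Op L := hamZero L t Δ μ + charging L Ec nc

/-- Span of the eigenvectors of `H` in the `M`-particle sector with energy at most `E`. -/
def lowSpace {L : ℕ} (H : Op L) (M : ℤ) (E : ℝ) : Submodule ℂ (State L) :=
  ⨆ e : {e : ℝ // e ≤ E}, H.eigenspace ((e : ℝ) : ℂ) ⊓ sector L M

/-- The `k`-th lowest eigenvalue (`k = 0, 1, …`, counted with multiplicity) of `H` in the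
`M`-particle sector. -/
def level {L : ℕ} (H : Op L) (M : ℤ) (k : ℕ) : ℝ :=
  sInf {E : ℝ | k + 1 ≤ Module.finrank ℂ (lowSpace H M E)}

/-- The energy gap of `H` in the `M`-particle sector; it is zero if the lowest level is
degenerate. -/
def gap {L : ℕ} (H : Op L) (M : ℤ) : ℝ := level H M 1 - level H M 0

/-- `ψ` is a normalized ground state of `H` in the `M`-particle sector. -/
def IsGroundState {L : ℕ} (H : Op L) (M : ℤ) (ψ : State L) : Prop :=
  ψ ∈ sector L M ∧ H ψ = ((level H M 0 : ℝ) : ℂ) • ψ ∧ inn ψ ψ = 1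

/-- `f^{(M)}(μ)`: the mean number of fermions on the wire in the ground state of `H_{0,μ}` in the
`M`-particle sector. -/
def filling (L : ℕ) (t Δ : ℝ) (M : ℤ) (μ : ℝ) : ℝ :=
  let χ := Classical.epsilon (IsGroundState (hamZero L t Δ μ) M)
  (inn χ (wireNum L χ)).re

/-- The phase `e^{iθ/2}` with `e^{iθ} = Δ/|Δ|`, used to absorb the sign of the pairing amplitude
in the fermion operators. It is `1` if `Δ > 0`. -/
def gauge (Δ : ℝ) : ℂ := if 0 < Δ then 1 else -Complex.I

/-- Number-conserving version of the Majorana operator `a_j = -i (c_j - c_j†)`, namely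
`A_j = -i (c_j - c_j† e^{-iφ})` for `Δ > 0`. It lowers the total particle number by one. -/
def majA {L : ℕ} (Δ : ℝ) (j : Fin L) : Op L :=
  (-Complex.I) • (gauge Δ • ann j - (starRingEnd ℂ) (gauge Δ) • (cre j * expPhase L (-1)))

/-- The adjoint `A_j†`. -/
def majADag {L : ℕ} (Δ : ℝ) (j : Fin L) : Op L :=
  Complex.I • ((starRingEnd ℂ) (gauge Δ) • cre j - gauge Δ • (expPhase L 1 * ann j))

/-- Number-conserving version of the Majorana operator `b_j = c_j + c_j†`, namely
`B_j = c_j + c_j† e^{-iφ}` for `Δ > 0`. -/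
def majB {L : ℕ} (Δ : ℝ) (j : Fin L) : Op L :=
  gauge Δ • ann j + (starRingEnd ℂ) (gauge Δ) • (cre j * expPhase L (-1))

/-- `Γ_ℓ = ∑ u_j A_j`. -/
def gammaL {L : ℕ} (Δ : ℝ) (u : Fin L → ℝ) : Op L := ∑ j, (u j : ℂ) • majA Δ j

/-- `Γ_ℓ† = ∑ u_j A_j†`. -/
def gammaLDag {L : ℕ} (Δ : ℝ) (u : Fin L → ℝ) : Op L := ∑ j, (u j : ℂ) • majADag Δ j

/-- `Γ_r = ∑ v_j B_j`. -/
def gammaR {L : ℕ} (Δ : ℝ) (v : Fin L → ℝ) : Op L := ∑ j, (v j : ℂ) • majB Δ j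

/-- The two normalized Majorana-like operators with amplitudes `u`, `v` are the two halves of an
exact Bogoliubov quasiparticle mode of `H_{0,μ}`:
`[H_{0,μ}, Γ_ℓ] = i ε Γ_r` and `[H_{0,μ}, Γ_r] = -i ε Γ_ℓ`
(so `[H_{0,μ}, Γ_ℓ ± i Γ_r] = ± ε (Γ_ℓ ± i Γ_r)`). -/
def IsMode {L : ℕ} (t Δ μ ε : ℝ) (u v : Fin L → ℝ) : Prop :=
  (∑ j, u j ^ 2 = 1) ∧ (∑ j, v j ^ 2 = 1) ∧
  hamZero L t Δ μ * gammaL Δ u - gammaL Δ u * hamZero L t Δ μ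
    = (Complex.I * (ε : ℂ)) • gammaR Δ v ∧
  hamZero L t Δ μ * gammaR Δ v - gammaR Δ v * hamZero L t Δ μ
    = (-(Complex.I * (ε : ℂ))) • gammaL Δ u

/-- `u`, `v` are the amplitudes of the left and right Majorana-like edge operators of `H_{0,μ}`:
they form the mode with the smallest `|ε|`, and the signs are such that `Γ_ℓ` has a positive
amplitude on the first site and `Γ_r` has a positive amplitude on the last site. -/
def IsEdgePair {L : ℕ} (t Δ μ : ℝ) (u v : Fin L → ℝ) : Prop :=
  (∃ ε : ℝ, IsMode t Δ μ ε u v ∧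
    ∀ (ε' : ℝ) (u' v' : Fin L → ℝ), IsMode t Δ μ ε' u' v' → |ε| ≤ |ε'|) ∧
  (∀ j : Fin L, j.val = 0 → 0 < u j) ∧ (∀ j : Fin L, j.val + 1 = L → 0 < v j)

/-- `μ'` is the effective chemical potential: it lies in `(-t, t)` and solves
`μ' + 2 E_c f^{(M)}(μ') = μ + 2 E_c (M - 2 n_c)`, so that in the `M`-particle sector
`H_μ = H_{0,μ'} + E_c (N_w - f^{(M)}(μ'))² + constant`. -/
def IsEffectivePotential (L : ℕ) (t Δ μ Ec nc : ℝ) (M : ℤ) (μ' : ℝ) : Prop :=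
  |μ'| < t ∧ μ' + 2 * Ec * filling L t Δ M μ' = μ + 2 * Ec * (M - 2 * nc)

end Wire

end

/-! In the `M`-particle sector the number of Cooper pairs is fixed by the configuration of the wire,
so a state is a vector of Fock amplitudes of parity `M`. After multiplying the amplitude of `S` by a
phase `twist Δ ^ S.card` (`coord`), `hamZero` becomes the Kitaev chain `kitaev` with pairing `|Δ|`,
and the Majorana-like operators become ordinary Majorana operators (`coord_hamZero`, `coord_gammaL`,
`coord_gammaR`).

In this gauge all off-diagonal matrix elements are nonpositive and connect all configurations of
equal parity. By Perron-Frobenius (`exists_isPerron`) each parity has a unique ground state, with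
strictly positive amplitudes `r p` and energy `e p`. A quasiparticle mode of energy `ε` takes a
ground state to states of the other parity with energy shifted by `±ε`, hence `|e 1 - e 0| ≤ |ε|`
for every mode. Equality is attained by the mode whose amplitudes are the matrix elements of the
Majorana operators between `r 0` and `r 1`. At the two ends of the wire the Jordan-Wigner string is
trivial or equals the total parity, so positivity of `r` fixes the signs there. The minimal mode is
therefore unique, and it exchanges the two ground states up to a sign depending on `M`
(`IsEdgePair.eq_edge`, `IsEdgePair.apply_ground`): without charging energy the edge correlation is
exactly `(-1) ^ M`.

The charging energy is treated variationally. The filling is a monotone continuous function of the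
chemical potential, which gives the unique `μ'`; completing the square leaves the perturbation `Ec
(N_w - f)²` of the chain at `μ'` (`chargedKitaev_eq`). Since every mode is empty or filled in `r p`,
a Wick computation bounds the variance of `N_w` by `L / 2` (`norm_numOp_sub_le`), so the unperturbed
ground state as a trial state costs at most `calE / 2`. Positivity of the perturbation and the gap
`δ` then bound the weight of a true ground state outside the unperturbed one by `w / δ`
(`gap_mul_le_of_ground`). As `w < δ`, no ground state is orthogonal to the unperturbed one, which
gives uniqueness, and the edge correlation is lowered by at most twice that weight
(`edge_correlation_ge`). -/

noncomputable section

namespace Wire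

open scoped InnerProductSpace

variable {L : ℕ}

/-! ### Occupation number configurations -/

/-- The configuration in which the occupation of site `j` is changed. -/
def toggle (j : Fin L) (S : Finset (Fin L)) : Finset (Fin L) := symmDiff S {j}

theorem toggle_of_mem {j : Fin L} {S : Finset (Fin L)} (h : j ∈ S) : toggle j S = S.erase j := by
  ext i
  simp only [toggle, Finset.mem_symmDiff, Finset.mem_singleton, Finset.mem_erase]
  by_cases hij : i = j
  · subst hij; simp [h]
  · simp [hij]

theorem toggle_of_notMem {j : Fin L} {S : Finset (Fin L)} (h : j ∉ S) :
    toggle j S = insert j S := by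
  ext i
  simp only [toggle, Finset.mem_symmDiff, Finset.mem_singleton, Finset.mem_insert]
  by_cases hij : i = j
  · subst hij; simp [h]
  · simp [hij]

@[simp] theorem toggle_toggle (j : Fin L) (S : Finset (Fin L)) : toggle j (toggle j S) = S := by
  simp [toggle]

theorem toggle_comm (j k : Fin L) (S : Finset (Fin L)) :
    toggle j (toggle k S) = toggle k (toggle j S) := by
  simp only [toggle]
  rw [symmDiff_right_comm]

@[simp] theorem mem_toggle_self {j : Fin L} {S : Finset (Fin L)} : j ∈ toggle j S ↔ j ∉ S := by
  simp [toggle, Finset.mem_symmDiff]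

theorem mem_toggle_of_ne {i j : Fin L} (h : i ≠ j) {S : Finset (Fin L)} :
    i ∈ toggle j S ↔ i ∈ S := by
  simp [toggle, Finset.mem_symmDiff, h]

theorem card_toggle (j : Fin L) (S : Finset (Fin L)) :
    ((toggle j S).card : ℤ) = if j ∈ S then (S.card : ℤ) - 1 else S.card + 1 := by
  split_ifs with h
  · rw [toggle_of_mem h, Finset.card_erase_of_mem h]
    have := Finset.card_pos.2 ⟨j, h⟩
    omega
  · rw [toggle_of_notMem h, Finset.card_insert_of_notMem h]
    push_cast; rfl

theorem neg_one_pow_card_toggle (j : Fin L) (S : Finset (Fin L)) :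
    (-1 : ℂ) ^ (toggle j S).card = -(-1) ^ S.card := by
  by_cases h : j ∈ S
  · have h2 := Finset.card_erase_add_one h
    rw [toggle_of_mem h, ← h2, pow_succ]; ring
  · rw [toggle_of_notMem h, Finset.card_insert_of_notMem h, pow_succ]; ring

theorem toggle_bijective (j : Fin L) : Function.Bijective (toggle j) :=
  Function.Involutive.bijective (toggle_toggle j)

theorem sum_toggle {A : Type*} [AddCommMonoid A] (j : Fin L) (f : Finset (Fin L) → A) :
    ∑ S, f (toggle j S) = ∑ S, f S :=
  (toggle_bijective j).sum_comp f

/-- The parity of the number of fermions. -/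
def par (S : Finset (Fin L)) : ZMod 2 := (S.card : ZMod 2)

@[simp] theorem par_toggle (j : Fin L) (S : Finset (Fin L)) : par (toggle j S) = par S + 1 := by
  have h := congrArg (Int.cast : ℤ → ZMod 2) (card_toggle j S)
  simp only [Int.cast_natCast] at h
  rw [par, par, h]
  split_ifs
  · push_cast
    rw [sub_eq_add_neg]; rfl
  · push_cast; rfl

theorem add_one_add_one (p : ZMod 2) : p + 1 + 1 = p := by revert p; decide

theorem eq_or_eq_add_one (p q : ZMod 2) : p = q ∨ p = q + 1 := by revert p q; decide

/-- Only sites strictly to the left of `k` enter the string. This asymmetry between `j < k` and `k <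
j` is the source of all the anticommutation relations below. -/
theorem fsign_toggle (j k : Fin L) (S : Finset (Fin L)) :
    fsign k (toggle j S) = if j < k then -fsign k S else fsign k S := by
  have hf : (toggle j S).filter (· < k)
      = if j < k then toggle j (S.filter (· < k)) else S.filter (· < k) := by
    ext i
    split_ifs with h
    · by_cases hij : i = j
      · subst hij; simp [h]
      · simp [mem_toggle_of_ne hij]
    · by_cases hij : i = j
      · subst hij; simp [h]
      · simp [mem_toggle_of_ne hij]
  rw [fsign, fsign, hf]
  split_ifs
  · exact neg_one_pow_card_toggle _ _
  · rfl

theorem fsign_mul_self (j : Fin L) (S : Finset (Fin L)) : fsign j S * fsign j S = 1 := by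
  rw [fsign, ← mul_pow]; simp

@[simp] theorem conj_fsign (j : Fin L) (S : Finset (Fin L)) :
    (starRingEnd ℂ) (fsign j S) = fsign j S := by simp [fsign]

/-! ### Majorana operators on the Fock space of the wire -/

/-- Fock space of the wire. -/
abbrev Amp (L : ℕ) : Type := EuclideanSpace ℂ (Finset (Fin L))

theorem inner_amp (x y : Amp L) : ⟪x, y⟫_ℂ = ∑ S, (starRingEnd ℂ) (x S) * y S := by
  rw [PiLp.inner_apply]
  refine Finset.sum_congr rfl fun S _ => ?_
  rw [RCLike.inner_apply, mul_comm]

/-- The operator changing the occupation of site `j` with weight `w`. -/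
def wflip (j : Fin L) (w : Finset (Fin L) → ℂ) : Module.End ℂ (Amp L) where
  toFun x := WithLp.toLp 2 fun S => w S * x (toggle j S)
  map_add' x y := by ext S; simp [mul_add]
  map_smul' c x := by ext S; simp; ring

@[simp] theorem wflip_apply (j : Fin L) (w : Finset (Fin L) → ℂ) (x : Amp L)
    (S : Finset (Fin L)) : wflip j w x S = w S * x (toggle j S) := rfl

theorem inner_wflip_left (j : Fin L) (w : Finset (Fin L) → ℂ) (x y : Amp L) :
    ⟪wflip j w x, y⟫_ℂ = ⟪x, wflip j (fun S => (starRingEnd ℂ) (w (toggle j S))) y⟫_ℂ := by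
  rw [inner_amp, inner_amp, ← sum_toggle j]
  refine Finset.sum_congr rfl fun S _ => ?_
  simp only [wflip_apply, toggle_toggle, map_mul]
  ring

/-- First Majorana operator of site `j`. -/
def majX (j : Fin L) : Module.End ℂ (Amp L) := wflip j (fsign j)

/-- Second Majorana operator of site `j`, multiplied by `-i`. -/
def majY (j : Fin L) : Module.End ℂ (Amp L) :=
  wflip j fun S => if j ∈ S then -fsign j S else fsign j S

theorem majX_apply (j : Fin L) (x : Amp L) (S : Finset (Fin L)) :
    majX j x S = fsign j S * x (toggle j S) := rfl

theorem majY_apply (j : Fin L) (x : Amp L) (S : Finset (Fin L)) :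
    majY j x S = (if j ∈ S then -fsign j S else fsign j S) * x (toggle j S) := rfl

theorem inner_majX (j : Fin L) (x y : Amp L) : ⟪majX j x, y⟫_ℂ = ⟪x, majX j y⟫_ℂ := by
  rw [majX, inner_wflip_left]
  simp [fsign_toggle, conj_fsign]

theorem inner_majY (j : Fin L) (x y : Amp L) : ⟪majY j x, y⟫_ℂ = -⟪x, majY j y⟫_ℂ := by
  rw [majY, inner_wflip_left, ← inner_neg_right]
  congr 1
  ext S
  simp only [wflip_apply, mem_toggle_self, fsign_toggle, PiLp.neg_apply]
  by_cases h : j ∈ S <;> simp [h]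

theorem majX_anticomm (j k : Fin L) :
    majX j * majX k + majX k * majX j = if j = k then (2 : ℂ) • 1 else 0 := by
  ext1 x
  ext S
  split_ifs with h
  · subst h
    simp only [LinearMap.add_apply, Module.End.mul_apply, PiLp.add_apply, majX_apply, fsign_toggle,
      toggle_toggle, lt_irrefl, if_false, LinearMap.smul_apply, Module.End.one_apply,
      PiLp.smul_apply, smul_eq_mul]
    linear_combination 2 * x S * fsign_mul_self j S
  · simp only [LinearMap.add_apply, Module.End.mul_apply, PiLp.add_apply, majX_apply, fsign_toggle,
      LinearMap.zero_apply, PiLp.zero_apply, toggle_comm j k]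
    rcases lt_or_gt_of_ne h with h' | h' <;> simp [h', h'.not_gt] <;> ring

theorem majY_anticomm (j k : Fin L) :
    majY j * majY k + majY k * majY j = if j = k then (-2 : ℂ) • 1 else 0 := by
  ext1 x
  ext S
  split_ifs with h
  · subst h
    simp only [LinearMap.add_apply, Module.End.mul_apply, PiLp.add_apply, majY_apply, fsign_toggle,
      toggle_toggle, lt_irrefl, if_false, LinearMap.smul_apply, Module.End.one_apply,
      PiLp.smul_apply, smul_eq_mul, mem_toggle_self]
    by_cases hj : j ∈ S <;> simp only [hj, if_true, if_false, not_true, not_false_eq_true] <;>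
    linear_combination (-2) * x S * fsign_mul_self j S
  · simp only [LinearMap.add_apply, Module.End.mul_apply, PiLp.add_apply, majY_apply, fsign_toggle,
      LinearMap.zero_apply, PiLp.zero_apply, toggle_comm j k, mem_toggle_of_ne h,
      mem_toggle_of_ne (Ne.symm h)]
    rcases lt_or_gt_of_ne h with h' | h' <;> by_cases h1 : j ∈ S <;> by_cases h2 : k ∈ S <;>
      simp [h', h'.not_gt, h1, h2] <;> ring

theorem majX_majY_anticomm (j k : Fin L) : majX j * majY k + majY k * majX j = 0 := by
  ext1 x
  ext S
  by_cases h : j = k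
  · subst h
    simp only [LinearMap.add_apply, Module.End.mul_apply, PiLp.add_apply, majX_apply, majY_apply,
      fsign_toggle, toggle_toggle, lt_irrefl, if_false, mem_toggle_self, LinearMap.zero_apply,
      PiLp.zero_apply]
    by_cases hj : j ∈ S <;> simp [hj]
  · simp only [LinearMap.add_apply, Module.End.mul_apply, PiLp.add_apply, majX_apply, majY_apply,
      fsign_toggle, LinearMap.zero_apply, PiLp.zero_apply, toggle_comm j k,
      mem_toggle_of_ne (Ne.symm h)]
    rcases lt_or_gt_of_ne h with h' | h' <;> by_cases h2 : k ∈ S <;>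
      simp [h', h'.not_gt, h2] <;> ring

/-! ### Real linear combinations of Majorana operators and their Clifford relations -/

/-- Real combinations of the first Majorana operators. -/
def combX (u : Fin L → ℝ) : Module.End ℂ (Amp L) := ∑ j, (u j : ℂ) • majX j

/-- Real combinations of the second Majorana operators. -/
def combY (v : Fin L → ℝ) : Module.End ℂ (Amp L) := ∑ j, (v j : ℂ) • majY j

theorem combX_smul (c : ℝ) (u : Fin L → ℝ) : combX (c • u) = (c : ℂ) • combX u := by
  simp only [combX, Finset.smul_sum, smul_smul, Pi.smul_apply, smul_eq_mul, Complex.ofReal_mul]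

theorem combY_smul (c : ℝ) (u : Fin L → ℝ) : combY (c • u) = (c : ℂ) • combY u := by
  simp only [combY, Finset.smul_sum, smul_smul, Pi.smul_apply, smul_eq_mul, Complex.ofReal_mul]

theorem inner_combX (u : Fin L → ℝ) (x y : Amp L) :
    ⟪combX u x, y⟫_ℂ = ⟪x, combX u y⟫_ℂ := by
  simp only [combX, LinearMap.sum_apply, LinearMap.smul_apply, sum_inner, inner_sum,
    inner_smul_left, inner_smul_right, inner_majX, Complex.conj_ofReal]

theorem inner_combY (u : Fin L → ℝ) (x y : Amp L) :
    ⟪combY u x, y⟫_ℂ = -⟪x, combY u y⟫_ℂ := by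
  simp only [combY, LinearMap.sum_apply, LinearMap.smul_apply, sum_inner, inner_sum,
    inner_smul_left, inner_smul_right, inner_majY, Complex.conj_ofReal, mul_neg,
    Finset.sum_neg_distrib]

theorem sum_smul_mul_sum_smul (a b : Fin L → ℂ) (f g : Fin L → Module.End ℂ (Amp L)) :
    (∑ j, a j • f j) * ∑ k, b k • g k = ∑ j, ∑ k, (a j * b k) • (f j * g k) := by
  rw [Finset.sum_mul_sum]
  simp only [smul_mul_smul_comm]

theorem combX_anticomm (u v : Fin L → ℝ) :
    combX u * combX v + combX v * combX u = ((2 * ∑ j, u j * v j : ℝ) : ℂ) • 1 := by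
  have h1 : combX u * combX v + combX v * combX u
      = ∑ j, ∑ k, ((u j : ℂ) * v k) • (majX j * majX k + majX k * majX j) := by
    simp only [combX, sum_smul_mul_sum_smul, smul_add, Finset.sum_add_distrib]
    congr 1
    rw [Finset.sum_comm]
    simp only [mul_comm (u _ : ℂ)]
  rw [h1]
  simp only [majX_anticomm, smul_ite, smul_zero, Finset.sum_ite_eq, Finset.mem_univ, if_true,
    smul_smul, ← Finset.sum_smul]
  congr 1
  push_cast
  rw [Finset.mul_sum]
  exact Finset.sum_congr rfl fun j _ => by ring

theorem combY_anticomm (u v : Fin L → ℝ) :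
    combY u * combY v + combY v * combY u = ((-2 * ∑ j, u j * v j : ℝ) : ℂ) • 1 := by
  have h1 : combY u * combY v + combY v * combY u
      = ∑ j, ∑ k, ((u j : ℂ) * v k) • (majY j * majY k + majY k * majY j) := by
    simp only [combY, sum_smul_mul_sum_smul, smul_add, Finset.sum_add_distrib]
    congr 1
    rw [Finset.sum_comm]
    simp only [mul_comm (u _ : ℂ)]
  rw [h1]
  simp only [majY_anticomm, smul_ite, smul_zero, Finset.sum_ite_eq, Finset.mem_univ, if_true,
    smul_smul, ← Finset.sum_smul]
  congr 1
  push_cast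
  rw [Finset.mul_sum]
  exact Finset.sum_congr rfl fun j _ => by ring

theorem combX_combY_anticomm (u v : Fin L → ℝ) :
    combX u * combY v + combY v * combX u = 0 := by
  have h1 : combX u * combY v + combY v * combX u
      = ∑ j, ∑ k, ((u j : ℂ) * v k) • (majX j * majY k + majY k * majX j) := by
    simp only [combX, combY, sum_smul_mul_sum_smul, smul_add, Finset.sum_add_distrib]
    congr 1
    rw [Finset.sum_comm]
    simp only [mul_comm (u _ : ℂ)]
  rw [h1]
  simp [majX_majY_anticomm]

theorem combX_sq {u : Fin L → ℝ} (hu : ∑ j, u j ^ 2 = 1) (x : Amp L) :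
    combX u (combX u x) = x := by
  have h := LinearMap.congr_fun (combX_anticomm u u) x
  have hu' : ∑ j, u j * u j = 1 := by rw [← hu]; exact Finset.sum_congr rfl fun j _ => by ring
  simp only [hu', LinearMap.add_apply, Module.End.mul_apply, LinearMap.smul_apply,
    Module.End.one_apply, ← two_smul ℂ (combX u (combX u x))] at h
  have h2 : (2 : ℂ) • combX u (combX u x) = (2 : ℂ) • x := by simpa using h
  exact smul_right_injective _ (two_ne_zero' ℂ) h2

theorem combY_sq {u : Fin L → ℝ} (hu : ∑ j, u j ^ 2 = 1) (x : Amp L) :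
    combY u (combY u x) = -x := by
  have h := LinearMap.congr_fun (combY_anticomm u u) x
  have hu' : ∑ j, u j * u j = 1 := by rw [← hu]; exact Finset.sum_congr rfl fun j _ => by ring
  simp only [hu', LinearMap.add_apply, Module.End.mul_apply, LinearMap.smul_apply,
    Module.End.one_apply, ← two_smul ℂ (combY u (combY u x))] at h
  have h2 : (2 : ℂ) • combY u (combY u x) = (2 : ℂ) • (-x) := by simpa using h
  exact smul_right_injective _ (two_ne_zero' ℂ) h2

/-! ### Parity sectors -/

/-- Vectors of given fermion parity. -/
def parSpace (L : ℕ) (p : ZMod 2) : Submodule ℂ (Amp L) where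
  carrier := {x | ∀ S, par S ≠ p → x S = 0}
  zero_mem' := fun _ _ => rfl
  add_mem' := fun hx hy S hS => by simp [hx S hS, hy S hS]
  smul_mem' := fun c x hx S hS => by simp [hx S hS]

theorem wflip_mem_parSpace {p : ZMod 2} {x : Amp L} (hx : x ∈ parSpace L p) (j : Fin L)
    (w : Finset (Fin L) → ℂ) : wflip j w x ∈ parSpace L (p + 1) := by
  intro S hS
  rw [wflip_apply, hx, mul_zero]
  rw [par_toggle]
  intro h
  exact hS (by rw [← h, add_one_add_one])

theorem combX_mem_parSpace {p : ZMod 2} {x : Amp L} (hx : x ∈ parSpace L p) (u : Fin L → ℝ) :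
    combX u x ∈ parSpace L (p + 1) := by
  simp only [combX, LinearMap.sum_apply, LinearMap.smul_apply]
  exact Submodule.sum_mem _ fun j _ => Submodule.smul_mem _ _ (wflip_mem_parSpace hx j _)

theorem combY_mem_parSpace {p : ZMod 2} {x : Amp L} (hx : x ∈ parSpace L p) (u : Fin L → ℝ) :
    combY u x ∈ parSpace L (p + 1) := by
  simp only [combY, LinearMap.sum_apply, LinearMap.smul_apply]
  exact Submodule.sum_mem _ fun j _ => Submodule.smul_mem _ _ (wflip_mem_parSpace hx j _)

/-! ### The Hamiltonian in terms of Majorana operators -/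

/-- The tridiagonal matrix of couplings between the two kinds of Majorana operators. -/
def coupling (L : ℕ) (t D μ : ℝ) : Matrix (Fin L) (Fin L) ℝ := fun j k =>
  if j = k then μ else if j.val + 1 = k.val then (t + D) / 2
    else if k.val + 1 = j.val then (t - D) / 2 else 0

/-- The Hamiltonian of the wire without charging energy, restricted to a sector of fixed particle
number and written as an operator on the Fock space of the wire. -/
def kitaev (L : ℕ) (t D μ : ℝ) : Module.End ℂ (Amp L) :=
  (1 / 2 : ℂ) • ∑ j, ∑ k, (coupling L t D μ j k : ℂ) • (majY j * majX k)

theorem kitaev_isSymmetric (t D μ : ℝ) : (kitaev L t D μ).IsSymmetric := by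
  intro x y
  have h : ∀ j k : Fin L, ⟪x, majX k (majY j y)⟫_ℂ = - ⟪x, majY j (majX k y)⟫_ℂ := by
    intro j k
    have h2 := LinearMap.congr_fun (majX_majY_anticomm k j) y
    simp only [LinearMap.add_apply, Module.End.mul_apply, LinearMap.zero_apply] at h2
    rw [eq_neg_of_add_eq_zero_left h2, inner_neg_right]
  simp only [kitaev, LinearMap.smul_apply, LinearMap.sum_apply, Module.End.mul_apply,
    inner_smul_left, inner_smul_right, sum_inner, inner_sum, Complex.conj_ofReal,
    inner_majY, inner_majX, h, neg_neg, map_div₀, map_one, Complex.conj_ofNat]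

/-- The commutator of a bilinear with a Majorana operator is again linear. This is what reduces the
search for modes from the Fock space to the `L × L` matrix `coupling`. -/
theorem commute_bilinear_majX (j k l : Fin L) :
    majY j * majX k * majX l - majX l * (majY j * majX k)
      = if k = l then (2 : ℂ) • majY j else 0 := by
  have h1 : majX l * majY j = -(majY j * majX l) :=
    eq_neg_of_add_eq_zero_left (majX_majY_anticomm l j)
  have h2 := majX_anticomm k l
  calc _ = majY j * (majX k * majX l) - (majX l * majY j) * majX k := by noncomm_ring
    _ = majY j * (majX k * majX l + majX l * majX k) := by rw [h1]; noncomm_ring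
    _ = _ := by rw [h2]; split_ifs <;> simp

theorem commute_bilinear_majY (j k l : Fin L) :
    majY j * majX k * majY l - majY l * (majY j * majX k)
      = if j = l then (2 : ℂ) • majX k else 0 := by
  have h1 : majX k * majY l = -(majY l * majX k) :=
    eq_neg_of_add_eq_zero_left (majX_majY_anticomm k l)
  have h2 := majY_anticomm j l
  calc _ = majY j * (majX k * majY l) - majY l * majY j * majX k := by noncomm_ring
    _ = -((majY j * majY l + majY l * majY j) * majX k) := by rw [h1]; noncomm_ring
    _ = _ := by rw [h2]; split_ifs <;> simp

theorem kitaev_majX (t D μ : ℝ) (l : Fin L) :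
    kitaev L t D μ * majX l - majX l * kitaev L t D μ
      = combY fun j => coupling L t D μ j l := by
  have h : kitaev L t D μ * majX l - majX l * kitaev L t D μ
      = (1 / 2 : ℂ) • ∑ j, ∑ k, (coupling L t D μ j k : ℂ) •
        (majY j * majX k * majX l - majX l * (majY j * majX k)) := by
    simp only [kitaev, smul_sub, Finset.sum_sub_distrib, Finset.mul_sum, Finset.sum_mul,
      smul_mul_assoc, mul_smul_comm]
  rw [h]
  simp only [commute_bilinear_majX, smul_ite, smul_zero, Finset.sum_ite_eq', Finset.mem_univ,
    if_true, Finset.smul_sum, smul_smul, combY]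
  refine Finset.sum_congr rfl fun j _ => ?_
  congr 1
  ring

theorem kitaev_majY (t D μ : ℝ) (l : Fin L) :
    kitaev L t D μ * majY l - majY l * kitaev L t D μ
      = combX fun k => coupling L t D μ l k := by
  have h : kitaev L t D μ * majY l - majY l * kitaev L t D μ
      = (1 / 2 : ℂ) • ∑ j, ∑ k, (coupling L t D μ j k : ℂ) •
        (majY j * majX k * majY l - majY l * (majY j * majX k)) := by
    simp only [kitaev, smul_sub, Finset.sum_sub_distrib, Finset.mul_sum, Finset.sum_mul,
      smul_mul_assoc, mul_smul_comm]
  rw [h, Finset.sum_comm]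
  simp only [commute_bilinear_majY, smul_ite, smul_zero, Finset.sum_ite_eq', Finset.mem_univ,
    if_true, Finset.smul_sum, smul_smul, combX]
  refine Finset.sum_congr rfl fun j _ => ?_
  congr 1
  ring

theorem kitaev_combX (t D μ : ℝ) (u : Fin L → ℝ) :
    kitaev L t D μ * combX u - combX u * kitaev L t D μ
      = combY ((coupling L t D μ).mulVec u) := by
  have h : kitaev L t D μ * combX u - combX u * kitaev L t D μ
      = ∑ l, (u l : ℂ) • (kitaev L t D μ * majX l - majX l * kitaev L t D μ) := by
    simp only [combX, smul_sub, Finset.sum_sub_distrib, Finset.mul_sum, Finset.sum_mul,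
      smul_mul_assoc, mul_smul_comm]
  rw [h]
  simp only [kitaev_majX, combY, Finset.smul_sum, smul_smul]
  rw [Finset.sum_comm]
  refine Finset.sum_congr rfl fun j _ => ?_
  rw [← Finset.sum_smul]
  congr 1
  simp [Matrix.mulVec, dotProduct, mul_comm]

theorem kitaev_combY (t D μ : ℝ) (v : Fin L → ℝ) :
    kitaev L t D μ * combY v - combY v * kitaev L t D μ
      = combX ((coupling L t D μ).transpose.mulVec v) := by
  have h : kitaev L t D μ * combY v - combY v * kitaev L t D μ
      = ∑ l, (v l : ℂ) • (kitaev L t D μ * majY l - majY l * kitaev L t D μ) := by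
    simp only [combY, smul_sub, Finset.sum_sub_distrib, Finset.mul_sum, Finset.sum_mul,
      smul_mul_assoc, mul_smul_comm]
  rw [h]
  simp only [kitaev_majY, combX, Finset.smul_sum, smul_smul]
  rw [Finset.sum_comm]
  refine Finset.sum_congr rfl fun j _ => ?_
  rw [← Finset.sum_smul]
  congr 1
  simp [Matrix.mulVec, dotProduct, mul_comm, Matrix.transpose]

/-! ### Lowest eigenvectors in an invariant subspace -/

section Lowest

variable {E : Type*} [NormedAddCommGroup E] [InnerProductSpace ℂ E]

/-- If the residual `z = T x - e x` were nonzero, moving from `x` a little in the direction `-z`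
would lower the energy to first order, against minimality on `W`. -/
theorem eigenvector_of_minimal {T : Module.End ℂ E} (hT : T.IsSymmetric) {W : Submodule ℂ E}
    (hW : ∀ x ∈ W, T x ∈ W) {e : ℝ} (hmin : ∀ y ∈ W, e * ‖y‖ ^ 2 ≤ (⟪y, T y⟫_ℂ).re)
    {x : E} (hx : x ∈ W) (hle : (⟪x, T x⟫_ℂ).re ≤ e * ‖x‖ ^ 2) : T x = (e : ℂ) • x := by
  set z : E := T x - (e : ℂ) • x with hz
  have hzW : z ∈ W := W.sub_mem (hW x hx) (W.smul_mem _ hx)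
  have hsq : ∀ y : E, ‖y‖ ^ 2 = (⟪y, y⟫_ℂ).re := fun y => by
    rw [inner_self_eq_norm_sq_to_K]; norm_cast
  by_contra hne
  have hz0 : 0 < ‖z‖ ^ 2 := by
    have : z ≠ 0 := fun h => hne (sub_eq_zero.1 h)
    positivity
  have hq : 0 ≤ (⟪z, T z⟫_ℂ).re - e * ‖z‖ ^ 2 := sub_nonneg.2 (hmin z hzW)
  set q := (⟪z, T z⟫_ℂ).re - e * ‖z‖ ^ 2 with hqdef
  have hzx : (⟪z, T x⟫_ℂ).re - e * (⟪z, x⟫_ℂ).re = ‖z‖ ^ 2 := by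
    have : ⟪z, z⟫_ℂ = ⟪z, T x⟫_ℂ - (e : ℂ) * ⟪z, x⟫_ℂ := by
      conv_lhs => rw [hz]
      rw [← hz, inner_sub_right, inner_smul_right]
    rw [hsq, this]; simp
  -- The quadratic form at `x - s z` changes by `-2 s ‖z‖² + s² q`; the step `s` chosen next makes
  -- `s q ≤ ‖z‖²`, so the linear term wins.
  have hxz : (⟪x, T z⟫_ℂ).re - e * (⟪x, z⟫_ℂ).re = ‖z‖ ^ 2 := by
    rw [← hzx, ← hT x z, ← inner_conj_symm (T x) z, ← inner_conj_symm x z, Complex.conj_re,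
      Complex.conj_re]
  set s : ℝ := ‖z‖ ^ 2 / (q + 1) with hs
  have hspos : 0 < s := by positivity
  have hy := hmin (x - (s : ℂ) • z) (W.sub_mem hx (W.smul_mem _ hzW))
  rw [hsq (x - (s : ℂ) • z)] at hy
  simp only [map_sub, map_smul, inner_sub_left, inner_sub_right, inner_smul_left,
    inner_smul_right, Complex.conj_ofReal, Complex.sub_re, Complex.re_ofReal_mul] at hy
  rw [← hsq, ← hsq] at hy
  have h2 : 2 * (s * ‖z‖ ^ 2) ≤ s * (s * q) := by
    rw [hqdef]
    linear_combination hy + hle - s * hzx - s * hxz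
  have h3 : 2 * ‖z‖ ^ 2 ≤ s * q := by
    have : s * (2 * ‖z‖ ^ 2) ≤ s * (s * q) := by linarith
    exact le_of_mul_le_mul_left this hspos
  have h4 : s * q ≤ ‖z‖ ^ 2 := by
    have : s * (q + 1) = ‖z‖ ^ 2 := by rw [hs]; field_simp
    nlinarith
  linarith

theorem exists_lowest [FiniteDimensional ℂ E] {T : Module.End ℂ E} (hT : T.IsSymmetric)
    {W : Submodule ℂ E} (hW : ∀ x ∈ W, T x ∈ W) (hne : W ≠ ⊥) :
    ∃ (e : ℝ) (x : E), x ∈ W ∧ ‖x‖ = 1 ∧ T x = (e : ℂ) • x ∧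
      ∀ y ∈ W, e * ‖y‖ ^ 2 ≤ (⟪y, T y⟫_ℂ).re := by
  have := FiniteDimensional.proper_rclike ℂ E
  obtain ⟨w, hwW, hw0⟩ := W.exists_mem_ne_zero_of_ne_bot hne
  have hTc : Continuous T := T.continuous_of_finiteDimensional
  have hnw : ‖w‖ ≠ 0 := norm_ne_zero_iff.2 hw0
  have hcomp : IsCompact (Metric.sphere (0 : E) 1 ∩ (W : Set E)) :=
    (isCompact_sphere _ _).inter_right W.closed_of_finiteDimensional
  have hnonempty : (Metric.sphere (0 : E) 1 ∩ (W : Set E)).Nonempty := by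
    refine ⟨((‖w‖⁻¹ : ℝ) : ℂ) • w, ?_, W.smul_mem _ hwW⟩
    rw [mem_sphere_zero_iff_norm, norm_smul, Complex.norm_real, norm_inv, norm_norm,
      inv_mul_cancel₀ hnw]
  obtain ⟨x, ⟨hx1, hxW⟩, hmin⟩ := hcomp.exists_isMinOn hnonempty
    (f := fun y => (⟪y, T y⟫_ℂ).re)
    (Complex.continuous_re.comp (continuous_id.inner hTc)).continuousOn
  have hx1' : ‖x‖ = 1 := mem_sphere_zero_iff_norm.1 hx1
  have hmin' : ∀ y ∈ W, (⟪x, T x⟫_ℂ).re * ‖y‖ ^ 2 ≤ (⟪y, T y⟫_ℂ).re := by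
    intro y hy
    by_cases hy0 : y = 0
    · simp [hy0]
    have hny : ‖y‖ ≠ 0 := norm_ne_zero_iff.2 hy0
    have h := hmin (show ((‖y‖⁻¹ : ℝ) : ℂ) • y ∈ Metric.sphere (0 : E) 1 ∩ (W : Set E) from
      ⟨by rw [mem_sphere_zero_iff_norm, norm_smul, Complex.norm_real, norm_inv, norm_norm,
          inv_mul_cancel₀ hny], W.smul_mem _ hy⟩)
    simp only [Set.mem_ofPred_eq, map_smul, inner_smul_left, inner_smul_right,
      Complex.conj_ofReal, Complex.re_ofReal_mul] at h
    calc _ ≤ (‖y‖⁻¹ * (‖y‖⁻¹ * (⟪y, T y⟫_ℂ).re)) * ‖y‖ ^ 2 := by gcongr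
      _ = _ := by field_simp
  exact ⟨(⟪x, T x⟫_ℂ).re, x, hxW, hx1',
    eigenvector_of_minimal hT hW hmin' hxW (by rw [hx1']; simp), hmin'⟩

end Lowest

/-! ### The Hamiltonian in the occupation number basis -/

/-- Minus the matrix element of the Hamiltonian for flipping the neighbouring sites `j`, `k`. -/
def bond (t D : ℝ) (j k : Fin L) (S : Finset (Fin L)) : ℝ :=
  if (j ∈ S ↔ k ∈ S) then D / 2 else t / 2

/-- For neighbouring sites the strings cancel up to the occupation of `j`. Hence the
nearest-neighbour terms carry no string in the occupation basis, the basis of the sign structure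
used for Perron-Frobenius. -/
theorem fsign_succ {j k : Fin L} (h : j.val + 1 = k.val) (S : Finset (Fin L)) :
    fsign k S = if j ∈ S then -fsign j S else fsign j S := by
  have hlt : ∀ i : Fin L, i < k ↔ i < j ∨ i = j := fun i => by
    rw [Fin.lt_def, Fin.lt_def, Fin.ext_iff]; omega
  split_ifs with hj
  · have : S.filter (· < k) = insert j (S.filter (· < j)) := by
      ext i
      simp only [Finset.mem_filter, Finset.mem_insert, hlt]
      constructor
      · rintro ⟨h1, h2 | h2⟩
        · exact Or.inr ⟨h1, h2⟩
        · exact Or.inl h2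
      · rintro (rfl | ⟨h1, h2⟩)
        · exact ⟨hj, Or.inr rfl⟩
        · exact ⟨h1, Or.inl h2⟩
    rw [fsign, fsign, this, Finset.card_insert_of_notMem (by simp), pow_succ]; ring
  · have : S.filter (· < k) = S.filter (· < j) := by
      ext i
      simp only [Finset.mem_filter, hlt, and_congr_right_iff, or_iff_left_iff_imp]
      rintro h1 rfl
      exact absurd h1 hj
    rw [fsign, fsign, this]

theorem majY_majX_self (j : Fin L) (x : Amp L) (S : Finset (Fin L)) :
    majY j (majX j x) S = (if j ∈ S then -1 else 1) * x S := by
  rw [majY_apply, majX_apply, fsign_toggle, if_neg (lt_irrefl j), toggle_toggle]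
  split_ifs
  · linear_combination (-x S) * fsign_mul_self j S
  · linear_combination x S * fsign_mul_self j S

theorem majY_majX_of_succ {j k : Fin L} (h : j.val + 1 = k.val) (x : Amp L)
    (S : Finset (Fin L)) :
    majY j (majX k x) S = -x (toggle j (toggle k S)) := by
  have hjk : j < k := by rw [Fin.lt_def]; omega
  rw [majY_apply, majX_apply, fsign_toggle, if_pos hjk, fsign_succ h, toggle_comm k j]
  split_ifs <;> linear_combination (-x (toggle j (toggle k S))) * fsign_mul_self j S

theorem majY_majX_of_succ' {j k : Fin L} (h : j.val + 1 = k.val) (x : Amp L)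
    (S : Finset (Fin L)) :
    majY k (majX j x) S = (if (j ∈ S ↔ k ∈ S) then 1 else -1) * x (toggle j (toggle k S)) := by
  have hjk : ¬ k < j := by rw [Fin.lt_def]; omega
  rw [majY_apply, majX_apply, fsign_toggle, if_neg hjk, fsign_succ h]
  by_cases h1 : j ∈ S <;> by_cases h2 : k ∈ S <;> 
    simp only [h1, h2, if_true, if_false, iff_true, iff_false, not_true, neg_neg]
  · linear_combination (x (toggle j (toggle k S))) * fsign_mul_self j S
  · linear_combination (-x (toggle j (toggle k S))) * fsign_mul_self j S
  · linear_combination (-x (toggle j (toggle k S))) * fsign_mul_self j S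
  · linear_combination (x (toggle j (toggle k S))) * fsign_mul_self j S

theorem sum_occupation (S : Finset (Fin L)) :
    ∑ j : Fin L, (if j ∈ S then (-1 : ℂ) else 1) = L - 2 * S.card := by
  have : ∀ j : Fin L, (if j ∈ S then (-1 : ℂ) else 1) = 1 - 2 * (if j ∈ S then 1 else 0) := by
    intro j; split_ifs <;> norm_num
  simp [this, Finset.sum_sub_distrib, mul_comm]

theorem coupling_eq (t D μ : ℝ) (j k : Fin L) :
    coupling L t D μ j k = (if j = k then μ else 0)
      + (if j.val + 1 = k.val then (t + D) / 2 else 0)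
      + (if k.val + 1 = j.val then (t - D) / 2 else 0) := by
  rw [coupling]
  by_cases h1 : j = k
  · subst h1; simp
  · by_cases h2 : j.val + 1 = k.val
    · have : ¬ k.val + 1 = j.val := by omega
      simp [h1, h2, this]
    · simp [h1, h2]

theorem kitaev_apply (t D μ : ℝ) (x : Amp L) (S : Finset (Fin L)) :
    kitaev L t D μ x S = ((-(μ * (S.card - L / 2)) : ℝ) : ℂ) * x S
      - ∑ j : Fin L, ∑ k : Fin L, if j.val + 1 = k.val then
          (bond t D j k S : ℂ) * x (toggle j (toggle k S)) else 0 := by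
  have h0 : kitaev L t D μ x S
      = (1 / 2 : ℂ) * ∑ j, ∑ k, (coupling L t D μ j k : ℂ) * (majY j (majX k x)) S := by
    simp [kitaev, LinearMap.sum_apply]
  have h1 : ∑ j : Fin L, ∑ k : Fin L, ((if j = k then μ else 0 : ℝ) : ℂ) * (majY j (majX k x)) S
      = μ * ((L : ℂ) - 2 * S.card) * x S := by
    rw [← sum_occupation]
    simp only [apply_ite Complex.ofReal, Complex.ofReal_zero, ite_mul, zero_mul,
      Finset.sum_ite_eq, Finset.mem_univ, if_true, Finset.mul_sum, Finset.sum_mul,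
      majY_majX_self]
    refine Finset.sum_congr rfl fun j _ => ?_
    split_ifs <;> ring
  have h2 : ∑ j : Fin L, ∑ k : Fin L, ((if j.val + 1 = k.val then (t + D) / 2 else 0 : ℝ) : ℂ)
        * (majY j (majX k x)) S
      = ∑ j : Fin L, ∑ k : Fin L, if j.val + 1 = k.val then
          -(((t + D) / 2 : ℝ) : ℂ) * x (toggle j (toggle k S)) else 0 := by
    refine Finset.sum_congr rfl fun j _ => Finset.sum_congr rfl fun k _ => ?_
    split_ifs with h
    · rw [majY_majX_of_succ h]; ring
    · simp
  have h3 : ∑ j : Fin L, ∑ k : Fin L, ((if k.val + 1 = j.val then (t - D) / 2 else 0 : ℝ) : ℂ)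
        * (majY j (majX k x)) S
      = ∑ j : Fin L, ∑ k : Fin L, if j.val + 1 = k.val then
          (((t - D) / 2 : ℝ) : ℂ) * ((if (j ∈ S ↔ k ∈ S) then 1 else -1)
            * x (toggle j (toggle k S))) else 0 := by
    rw [Finset.sum_comm]
    refine Finset.sum_congr rfl fun j _ => Finset.sum_congr rfl fun k _ => ?_
    split_ifs with h h'
    · rw [majY_majX_of_succ' h, if_pos h']
    · rw [majY_majX_of_succ' h, if_neg h']
    · simp
  rw [h0]
  simp only [coupling_eq, Complex.ofReal_add, add_mul, Finset.sum_add_distrib]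
  rw [h1, h2, h3]
  have h4 : ∀ F G H : Fin L → Fin L → ℂ, (∀ j k, F j k + G j k = -(2 * H j k)) →
      ∑ j, ∑ k, F j k + ∑ j, ∑ k, G j k = -(2 * ∑ j, ∑ k, H j k) := by
    intro F G H h
    simp only [Finset.mul_sum, ← Finset.sum_neg_distrib, ← Finset.sum_add_distrib, h]
  rw [add_assoc, h4 _ _ (fun j k => if j.val + 1 = k.val then
          (bond t D j k S : ℂ) * x (toggle j (toggle k S)) else 0)]
  · push_cast; ring
  · intro j k
    rw [bond]
    split_ifs <;> push_cast <;> ring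

theorem kitaev_mem_parSpace (t D μ : ℝ) {p : ZMod 2} {x : Amp L} (hx : x ∈ parSpace L p) :
    kitaev L t D μ x ∈ parSpace L p := by
  intro S hS
  rw [kitaev_apply, hx S hS]
  have : ∀ j k : Fin L, x (toggle j (toggle k S)) = 0 := fun j k => hx _ (by
    rwa [par_toggle, par_toggle, add_one_add_one])
  simp [this]

/-! ### Positivity of the ground states -/

theorem symmDiff_toggle_toggle (j : Fin L) (S A : Finset (Fin L)) :
    symmDiff (toggle j S) (toggle j A) = symmDiff S A := by
  ext i
  simp only [toggle, Finset.mem_symmDiff]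
  tauto

/-- Hopping of one or two particles between neighbouring sites connects all configurations of
equal parity. -/
theorem forall_of_neighbour_closed {Z : Finset (Fin L) → Prop}
    (hZ : ∀ (j k : Fin L) S, j.val + 1 = k.val → Z S → Z (toggle j (toggle k S)))
    {S S' : Finset (Fin L)} (hS : Z S) (hpar : par S = par S') : Z S' := by
  -- Distant sites are toggled together through a chain of neighbours; each intermediate site is
  -- toggled twice.
  have hdist : ∀ (d : ℕ) (j k : Fin L) S, j.val + d + 1 = k.val → Z S →
      Z (toggle j (toggle k S)) := by
    intro d
    induction d with
    | zero => exact fun j k S h => hZ j k S (by simpa using h)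
    | succ d ih =>
      intro j k S h hS
      have h1 := hZ ⟨j.val + d + 1, by omega⟩ k S (by simp; omega) hS
      have h2 := ih j ⟨j.val + d + 1, by omega⟩ _ rfl h1
      rwa [toggle_toggle] at h2
  have hpair : ∀ (j k : Fin L) S, j ≠ k → Z S → Z (toggle j (toggle k S)) := by
    intro j k S h hS
    rcases lt_or_gt_of_ne h with h' | h'
    · exact hdist (k.val - j.val - 1) j k S (by rw [Fin.lt_def] at h'; omega) hS
    · rw [toggle_comm]
      exact hdist (j.val - k.val - 1) k j S (by rw [Fin.lt_def] at h'; omega) hS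
  -- A set of even size is removed two sites at a time; two configurations of equal parity differ by
  -- such a set.
  have hdiff : ∀ (n : ℕ) (A S : Finset (Fin L)), A.card = n → par A = 0 → Z S →
      Z (symmDiff S A) := by
    intro n
    induction n using Nat.strong_induction_on with
    | _ n ih =>
      intro A S hn hA hS
      rcases A.eq_empty_or_nonempty with rfl | ⟨j, hj⟩
      · rwa [← Finset.bot_eq_empty, symmDiff_bot]
      have hj2 : (A.erase j).Nonempty := by
        rw [Finset.nonempty_iff_ne_empty, ← toggle_of_mem hj]
        intro h
        have h2 := par_toggle j A
        rw [h, hA] at h2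
        exact absurd h2 (by simp [par])
      obtain ⟨k, hk⟩ := hj2
      have hkj : k ≠ j := Finset.ne_of_mem_erase hk
      have hS1 := hpair j k S hkj.symm hS
      have h3 := ih ((A.erase j).erase k).card
        (by
          rw [← hn]
          exact (Finset.card_erase_lt_of_mem hk).trans (Finset.card_erase_lt_of_mem hj))
        ((A.erase j).erase k) _ rfl
        (by
          rw [← toggle_of_mem hj] at hk ⊢
          rw [← toggle_of_mem hk, par_toggle, par_toggle, hA]; decide) hS1
      convert h3 using 1
      rw [← toggle_of_mem hk, ← toggle_of_mem hj, toggle_comm j k S, symmDiff_toggle_toggle,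
        symmDiff_toggle_toggle]
  have h := hdiff _ (symmDiff S S') S rfl ?_ hS
  · rwa [symmDiff_symmDiff_cancel_left] at h
  · have hcard : (symmDiff S S').card + 2 * (S ∩ S').card = S.card + S'.card := by
      have h1 := Finset.card_sdiff_add_card_inter S S'
      have h2 := Finset.card_sdiff_add_card_inter S' S
      rw [Finset.inter_comm S' S] at h2
      have h3 : (symmDiff S S').card = (S \ S').card + (S' \ S).card :=
        Finset.card_union_of_disjoint disjoint_sdiff_sdiff
      omega
    have := congrArg (Nat.cast : ℕ → ZMod 2) hcard
    push_cast at this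
    rw [show (2 : ZMod 2) = 0 from rfl, zero_mul, add_zero] at this
    rw [par, this]
    change par S + par S' = 0
    rw [hpar]
    exact CharTwo.add_self_eq_zero _

/-- The vector with real amplitudes `r`. -/
def ofRe (r : Finset (Fin L) → ℝ) : Amp L := WithLp.toLp 2 fun S => (r S : ℂ)

@[simp] theorem ofRe_apply (r : Finset (Fin L) → ℝ) (S : Finset (Fin L)) :
    ofRe r S = (r S : ℂ) := rfl

theorem re_inner_kitaev (t D μ : ℝ) (x : Amp L) :
    (⟪x, kitaev L t D μ x⟫_ℂ).re = ∑ S, (-(μ * (S.card - L / 2)) * ‖x S‖ ^ 2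
      - ∑ j : Fin L, ∑ k : Fin L, if j.val + 1 = k.val then
          bond t D j k S * ((starRingEnd ℂ) (x S) * x (toggle j (toggle k S))).re else 0) := by
  rw [inner_amp, Complex.re_sum]
  refine Finset.sum_congr rfl fun S _ => ?_
  rw [kitaev_apply, mul_sub, Complex.sub_re]
  congr 1
  · rw [mul_left_comm, Complex.re_ofReal_mul, mul_comm _ (x S), Complex.mul_conj,
      Complex.ofReal_re, Complex.normSq_eq_norm_sq]
  · simp only [Finset.mul_sum, Complex.re_sum]
    refine Finset.sum_congr rfl fun j _ => Finset.sum_congr rfl fun k _ => ?_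
    split_ifs
    · rw [mul_left_comm, Complex.re_ofReal_mul]
    · simp

theorem bond_pos {t D : ℝ} (ht : 0 < t) (hD : 0 < D) (j k : Fin L) (S : Finset (Fin L)) :
    0 < bond t D j k S := by
  rw [bond]; split_ifs <;> positivity

/-- The diagonal part depends only on the moduli, and the off-diagonal elements `-bond` are
negative, so aligning all phases can only lower the energy. -/
theorem re_inner_kitaev_norm_le {t D : ℝ} (ht : 0 < t) (hD : 0 < D) (μ : ℝ) (x : Amp L) :
    (⟪ofRe fun S => ‖x S‖, kitaev L t D μ (ofRe fun S => ‖x S‖)⟫_ℂ).re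
      ≤ (⟪x, kitaev L t D μ x⟫_ℂ).re := by
  rw [re_inner_kitaev, re_inner_kitaev]
  refine Finset.sum_le_sum fun S _ => ?_
  refine sub_le_sub (by simp) (Finset.sum_le_sum fun j _ => Finset.sum_le_sum fun k _ => ?_)
  split_ifs
  · refine mul_le_mul_of_nonneg_left ?_ (bond_pos ht hD j k S).le
    refine (Complex.re_le_norm _).trans ?_
    rw [ofRe_apply, ofRe_apply, Complex.conj_ofReal, ← Complex.ofReal_mul, Complex.ofReal_re,
      norm_mul, RCLike.norm_conj]
  · exact le_rfl

theorem norm_ofRe_norm (x : Amp L) : ‖ofRe fun S => ‖x S‖‖ = ‖x‖ := by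
  simp [EuclideanSpace.norm_eq]

/-- At a zero of `r` the eigenvalue equation says that a sum of nonnegative terms over the
neighbouring configurations vanishes. The zero thus spreads to all configurations of the same
parity. -/
theorem ne_zero_of_nonneg_eigenvector {t D : ℝ} (ht : 0 < t) (hD : 0 < D) {μ e : ℝ} {p : ZMod 2}
    {r : Finset (Fin L) → ℝ} (hr : ∀ S, 0 ≤ r S) (hp : ofRe r ∈ parSpace L p)
    (he : kitaev L t D μ (ofRe r) = (e : ℂ) • ofRe r) (h0 : ofRe r ≠ 0)
    {S : Finset (Fin L)} (hS : par S = p) : r S ≠ 0 := by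
  intro hrS
  apply h0
  ext S'
  by_cases hS' : par S' = p
  swap
  · exact hp S' hS'
  have : r S' = 0 := by
    refine forall_of_neighbour_closed (Z := fun S => r S = 0) ?_ hrS (hS.trans hS'.symm)
    intro j k S hjk hrS
    have h1 := congrArg (fun y : Amp L => y S) he
    simp only [kitaev_apply, ofRe_apply, hrS, PiLp.smul_apply, Complex.ofReal_zero, mul_zero,
      zero_sub, smul_zero, neg_eq_zero] at h1
    have h2 : ∑ j : Fin L, ∑ k : Fin L, (if j.val + 1 = k.val then
        bond t D j k S * r (toggle j (toggle k S)) else 0) = 0 := by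
      apply Complex.ofReal_injective
      push_cast
      rw [← h1]
      simp [apply_ite Complex.ofReal]
    have hnn : ∀ j k : Fin L, 0 ≤ (if j.val + 1 = k.val then
        bond t D j k S * r (toggle j (toggle k S)) else 0) := by
      intro j k
      split_ifs
      · exact mul_nonneg (bond_pos ht hD j k S).le (hr _)
      · exact le_rfl
    rw [Finset.sum_eq_zero_iff_of_nonneg fun j _ => Finset.sum_nonneg fun k _ => hnn j k] at h2
    have h3 := h2 j (Finset.mem_univ _)
    rw [Finset.sum_eq_zero_iff_of_nonneg fun k _ => hnn j k] at h3
    have h4 := h3 k (Finset.mem_univ _)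
    rw [if_pos hjk] at h4
    exact (mul_eq_zero.1 h4).resolve_left (bond_pos ht hD j k S).ne'
  simp [this]

/-- `r` is the positive normalized ground state, with energy `e`, of the Hamiltonian in the
sector of parity `p`, and this ground state is unique. -/
structure IsPerron (t D μ : ℝ) (p : ZMod 2) (e : ℝ) (r : Finset (Fin L) → ℝ) : Prop where
  pos : ∀ S, par S = p → 0 < r S
  mem : ofRe r ∈ parSpace L p
  norm_eq : ‖ofRe r‖ = 1
  eigen : kitaev L t D μ (ofRe r) = (e : ℂ) • ofRe r
  le : ∀ y ∈ parSpace L p, e * ‖y‖ ^ 2 ≤ (⟪y, kitaev L t D μ y⟫_ℂ).re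
  unique : ∀ y ∈ parSpace L p, kitaev L t D μ y = (e : ℂ) • y → ∃ z : ℂ, y = z • ofRe r

theorem exists_par_eq (hL : 0 < L) (p : ZMod 2) : ∃ S : Finset (Fin L), par S = p := by
  rcases eq_or_eq_add_one p 0 with rfl | rfl
  · exact ⟨∅, by simp [par]⟩
  · exact ⟨{⟨0, hL⟩}, by simp [par]⟩

theorem parSpace_ne_bot (hL : 0 < L) (p : ZMod 2) : parSpace L p ≠ ⊥ := by
  obtain ⟨S, hS⟩ := exists_par_eq hL p
  intro h
  have hm : EuclideanSpace.single S (1 : ℂ) ∈ parSpace L p := by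
    intro S' hS'
    have : S' ≠ S := by rintro rfl; exact hS' hS
    simp [this]
  rw [h, Submodule.mem_bot] at hm
  simpa using congrArg (fun y : Amp L => y S) hm

theorem exists_isPerron (hL : 0 < L) {t D : ℝ} (ht : 0 < t) (hD : 0 < D) (μ : ℝ) (p : ZMod 2) :
    ∃ (e : ℝ) (r : Finset (Fin L) → ℝ), IsPerron t D μ p e r := by
  obtain ⟨e, x, hxp, hx1, hex, hmin⟩ := exists_lowest (kitaev_isSymmetric t D μ)
    (W := parSpace L p) (fun x hx => kitaev_mem_parSpace t D μ hx) (parSpace_ne_bot hL p)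
  have habs : ∀ y ∈ parSpace L p, kitaev L t D μ y = (e : ℂ) • y →
      ofRe (fun S => ‖y S‖) ∈ parSpace L p ∧
      kitaev L t D μ (ofRe fun S => ‖y S‖) = (e : ℂ) • ofRe fun S => ‖y S‖ := by
    intro y hy hey
    have hm : ofRe (fun S => ‖y S‖) ∈ parSpace L p := fun S hS => by simp [hy S hS]
    refine ⟨hm, eigenvector_of_minimal (kitaev_isSymmetric t D μ)
      (fun x hx => kitaev_mem_parSpace t D μ hx) hmin hm ?_⟩
    refine (re_inner_kitaev_norm_le ht hD μ y).trans ?_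
    rw [hey, norm_ofRe_norm, inner_smul_right, Complex.re_ofReal_mul,
      inner_self_eq_norm_sq_to_K]
    norm_cast
  have hne : ∀ y ∈ parSpace L p, kitaev L t D μ y = (e : ℂ) • y → y ≠ 0 →
      ∀ S, par S = p → 0 < ‖y S‖ := by
    intro y hy hey hy0 S hS
    have h := habs y hy hey
    refine lt_of_le_of_ne (norm_nonneg _) (Ne.symm ?_)
    refine ne_zero_of_nonneg_eigenvector ht hD (r := fun S => ‖y S‖) (fun S => norm_nonneg _)
      h.1 h.2 ?_ hS
    rw [← norm_ne_zero_iff, norm_ofRe_norm]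
    exact norm_ne_zero_iff.2 hy0
  have hx0 : x ≠ 0 := by
    rw [← norm_ne_zero_iff, hx1]; exact one_ne_zero
  obtain ⟨hm, he⟩ := habs x hxp hex
  refine ⟨e, fun S => ‖x S‖, hne x hxp hex hx0, hm, by rw [norm_ofRe_norm, hx1], he, hmin, ?_⟩
  intro y hy hey
  obtain ⟨S, hS⟩ := exists_par_eq hL p
  have hpos := hne x hxp hex hx0 S hS
  refine ⟨y S / ‖x S‖, ?_⟩
  by_contra hneq
  -- A second independent ground state would give a combination vanishing at `S`, whereas a nonzero
  -- ground state vanishes nowhere in its parity sector.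
  set w : Amp L := y - (y S / ‖x S‖) • ofRe fun S => ‖x S‖ with hw
  have h := hne w ((parSpace L p).sub_mem hy ((parSpace L p).smul_mem _ hm))
    (by rw [hw, map_sub, map_smul, hey, he, smul_sub, smul_comm]) (sub_ne_zero.2 hneq) S hS
  refine absurd h (not_lt.2 (le_of_eq ?_))
  have hc : (‖x S‖ : ℂ) ≠ 0 := by exact_mod_cast hpos.ne'
  rw [hw, PiLp.sub_apply, PiLp.smul_apply, ofRe_apply, smul_eq_mul, div_mul_cancel₀ _ hc, sub_self,
    norm_zero]

/-! ### Quasiparticle modes -/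

/-- The operators `combX u` and `combY v` are the two halves of a quasiparticle mode of
energy `ε`. -/
structure IsFockMode (t D μ ε : ℝ) (u v : Fin L → ℝ) : Prop where
  norm_u : ∑ j, u j ^ 2 = 1
  norm_v : ∑ j, v j ^ 2 = 1
  comm_u : kitaev L t D μ * combX u - combX u * kitaev L t D μ = (-(ε : ℂ)) • combY v
  comm_v : kitaev L t D μ * combY v - combY v * kitaev L t D μ = (-(ε : ℂ)) • combX u

theorem majX_eq_combX (j : Fin L) : majX j = combX (Pi.single j 1) := by
  simp [combX, Pi.single_apply]

theorem majY_eq_combY (j : Fin L) : majY j = combY (Pi.single j 1) := by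
  simp [combY, Pi.single_apply]

theorem sq_norm_amp (x : Amp L) : ⟪x, x⟫_ℂ = ((‖x‖ ^ 2 : ℝ) : ℂ) := by
  rw [inner_self_eq_norm_sq_to_K]; norm_cast

section Modes

variable {t D μ ε : ℝ} {u v : Fin L → ℝ} {e : ZMod 2 → ℝ} {r : ZMod 2 → Finset (Fin L) → ℝ}

theorem IsPerron.inner_self {p : ZMod 2} {e : ℝ} {r : Finset (Fin L) → ℝ}
    (h : IsPerron t D μ p e r) : ⟪ofRe r, ofRe r⟫_ℂ = 1 := by
  rw [sq_norm_amp, h.norm_eq]; norm_num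

theorem IsPerron.ne_zero {p : ZMod 2} {e : ℝ} {r : Finset (Fin L) → ℝ}
    (h : IsPerron t D μ p e r) : ofRe r ≠ 0 := by
  rw [← norm_ne_zero_iff, h.norm_eq]; exact one_ne_zero

theorem IsPerron.le_of_eigen {p : ZMod 2} {e e' : ℝ} {r : Finset (Fin L) → ℝ}
    (h : IsPerron t D μ p e r) {y : Amp L} (hy : y ∈ parSpace L p)
    (hey : kitaev L t D μ y = (e' : ℂ) • y) (h0 : y ≠ 0) : e ≤ e' := by
  have h1 := h.le y hy
  rw [hey, inner_smul_right, sq_norm_amp, Complex.re_ofReal_mul, Complex.ofReal_re] at h1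
  have : 0 < ‖y‖ ^ 2 := by
    have := norm_pos_iff.2 h0
    positivity
  exact le_of_mul_le_mul_right h1 this

/-- `combX u + s combY v` is an eigenvector of the commutator with the Hamiltonian, with eigenvalue
`-s ε`. Both signs `s` are treated together, since it is not known which one is the annihilator. -/
theorem IsFockMode.kitaev_ladder (hm : IsFockMode t D μ ε u v) {s : ℝ} (hs : s * s = 1)
    {a : ℝ} {x : Amp L} (hx : kitaev L t D μ x = (a : ℂ) • x) :
    kitaev L t D μ (combX u x + (s : ℂ) • combY v x)
      = ((a - s * ε : ℝ) : ℂ) • (combX u x + (s : ℂ) • combY v x) := by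
  have h1 := LinearMap.congr_fun hm.comm_u x
  have h2 := LinearMap.congr_fun hm.comm_v x
  simp only [LinearMap.sub_apply, Module.End.mul_apply, LinearMap.smul_apply, hx, map_smul,
    sub_eq_iff_eq_add] at h1 h2
  have hs' : (s : ℂ) * s = 1 := by exact_mod_cast hs
  rw [map_add, map_smul, h1, h2]
  push_cast
  match_scalars
  · linear_combination (ε : ℂ) * hs'
  · ring

theorem IsFockMode.eq_zero_or (hm : IsFockMode t D μ ε u v)
    (hP : ∀ p, IsPerron t D μ p (e p) (r p)) {s : ℝ} (hs : s * s = 1) (p : ZMod 2) :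
    combX u (ofRe (r p)) + (s : ℂ) • combY v (ofRe (r p)) = 0 ∨ e (p + 1) ≤ e p - s * ε := by
  rw [or_iff_not_imp_left]
  intro h0
  refine (hP (p + 1)).le_of_eigen ?_ (hm.kitaev_ladder hs (hP p).eigen) h0
  exact Submodule.add_mem _ (combX_mem_parSpace (hP p).mem u)
    (Submodule.smul_mem _ _ (combY_mem_parSpace (hP p).mem v))

/-- The two ladder operators cannot both kill the ground state: their sum is `2 combX u`, and `combX
u` squares to one. A surviving image has the other parity and energy at most `e p + |ε|`. -/
theorem IsFockMode.sub_le_abs (hm : IsFockMode t D μ ε u v)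
    (hP : ∀ p, IsPerron t D μ p (e p) (r p)) (p : ZMod 2) : e (p + 1) - e p ≤ |ε| := by
  rcases hm.eq_zero_or hP (s := 1) (by norm_num) p with h1 | h1
  · rcases hm.eq_zero_or hP (s := -1) (by norm_num) p with h2 | h2
    · exfalso
      have h3 : (2 : ℂ) • combX u (ofRe (r p)) = 0 := by
        rw [← add_zero (0 : Amp L)]
        nth_rewrite 1 [← h1]
        rw [← h2]
        push_cast
        module
      have h4 := (smul_eq_zero.1 h3).resolve_left two_ne_zero
      have h5 := combX_sq hm.norm_u (ofRe (r p))
      rw [h4, map_zero] at h5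
      exact (hP p).ne_zero h5.symm
    · have := le_abs_self ε
      linarith
  · have := neg_abs_le ε
    linarith

theorem IsFockMode.abs_sub_le_abs (hm : IsFockMode t D μ ε u v)
    (hP : ∀ p, IsPerron t D μ p (e p) (r p)) : |e 1 - e 0| ≤ |ε| := by
  have h0 := hm.sub_le_abs hP 0
  have h1 := hm.sub_le_abs hP 1
  rw [zero_add] at h0
  rw [show (1 + 1 : ZMod 2) = 0 from rfl] at h1
  exact abs_le.2 ⟨by linarith, h0⟩

theorem inner_ofRe_majX (a b : Finset (Fin L) → ℝ) (j : Fin L) :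
    ⟪ofRe a, majX j (ofRe b)⟫_ℂ = ((⟪ofRe a, majX j (ofRe b)⟫_ℂ).re : ℂ) := by
  rw [eq_comm, ← Complex.conj_eq_iff_re, inner_amp]
  simp [majX_apply]

theorem inner_ofRe_majY (a b : Finset (Fin L) → ℝ) (j : Fin L) :
    ⟪ofRe a, majY j (ofRe b)⟫_ℂ = ((⟪ofRe a, majY j (ofRe b)⟫_ℂ).re : ℂ) := by
  rw [eq_comm, ← Complex.conj_eq_iff_re, inner_amp]
  simp [majY_apply, apply_ite (starRingEnd ℂ)]

theorem inner_ofRe_combX (a b : Finset (Fin L) → ℝ) (u : Fin L → ℝ) :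
    ⟪ofRe a, combX u (ofRe b)⟫_ℂ
      = ((∑ j, u j * (⟪ofRe a, majX j (ofRe b)⟫_ℂ).re : ℝ) : ℂ) := by
  simp only [combX, LinearMap.sum_apply, LinearMap.smul_apply, inner_sum, inner_smul_right,
    Complex.ofReal_sum, Complex.ofReal_mul, ← inner_ofRe_majX]

theorem inner_ofRe_combY (a b : Finset (Fin L) → ℝ) (u : Fin L → ℝ) :
    ⟪ofRe a, combY u (ofRe b)⟫_ℂ
      = ((∑ j, u j * (⟪ofRe a, majY j (ofRe b)⟫_ℂ).re : ℝ) : ℂ) := by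
  simp only [combY, LinearMap.sum_apply, LinearMap.smul_apply, inner_sum, inner_smul_right,
    Complex.ofReal_sum, Complex.ofReal_mul, ← inner_ofRe_majY]

/-- From the parity of lower energy, each ladder image is either zero or must sit exactly at the
other ground-state energy, where the eigenspace is one-dimensional. -/
theorem IsFockMode.exists_smul (hm : IsFockMode t D μ ε u v)
    (hP : ∀ p, IsPerron t D μ p (e p) (r p)) (hε : |ε| = |e 1 - e 0|) (p : ZMod 2) :
    ∃ a b : ℂ, combX u (ofRe (r p)) = a • ofRe (r (p + 1)) ∧
      combY v (ofRe (r p)) = b • ofRe (r (p + 1)) := by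
  have key : ∀ q : ZMod 2, |ε| = e (q + 1) - e q → ∃ a b : ℂ,
      combX u (ofRe (r q)) = a • ofRe (r (q + 1)) ∧
      combY v (ofRe (r q)) = b • ofRe (r (q + 1)) := by
    intro q hq
    have h : ∀ s : ℝ, s * s = 1 → s * ε ≥ -|ε| → ∃ z : ℂ,
        combX u (ofRe (r q)) + (s : ℂ) • combY v (ofRe (r q)) = z • ofRe (r (q + 1)) := by
      intro s hs hsε
      rcases hm.eq_zero_or hP hs q with h1 | h1
      · exact ⟨0, by rw [h1, zero_smul]⟩
      · have h2 : e q - s * ε = e (q + 1) := by linarith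
        refine (hP (q + 1)).unique _ ?_ ?_
        · exact Submodule.add_mem _ (combX_mem_parSpace (hP q).mem u)
            (Submodule.smul_mem _ _ (combY_mem_parSpace (hP q).mem v))
        · rw [hm.kitaev_ladder hs (hP q).eigen, h2]
    obtain ⟨z, hz⟩ := h 1 (by norm_num) (by rw [one_mul]; exact neg_abs_le ε)
    obtain ⟨w, hw⟩ := h (-1) (by norm_num) (by have := le_abs_self ε; linarith)
    refine ⟨(z + w) / 2, (z - w) / 2, ?_, ?_⟩
    · have h3 := congrArg₂ (fun a b => (1 / 2 : ℂ) • (a + b)) hz hw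
      simp only [← add_smul, smul_smul] at h3
      rw [show (z + w) / 2 = 1 / 2 * (z + w) by ring, ← h3]
      push_cast
      module
    · have h3 := congrArg₂ (fun a b => (1 / 2 : ℂ) • (a - b)) hz hw
      simp only [← sub_smul, smul_smul] at h3
      rw [show (z - w) / 2 = 1 / 2 * (z - w) by ring, ← h3]
      push_cast
      module
  -- For the other parity the relations are inverted using the squares of `combX u` and `combY v`.
  have key' : ∀ q : ZMod 2, |ε| = e (q + 1) - e q → ∃ a b : ℂ,
      combX u (ofRe (r (q + 1))) = a • ofRe (r (q + 1 + 1)) ∧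
      combY v (ofRe (r (q + 1))) = b • ofRe (r (q + 1 + 1)) := by
    intro q hq
    obtain ⟨a, b, ha, hb⟩ := key q hq
    have h1 := combX_sq hm.norm_u (ofRe (r q))
    have h2 := combY_sq hm.norm_v (ofRe (r q))
    rw [ha, map_smul] at h1
    rw [hb, map_smul] at h2
    have ha0 : a ≠ 0 := by
      rintro rfl
      exact (hP q).ne_zero (by rw [← h1, zero_smul])
    have hb0 : b ≠ 0 := by
      rintro rfl
      exact (hP q).ne_zero (by rw [← neg_eq_zero, ← h2, zero_smul])
    rw [add_one_add_one]
    refine ⟨a⁻¹, -b⁻¹, ?_, ?_⟩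
    · rw [← h1, smul_smul, inv_mul_cancel₀ ha0, one_smul]
    · rw [neg_smul, ← smul_neg, ← h2, smul_smul, inv_mul_cancel₀ hb0, one_smul]
  have h01 : (1 + 1 : ZMod 2) = 0 := rfl
  rcases le_total (e 0) (e 1) with hle | hle
  · rw [abs_of_nonneg (sub_nonneg.2 hle)] at hε
    rcases eq_or_eq_add_one p 0 with rfl | rfl
    · exact key 0 (by rw [zero_add]; exact hε)
    · exact key' 0 (by rw [zero_add]; exact hε)
  · rw [abs_sub_comm, abs_of_nonneg (sub_nonneg.2 hle)] at hε
    rcases eq_or_eq_add_one p 1 with rfl | rfl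
    · exact key 1 (by rw [h01]; exact hε)
    · exact key' 1 (by rw [h01]; exact hε)

theorem IsFockMode.exists_sign_smul (hm : IsFockMode t D μ ε u v)
    (hP : ∀ p, IsPerron t D μ p (e p) (r p)) (hε : |ε| = |e 1 - e 0|) (p : ZMod 2) :
    ∃ a b : ℝ, a * a = 1 ∧ b * b = 1 ∧ combX u (ofRe (r p)) = (a : ℂ) • ofRe (r (p + 1)) ∧
      combY v (ofRe (r p)) = (b : ℂ) • ofRe (r (p + 1)) := by
  obtain ⟨a, b, ha, hb⟩ := hm.exists_smul hP hε p
  have ha' := inner_ofRe_combX (r (p + 1)) (r p) u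
  have hb' := inner_ofRe_combY (r (p + 1)) (r p) v
  rw [ha, inner_smul_right, (hP (p + 1)).inner_self, mul_one] at ha'
  rw [hb, inner_smul_right, (hP (p + 1)).inner_self, mul_one] at hb'
  rw [ha'] at ha
  rw [hb'] at hb
  refine ⟨_, _, ?_, ?_, ha, hb⟩
  · have h1 := inner_combX u (ofRe (r p)) (combX u (ofRe (r p)))
    rw [combX_sq hm.norm_u, (hP p).inner_self, ha, inner_smul_left, inner_smul_right,
      (hP (p + 1)).inner_self, Complex.conj_ofReal, mul_one] at h1
    exact_mod_cast h1
  · have h1 := inner_combY v (ofRe (r p)) (combY v (ofRe (r p)))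
    rw [combY_sq hm.norm_v, inner_neg_right, neg_neg, (hP p).inner_self, hb, inner_smul_left,
      inner_smul_right, (hP (p + 1)).inner_self, Complex.conj_ofReal, mul_one] at h1
    exact_mod_cast h1

/-- Each mode is either empty or filled in the ground state of each parity sector. -/
theorem IsFockMode.exists_sign_annihilates (hm : IsFockMode t D μ ε u v)
    (hP : ∀ p, IsPerron t D μ p (e p) (r p)) (p : ZMod 2) :
    ∃ s : ℝ, s * s = 1 ∧ combX u (ofRe (r p)) + (s : ℂ) • combY v (ofRe (r p)) = 0 := by
  -- For a minimal mode both operators give `±` the same vector, so a relative sign makes them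
  -- cancel. For any other mode the ladder operator lowering the energy by `|ε|` would reach below
  -- the ground-state energy of the opposite parity.
  rcases (hm.abs_sub_le_abs hP).eq_or_lt with h | h
  · obtain ⟨a, b, ha, hb, hX, hY⟩ := hm.exists_sign_smul hP h.symm p
    refine ⟨-(a * b), by linear_combination (b * b) * ha + hb, ?_⟩
    have hb' : (b : ℂ) * b = 1 := by exact_mod_cast hb
    rw [hX, hY, smul_smul, ← add_smul]
    push_cast
    rw [show (a : ℂ) + -(a * b) * b = a * (1 - b * b) by ring, hb', sub_self, mul_zero, zero_smul]
  · have hlt : ∀ q : ZMod 2, e q - |ε| < e (q + 1) := by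
      intro q
      have h1 := neg_abs_le (e 1 - e 0)
      have h2 := le_abs_self (e 1 - e 0)
      rcases eq_or_eq_add_one q 0 with rfl | rfl
      · rw [zero_add]; linarith
      · rw [show (0 + 1 + 1 : ZMod 2) = 0 from rfl, zero_add]; linarith
    obtain ⟨s, hs, hsε⟩ : ∃ s : ℝ, s * s = 1 ∧ s * ε = |ε| := by
      rcases le_total 0 ε with h0 | h0
      · exact ⟨1, by norm_num, by rw [abs_of_nonneg h0, one_mul]⟩
      · exact ⟨-1, by norm_num, by rw [abs_of_nonpos h0]; ring⟩
    refine ⟨s, hs, (hm.eq_zero_or hP hs p).resolve_right ?_⟩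
    rw [hsε, not_le]
    exact hlt p

/-! ### The edge mode -/

/-- Amplitudes of the left edge operator. -/
def edgeX (r : ZMod 2 → Finset (Fin L) → ℝ) (j : Fin L) : ℝ :=
  (⟪ofRe (r 1), majX j (ofRe (r 0))⟫_ℂ).re

/-- Amplitudes of the right edge operator. -/
def edgeY (r : ZMod 2 → Finset (Fin L) → ℝ) (j : Fin L) : ℝ :=
  -(⟪ofRe (r 1), majY j (ofRe (r 0))⟫_ℂ).re

theorem sum_pos_of_perron (hL : 0 < L) (hP : ∀ p, IsPerron t D μ p (e p) (r p)) (j : Fin L) :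
    0 < ∑ S, r 1 S * r 0 (toggle j S) := by
  have hnn : ∀ (p : ZMod 2) (S : Finset (Fin L)), 0 ≤ r p S := by
    intro p S
    by_cases hS : par S = p
    · exact ((hP p).pos S hS).le
    · have := (hP p).mem S hS
      rw [ofRe_apply, Complex.ofReal_eq_zero] at this
      exact this.ge
  obtain ⟨S, hS⟩ := exists_par_eq hL 1
  refine Finset.sum_pos' (fun S _ => mul_nonneg (hnn _ _) (hnn _ _)) ⟨S, Finset.mem_univ _, ?_⟩
  exact mul_pos ((hP 1).pos S hS) ((hP 0).pos _ (by rw [par_toggle, hS]; rfl))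

/-- No site lies to the left of the first one, so the string is `1` and the matrix element is a sum
of products of Perron amplitudes. -/
theorem edgeX_pos (hL : 0 < L) (hP : ∀ p, IsPerron t D μ p (e p) (r p)) {j : Fin L}
    (hj : j.val = 0) : 0 < edgeX r j := by
  have h : edgeX r j = ∑ S, r 1 S * r 0 (toggle j S) := by
    rw [edgeX, inner_amp, Complex.re_sum]
    refine Finset.sum_congr rfl fun S _ => ?_
    have h1 : fsign j S = 1 := by
      have : S.filter (· < j) = ∅ := by
        ext i; simp [Fin.lt_def, hj]
      rw [fsign, this]; simp
    rw [majX_apply, h1, one_mul, ofRe_apply, ofRe_apply, Complex.conj_ofReal,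
      ← Complex.ofReal_mul, Complex.ofReal_re]
  rw [h]
  exact sum_pos_of_perron hL hP j

theorem edgeY_pos (hL : 0 < L) (hP : ∀ p, IsPerron t D μ p (e p) (r p)) {j : Fin L}
    (hj : j.val + 1 = L) : 0 < edgeY r j := by
  have h : edgeY r j = ∑ S, r 1 S * r 0 (toggle j S) := by
    rw [edgeY, inner_amp, Complex.re_sum, ← Finset.sum_neg_distrib]
    refine Finset.sum_congr rfl fun S _ => ?_
    by_cases hS : par S = 1
    -- At the last site the string together with the sign in `majY` is the total parity, which is
    -- `-1` on the support of `r 1`. The minus sign in `edgeY` compensates it.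
    · have h1 : (if j ∈ S then -fsign j S else fsign j S) = (-1) ^ S.card := by
        have h2 : S.filter (· < j) = S.erase j := by
          ext i
          simp only [Finset.mem_filter, Finset.mem_erase, Fin.lt_def, Fin.ext_iff, ne_eq]
          have := i.isLt
          constructor
          · rintro ⟨h1, h2⟩; exact ⟨by omega, h1⟩
          · rintro ⟨h1, h2⟩; exact ⟨h2, by omega⟩
        rw [fsign, h2]
        split_ifs with hj
        · rw [← Finset.card_erase_add_one hj, pow_succ]; ring
        · rw [Finset.erase_eq_of_notMem hj]
      have h3 : (-1 : ℂ) ^ S.card = -1 := by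
        refine Odd.neg_one_pow ?_
        rw [par] at hS
        exact ZMod.natCast_eq_one_iff_odd.1 hS
      rw [majY_apply, h1, h3, ofRe_apply, ofRe_apply, Complex.conj_ofReal]
      simp
    · have := (hP 1).mem S hS
      rw [ofRe_apply, Complex.ofReal_eq_zero] at this
      simp [this]
  rw [h]
  exact sum_pos_of_perron hL hP j

/-- The ground states determine a minimal mode up to the two signs `a` and `b`, and the sign
conventions at the ends remove these. -/
theorem IsFockMode.eq_edge (hL : 0 < L) (hm : IsFockMode t D μ ε u v)
    (hP : ∀ p, IsPerron t D μ p (e p) (r p)) (hε : |ε| = |e 1 - e 0|)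
    (hu : ∀ j : Fin L, j.val = 0 → 0 < u j) (hv : ∀ j : Fin L, j.val + 1 = L → 0 < v j) :
    u = edgeX r ∧ v = edgeY r ∧ combX u (ofRe (r 0)) = ofRe (r 1) ∧
      combY v (ofRe (r 0)) = -ofRe (r 1) := by
  obtain ⟨a, b, ha, hb, hX, hY⟩ := hm.exists_sign_smul hP hε 0
  rw [zero_add] at hX hY
  have hux : ∀ j, u j = a * edgeX r j := by
    intro j
    -- The expectation in `r 0` of the anticommutator of `majX j` and `combX u` is `2 * u j`; since
    -- `combX u` takes `r 0` to `a r 1`, it is also `2 * a * edgeX r j`.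
    have h1 := congrArg (fun y => (⟪ofRe (r 0), y⟫_ℂ).re)
      (LinearMap.congr_fun (combX_anticomm (Pi.single j 1) u) (ofRe (r 0)))
    simp only [← majX_eq_combX, LinearMap.add_apply, Module.End.mul_apply, LinearMap.smul_apply,
      Module.End.one_apply, inner_add_right, inner_smul_right, (hP 0).inner_self,
      Complex.add_re, mul_one, Complex.ofReal_re] at h1
    rw [← inner_majX j _ (combX u _), ← inner_combX u _ (majX j _), hX, inner_smul_right, inner_smul_left, Complex.conj_ofReal,
      Complex.re_ofReal_mul, Complex.re_ofReal_mul, ← inner_conj_symm, Complex.conj_re] at h1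
    simp only [Pi.single_apply, ite_mul, one_mul, zero_mul, Finset.sum_ite_eq', Finset.mem_univ,
      if_true] at h1
    rw [edgeX]; linarith
  have hvy : ∀ j, v j = -b * edgeY r j := by
    intro j
    have h1 := congrArg (fun y => (⟪ofRe (r 0), y⟫_ℂ).re)
      (LinearMap.congr_fun (combY_anticomm (Pi.single j 1) v) (ofRe (r 0)))
    simp only [← majY_eq_combY, LinearMap.add_apply, Module.End.mul_apply, LinearMap.smul_apply,
      Module.End.one_apply, inner_add_right, inner_smul_right, (hP 0).inner_self,
      Complex.add_re, mul_one, Complex.ofReal_re] at h1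
    rw [← neg_neg (⟪ofRe (r 0), majY j _⟫_ℂ), ← inner_majY j _ (combY v _),
      ← neg_neg (⟪ofRe (r 0), combY v _⟫_ℂ), ← inner_combY v _ (majY j _), hY, inner_smul_right,
      inner_smul_left, Complex.conj_ofReal, Complex.neg_re, Complex.neg_re,
      Complex.re_ofReal_mul, Complex.re_ofReal_mul, ← inner_conj_symm, Complex.conj_re] at h1
    simp only [Pi.single_apply, ite_mul, one_mul, zero_mul, Finset.sum_ite_eq', Finset.mem_univ,
      if_true] at h1
    rw [edgeY]; linarith
  have ha1 : a = 1 := by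
    have h1 := hu ⟨0, hL⟩ rfl
    have h2 := edgeX_pos hL hP (j := ⟨0, hL⟩) rfl
    rw [hux] at h1
    have h3 : 0 < a := pos_of_mul_pos_left h1 h2.le
    nlinarith
  have hb1 : b = -1 := by
    have hj : (⟨L - 1, by omega⟩ : Fin L).val + 1 = L := by simp; omega
    have h1 := hv _ hj
    have h2 := edgeY_pos hL hP hj
    rw [hvy] at h1
    have h3 : 0 < -b := pos_of_mul_pos_left h1 h2.le
    nlinarith
  subst ha1 hb1
  refine ⟨funext fun j => by rw [hux, one_mul], funext fun j => by rw [hvy]; ring, ?_, ?_⟩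
  · rw [hX]; simp
  · rw [hY]; simp

theorem isFockMode_of_mulVec (hu : ∑ j, u j ^ 2 = 1) (hv : ∑ j, v j ^ 2 = 1)
    (h1 : (coupling L t D μ).mulVec u = (-ε) • v)
    (h2 : (coupling L t D μ).transpose.mulVec v = (-ε) • u) : IsFockMode t D μ ε u v where
  norm_u := hu
  norm_v := hv
  comm_u := by rw [kitaev_combX, h1, combY_smul, Complex.ofReal_neg]
  comm_v := by rw [kitaev_combY, h2, combX_smul, Complex.ofReal_neg]

/-- This is the matrix element between `r 1` and `r 0` of the commutator of the Hamiltonian with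
`majY l`: on eigenvectors the commutator is multiplication by `e 1 - e 0`. -/
theorem coupling_mulVec_edgeX (hP : ∀ p, IsPerron t D μ p (e p) (r p)) :
    (coupling L t D μ).mulVec (edgeX r) = (-(e 1 - e 0)) • edgeY r := by
  ext l
  have h1 := congrArg (fun y => (⟪ofRe (r 1), y⟫_ℂ).re)
    (LinearMap.congr_fun (kitaev_majY t D μ l) (ofRe (r 0)))
  simp only [LinearMap.sub_apply, Module.End.mul_apply, (hP 0).eigen, map_smul,
    inner_sub_right, inner_smul_right, inner_ofRe_combX, Complex.ofReal_re, Complex.sub_re,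
    Complex.re_ofReal_mul] at h1
  rw [← kitaev_isSymmetric t D μ (ofRe (r 1)), (hP 1).eigen, inner_smul_left,
    Complex.conj_ofReal, Complex.re_ofReal_mul] at h1
  simp only [Matrix.mulVec, dotProduct, Pi.smul_apply, smul_eq_mul, edgeX, edgeY]
  rw [← h1]; ring

theorem coupling_mulVec_edgeY (hP : ∀ p, IsPerron t D μ p (e p) (r p)) :
    (coupling L t D μ).transpose.mulVec (edgeY r) = (-(e 1 - e 0)) • edgeX r := by
  ext l
  have h1 := congrArg (fun y => (⟪ofRe (r 1), y⟫_ℂ).re)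
    (LinearMap.congr_fun (kitaev_majX t D μ l) (ofRe (r 0)))
  simp only [LinearMap.sub_apply, Module.End.mul_apply, (hP 0).eigen, map_smul,
    inner_sub_right, inner_smul_right, inner_ofRe_combY, Complex.ofReal_re, Complex.sub_re,
    Complex.re_ofReal_mul] at h1
  rw [← kitaev_isSymmetric t D μ (ofRe (r 1)), (hP 1).eigen, inner_smul_left,
    Complex.conj_ofReal, Complex.re_ofReal_mul] at h1
  simp only [Matrix.mulVec, dotProduct, Pi.smul_apply, smul_eq_mul, edgeX, edgeY,
    Matrix.transpose_apply, mul_neg, Finset.sum_neg_distrib]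
  rw [← h1]; ring

theorem exists_edge_mode (hL : 0 < L) (hP : ∀ p, IsPerron t D μ p (e p) (r p)) :
    ∃ u v : Fin L → ℝ, IsFockMode t D μ (e 1 - e 0) u v ∧
      (∀ j : Fin L, j.val = 0 → 0 < u j) ∧ (∀ j : Fin L, j.val + 1 = L → 0 < v j) := by
  set d := e 1 - e 0 with hd
  have hX := coupling_mulVec_edgeX hP
  have hY := coupling_mulVec_edgeY hP
  rw [← hd] at hX hY
  have hxpos : 0 < ∑ j, edgeX r j ^ 2 :=
    Finset.sum_pos' (fun j _ => sq_nonneg _) ⟨⟨0, hL⟩, Finset.mem_univ _,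
      pow_pos (edgeX_pos hL hP rfl) 2⟩
  have hypos : 0 < ∑ j, edgeY r j ^ 2 :=
    Finset.sum_pos' (fun j _ => sq_nonneg _) ⟨⟨L - 1, by omega⟩, Finset.mem_univ _,
      pow_pos (edgeY_pos hL hP (by simp; omega)) 2⟩
  have hdot : d * ∑ j, edgeY r j ^ 2 = d * ∑ j, edgeX r j ^ 2 := by
    have h1 : dotProduct (edgeY r) ((coupling L t D μ).mulVec (edgeX r))
        = dotProduct ((coupling L t D μ).transpose.mulVec (edgeY r)) (edgeX r) := by
      rw [Matrix.dotProduct_mulVec, Matrix.mulVec_transpose]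
    rw [hX, hY] at h1
    simp only [dotProduct, Pi.smul_apply, smul_eq_mul] at h1
    rw [Finset.mul_sum, Finset.mul_sum, ← neg_inj, ← Finset.sum_neg_distrib,
      ← Finset.sum_neg_distrib]
    convert h1 using 2 <;> ring
  set nx := √(∑ j, edgeX r j ^ 2) with hnx
  set ny := √(∑ j, edgeY r j ^ 2) with hny
  have hnx0 : 0 < nx := Real.sqrt_pos.2 hxpos
  have hny0 : 0 < ny := Real.sqrt_pos.2 hypos
  have hnx2 : nx ^ 2 = ∑ j, edgeX r j ^ 2 := Real.sq_sqrt hxpos.le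
  have hny2 : ny ^ 2 = ∑ j, edgeY r j ^ 2 := Real.sq_sqrt hypos.le
  -- The two edge vectors are normalized separately. If `d ≠ 0` the adjointness relation `hdot`
  -- makes their lengths equal; if `d = 0` the relative length does not affect the mode equations.
  have hdn : d * nx⁻¹ = d * ny⁻¹ := by
    rcases eq_or_ne d 0 with h0 | h0
    · rw [h0, zero_mul, zero_mul]
    · rw [hny, hnx, mul_left_cancel₀ h0 hdot]
  refine ⟨nx⁻¹ • edgeX r, ny⁻¹ • edgeY r, isFockMode_of_mulVec ?_ ?_ ?_ ?_, ?_, ?_⟩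
  · simp only [Pi.smul_apply, smul_eq_mul, mul_pow, ← Finset.mul_sum]
    rw [← hnx2, ← mul_pow, inv_mul_cancel₀ hnx0.ne', one_pow]
  · simp only [Pi.smul_apply, smul_eq_mul, mul_pow, ← Finset.mul_sum]
    rw [← hny2, ← mul_pow, inv_mul_cancel₀ hny0.ne', one_pow]
  · rw [Matrix.mulVec_smul, hX, smul_smul, smul_smul]
    congr 1
    linear_combination -hdn
  · rw [Matrix.mulVec_smul, hY, smul_smul, smul_smul]
    congr 1
    linear_combination hdn
  · intro j hj
    exact mul_pos (inv_pos.2 hnx0) (edgeX_pos hL hP hj)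
  · intro j hj
    exact mul_pos (inv_pos.2 hny0) (edgeY_pos hL hP hj)

end Modes

/-! ### Fluctuations of the particle number -/

/-- Number of fermions on the wire as an operator on its Fock space. -/
def numOp (L : ℕ) : Module.End ℂ (Amp L) where
  toFun x := WithLp.toLp 2 fun S => (S.card : ℂ) * x S
  map_add' x y := by ext S; simp [mul_add]
  map_smul' c x := by ext S; simp; ring

@[simp] theorem numOp_apply (x : Amp L) (S : Finset (Fin L)) :
    numOp L x S = (S.card : ℂ) * x S := rfl

theorem numOp_isSymmetric : (numOp L).IsSymmetric := by
  intro x y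
  rw [inner_amp, inner_amp]
  refine Finset.sum_congr rfl fun S _ => ?_
  simp only [numOp_apply, map_mul, map_natCast]
  ring

theorem numOp_mem_parSpace {p : ZMod 2} {x : Amp L} (hx : x ∈ parSpace L p) :
    numOp L x ∈ parSpace L p := fun S hS => by rw [numOp_apply, hx S hS, mul_zero]

theorem numOp_eq (x : Amp L) :
    numOp L x = ((L / 2 : ℝ) : ℂ) • x - (1 / 2 : ℂ) • ∑ j, majY j (majX j x) := by
  ext S
  have h : (∑ j, majY j (majX j x)) S = (L - 2 * S.card : ℂ) * x S := by
    rw [← sum_occupation, Finset.sum_mul]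
    simp [majY_majX_self]
  rw [PiLp.sub_apply, PiLp.smul_apply, PiLp.smul_apply, h, numOp_apply]
  simp only [smul_eq_mul]
  push_cast
  ring

section Wick

variable {u v : Fin L → Fin L → ℝ} {s : Fin L → ℝ}

/-- Operator annihilating a quasiparticle. -/
def lower (u v : Fin L → Fin L → ℝ) (s : Fin L → ℝ) (k : Fin L) : Module.End ℂ (Amp L) :=
  (1 / 2 : ℂ) • (combX (u k) + (s k : ℂ) • combY (v k))

/-- Operator creating a quasiparticle. -/
def raise (u v : Fin L → Fin L → ℝ) (s : Fin L → ℝ) (k : Fin L) : Module.End ℂ (Amp L) :=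
  (1 / 2 : ℂ) • (combX (u k) - (s k : ℂ) • combY (v k))

theorem inner_raise (k : Fin L) (x y : Amp L) :
    ⟪raise u v s k x, y⟫_ℂ = ⟪x, lower u v s k y⟫_ℂ := by
  simp only [raise, lower, LinearMap.smul_apply, LinearMap.add_apply, LinearMap.sub_apply,
    inner_smul_left, inner_smul_right, inner_add_right, inner_sub_left, inner_combX, inner_combY,
    Complex.conj_ofReal, map_div₀, map_one, Complex.conj_ofNat]
  ring

theorem combX_eq_lower_add_raise (k : Fin L) :
    combX (u k) = lower u v s k + raise u v s k := by
  rw [lower, raise]; module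

theorem combY_eq_lower_sub_raise (hs : ∀ k, s k * s k = 1) (k : Fin L) :
    combY (v k) = (s k : ℂ) • (lower u v s k - raise u v s k) := by
  have h : (s k : ℂ) * s k = 1 := by exact_mod_cast hs k
  rw [lower, raise]
  match_scalars
  · linear_combination -h
  · ring

theorem lower_raise (hu : ∀ k l, ∑ j, u k j * u l j = if k = l then 1 else 0)
    (hv : ∀ k l, ∑ j, v k j * v l j = if k = l then 1 else 0) (hs : ∀ k, s k * s k = 1)
    (l k : Fin L) (x : Amp L) :
    lower u v s l (raise u v s k x) = (if l = k then x else 0) - raise u v s k (lower u v s l x) := by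
  have h1 := LinearMap.congr_fun (combX_anticomm (u l) (u k)) x
  have h2 := LinearMap.congr_fun (combY_anticomm (v l) (v k)) x
  have h3 := LinearMap.congr_fun (combX_combY_anticomm (u l) (v k)) x
  have h4 := LinearMap.congr_fun (combX_combY_anticomm (u k) (v l)) x
  rw [hu] at h1
  rw [hv] at h2
  simp only [LinearMap.add_apply, Module.End.mul_apply, LinearMap.smul_apply,
    Module.End.one_apply, LinearMap.zero_apply] at h1 h2 h3 h4
  rw [eq_sub_iff_add_eq]
  have h5 : lower u v s l (raise u v s k x) + raise u v s k (lower u v s l x)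
      = (1 / 4 : ℂ) • ((combX (u l) (combX (u k) x) + combX (u k) (combX (u l) x))
        - ((s l : ℂ) * s k) • (combY (v l) (combY (v k) x) + combY (v k) (combY (v l) x))
        - (s k : ℂ) • (combX (u l) (combY (v k) x) + combY (v k) (combX (u l) x))
        + (s l : ℂ) • (combX (u k) (combY (v l) x) + combY (v l) (combX (u k) x))) := by
    simp only [lower, raise, LinearMap.smul_apply, LinearMap.add_apply, LinearMap.sub_apply,
      map_smul, map_add, map_sub]
    module
  rw [h5, h1, h2, h3, h4]
  split_ifs with h
  · subst h
    have h : (s l : ℂ) * s l = 1 := by exact_mod_cast hs l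
    rw [h]
    push_cast
    module
  · simp

/-- Wick's theorem for the variance of the particle number, as an upper bound. -/
theorem norm_numOp_sub_le (hu : ∀ k l, ∑ j, u k j * u l j = if k = l then 1 else 0)
    (hu' : ∀ i j, ∑ k, u k i * u k j = if i = j then 1 else 0)
    (hv : ∀ k l, ∑ j, v k j * v l j = if k = l then 1 else 0)
    (hv' : ∀ i j, ∑ k, v k i * v k j = if i = j then 1 else 0)
    (hs : ∀ k, s k * s k = 1) {x : Amp L} (hx1 : ‖x‖ = 1)
    (hx : ∀ k, combX (u k) x + (s k : ℂ) • combY (v k) x = 0) :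
    ∃ c : ℝ, ‖numOp L x - (c : ℂ) • x‖ ^ 2 ≤ L / 2 := by
  -- `q` is the overlap matrix of the two orthonormal families, up to signs of its rows, hence
  -- orthogonal. It is the matrix of `∑ majY j * majX j` in the quasiparticle basis.
  set q : Fin L → Fin L → ℝ := fun l k => s l * ∑ j, v l j * u k j with hq
  have hlow : ∀ k, lower u v s k x = 0 := fun k => by
    simp only [lower, LinearMap.smul_apply, LinearMap.add_apply, hx k, smul_zero]
  have hX : ∀ j, majX j x = ∑ k, (u k j : ℂ) • raise u v s k x := by
    intro j
    have h1 : majX j x = ∑ k, (u k j : ℂ) • combX (u k) x := by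
      simp only [combX, LinearMap.sum_apply, LinearMap.smul_apply, Finset.smul_sum, smul_smul]
      rw [Finset.sum_comm]
      simp only [← Finset.sum_smul, ← Complex.ofReal_mul, ← Complex.ofReal_sum, hu']
      simp
    rw [h1]
    refine Finset.sum_congr rfl fun k _ => ?_
    rw [combX_eq_lower_add_raise (v := v) (s := s), LinearMap.add_apply, hlow, zero_add]
  have hY : ∀ j (y : Amp L), majY j y = ∑ k, (v k j : ℂ) • combY (v k) y := by
    intro j y
    simp only [combY, LinearMap.sum_apply, LinearMap.smul_apply, Finset.smul_sum, smul_smul]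
    rw [Finset.sum_comm]
    simp only [← Finset.sum_smul, ← Complex.ofReal_mul, ← Complex.ofReal_sum, hv']
    simp
  have hYr : ∀ l k, combY (v l) (raise u v s k x)
      = (s l : ℂ) • ((if l = k then x else 0) - raise u v s l (raise u v s k x)) := by
    intro l k
    rw [combY_eq_lower_sub_raise (u := u) hs, LinearMap.smul_apply, LinearMap.sub_apply,
      lower_raise hu hv hs, hlow, map_zero, sub_zero]
  have hsum : ∑ j, majY j (majX j x) = ∑ l, ∑ k, (q l k : ℂ) •
      ((if l = k then x else 0) - raise u v s l (raise u v s k x)) := by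
    calc ∑ j, majY j (majX j x)
        = ∑ j, ∑ l, ∑ k, ((v l j * u k j : ℝ) : ℂ) • combY (v l) (raise u v s k x) := by
          refine Finset.sum_congr rfl fun j _ => ?_
          rw [hY, hX]
          refine Finset.sum_congr rfl fun l _ => ?_
          simp only [map_sum, map_smul, Finset.smul_sum, smul_smul, Complex.ofReal_mul]
      _ = ∑ l, ∑ k, ∑ j, ((v l j * u k j : ℝ) : ℂ) • combY (v l) (raise u v s k x) := by
          rw [Finset.sum_comm]
          exact Finset.sum_congr rfl fun l _ => Finset.sum_comm
      _ = _ := by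
          refine Finset.sum_congr rfl fun l _ => Finset.sum_congr rfl fun k _ => ?_
          rw [← Finset.sum_smul, ← Complex.ofReal_sum, hYr, smul_smul, hq]
          push_cast
          rw [mul_comm]
  refine ⟨L / 2 - 1 / 2 * ∑ k, q k k, ?_⟩
  -- As `x` is the quasiparticle vacuum, `N_w x` has only a vacuum part, which is the constant `c`,
  -- and a two-quasiparticle part proportional to `z`.
  set z : Amp L := ∑ l, ∑ k, (q l k : ℂ) • raise u v s l (raise u v s k x) with hz
  have hnum : numOp L x - ((L / 2 - 1 / 2 * ∑ k, q k k : ℝ) : ℂ) • x = (1 / 2 : ℂ) • z := by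
    have h1 : ∑ l, ∑ k, (q l k : ℂ) • (if l = k then x else 0) = ((∑ k, q k k : ℝ) : ℂ) • x := by
      simp only [smul_ite, smul_zero, Finset.sum_ite_eq, Finset.mem_univ, if_true,
        ← Finset.sum_smul, Complex.ofReal_sum]
    rw [numOp_eq, hsum]
    simp only [smul_sub, Finset.sum_sub_distrib]
    rw [h1, ← hz]
    push_cast
    module
  have hin : ∀ l' k' l k, ⟪raise u v s l' (raise u v s k' x), raise u v s l (raise u v s k x)⟫_ℂ
      = (if l' = l ∧ k' = k then 1 else 0) - (if l' = k ∧ k' = l then 1 else 0) := by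
    intro l' k' l k
    have hxx : ⟪x, x⟫_ℂ = 1 := by rw [sq_norm_amp, hx1]; norm_num
    have hd : ∀ (a b : Fin L) (y : Amp L), lower u v s a y = 0 → lower u v s a (raise u v s b y)
        = if a = b then y else 0 := by
      intro a b y hy
      rw [lower_raise hu hv hs, hy, map_zero, sub_zero]
    rw [inner_raise, inner_raise, lower_raise hu hv hs, hd _ _ _ (hlow _), map_sub]
    have h1 : lower u v s k' (if l' = l then raise u v s k x else 0)
        = if l' = l ∧ k' = k then x else 0 := by
      rw [apply_ite (lower u v s k'), map_zero, hd _ _ _ (hlow _), ite_and]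
    have h2 : lower u v s k' (raise u v s l (if l' = k then x else 0))
        = if l' = k ∧ k' = l then x else 0 := by
      rw [apply_ite (raise u v s l), map_zero, apply_ite (lower u v s k'), map_zero,
        hd _ _ _ (hlow _), ite_and]
    rw [h1, h2, inner_sub_right, apply_ite (inner ℂ x), apply_ite (inner ℂ x), hxx,
      inner_zero_right]
  have hzn : ‖z‖ ^ 2 = ∑ l, ∑ k, (q l k * q l k - q l k * q k l) := by
    apply Complex.ofReal_injective
    rw [← sq_norm_amp]
    nth_rewrite 2 [hz]
    simp only [inner_sum, inner_smul_right, Complex.ofReal_sum]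
    refine Finset.sum_congr rfl fun l _ => Finset.sum_congr rfl fun k _ => ?_
    rw [hz]
    simp only [sum_inner, inner_smul_left, hin, Complex.conj_ofReal]
    have h2 : ∀ a b : Fin L, ∑ l', ∑ k', (q l' k' : ℂ) * (if l' = a ∧ k' = b then 1 else 0)
        = q a b := by
      intro a b
      simp only [ite_and, mul_ite, mul_one, mul_zero]
      simp
    simp only [mul_sub, Finset.sum_sub_distrib, h2]
    push_cast
    ring
  -- Each column of the orthogonal matrix `q` has norm one, and there are `L` of them.
  have hqq : ∑ l, ∑ k, q l k * q l k = L := by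
    rw [Finset.sum_comm]
    have h1 : ∀ k, ∑ l, q l k * q l k = 1 := by
      intro k
      calc ∑ l, q l k * q l k
          = ∑ l, ∑ i, ∑ j, (u k i * u k j) * (v l i * v l j) := by
            refine Finset.sum_congr rfl fun l _ => ?_
            simp only [hq]
            rw [mul_mul_mul_comm, hs, one_mul, Finset.sum_mul_sum]
            exact Finset.sum_congr rfl fun i _ => Finset.sum_congr rfl fun j _ => by ring
        _ = ∑ i, ∑ j, ∑ l, (u k i * u k j) * (v l i * v l j) := by
            rw [Finset.sum_comm]
            exact Finset.sum_congr rfl fun l _ => Finset.sum_comm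
        _ = 1 := by
            simp only [← Finset.mul_sum, hv', mul_ite, mul_one, mul_zero, Finset.sum_ite_eq,
              Finset.mem_univ, if_true, hu]
    simp [h1]
  have hle : ‖z‖ ^ 2 ≤ 2 * L := by
    have h1 : ∑ l, ∑ k, q k l * q k l = (L : ℝ) := by rw [Finset.sum_comm]; exact hqq
    have h2 : ‖z‖ ^ 2 ≤ ∑ l, ∑ k, (3 / 2 * (q l k * q l k) + 1 / 2 * (q k l * q k l)) := by
      rw [hzn]
      refine Finset.sum_le_sum fun l _ => Finset.sum_le_sum fun k _ => ?_
      -- The difference of the two sides is `(q l k + q k l)² / 2`. Summation gives `‖z‖² ≤ 2 L`,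
      -- and the factor `1 / 2` in front of `z` turns this into `L / 2`.
      nlinarith [sq_nonneg (q l k + q k l)]
    simp only [Finset.sum_add_distrib, ← Finset.mul_sum, hqq, h1] at h2
    linarith
  rw [hnum, norm_smul, mul_pow]
  norm_num
  linarith

end Wick

/-! ### Reflection symmetry and a complete family of modes -/

theorem coupling_rev (t D μ : ℝ) (j k : Fin L) :
    coupling L t D μ j.rev k = coupling L t D μ k.rev j := by
  have hj := j.isLt
  have hk := k.isLt
  simp only [coupling, Fin.ext_iff, Fin.val_rev]
  split_ifs <;> first | rfl | omega

/-- Reflecting the wire transposes `coupling`, so `coupling` composed with the reflection is a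
symmetric matrix. Its orthonormal eigenvectors `u k` and their reflections `v k` form a singular
value decomposition (with signs) of `coupling`, hence a complete family of modes. -/
theorem exists_norm_numOp_sub_le {t D μ : ℝ} {e : ZMod 2 → ℝ} {r : ZMod 2 → Finset (Fin L) → ℝ}
    (hP : ∀ p, IsPerron t D μ p (e p) (r p)) (p : ZMod 2) :
    ∃ c : ℝ, ‖numOp L (ofRe (r p)) - (c : ℂ) • ofRe (r p)‖ ^ 2 ≤ L / 2 := by
  set K : Matrix (Fin L) (Fin L) ℝ := Matrix.of fun j k => coupling L t D μ j.rev k with hK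
  have hKh : K.IsHermitian := by
    ext j k
    simp only [Matrix.conjTranspose_apply, hK, Matrix.of_apply, star_trivial]
    exact coupling_rev t D μ k j
  set b := hKh.eigenvectorBasis with hb
  set u : Fin L → Fin L → ℝ := fun k j => b k j with hu_def
  set v : Fin L → Fin L → ℝ := fun k j => b k j.rev with hv_def
  have hu : ∀ k l, ∑ j, u k j * u l j = if k = l then 1 else 0 := by
    intro k l
    have h := orthonormal_iff_ite.1 b.orthonormal k l
    rw [PiLp.inner_apply] at h
    rw [← h]
    refine Finset.sum_congr rfl fun j _ => ?_
    simp [hu_def, mul_comm]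
  have hu' : ∀ i j, ∑ k, u k i * u k j = if i = j then 1 else 0 := by
    intro i j
    have h := b.sum_inner_mul_inner (EuclideanSpace.single i 1) (EuclideanSpace.single j 1)
    simp only [EuclideanSpace.inner_single_left, EuclideanSpace.inner_single_right, map_one,
      one_mul, conj_trivial] at h
    rw [show (∑ k, u k i * u k j) = _ from h]
    simp [eq_comm]
  have hsum : ∀ f : Fin L → ℝ, ∑ j : Fin L, f j.rev = ∑ j, f j := fun f =>
    Equiv.sum_comp Fin.revPerm f
  have hv : ∀ k l, ∑ j, v k j * v l j = if k = l then 1 else 0 := fun k l => by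
    rw [← hu k l]; exact hsum fun j => u k j * u l j
  have hv' : ∀ i j, ∑ k, v k i * v k j = if i = j then 1 else 0 := fun i j => by
    have h := hu' i.rev j.rev
    simp only [Fin.rev_inj] at h
    exact h
  have hmode : ∀ k, IsFockMode t D μ (-hKh.eigenvalues k) (u k) (v k) := by
    intro k
    have hKu : ∀ i, ∑ j, coupling L t D μ i.rev j * u k j = hKh.eigenvalues k * u k i := by
      intro i
      have h := congrFun (hKh.mulVec_eigenvectorBasis k) i
      simpa [Matrix.mulVec, dotProduct, hK] using h
    have hnu : ∑ j, u k j ^ 2 = 1 := by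
      have := hu k k
      rw [if_pos rfl] at this
      rw [← this]
      exact Finset.sum_congr rfl fun j _ => by ring
    have hnv : ∑ j, v k j ^ 2 = 1 := by
      rw [← hnu]; exact hsum fun j => u k j ^ 2
    refine isFockMode_of_mulVec hnu hnv ?_ ?_
    · ext i
      have h := hKu i.rev
      rw [Fin.rev_rev] at h
      rw [neg_neg]
      exact h
    · ext i
      have h := hKu i
      rw [neg_neg, Pi.smul_apply, smul_eq_mul, ← h]
      simp only [Matrix.mulVec, dotProduct, Matrix.transpose_apply]
      rw [← hsum]
      refine Finset.sum_congr rfl fun j _ => ?_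
      rw [coupling_rev]
      simp [hu_def, hv_def]
  choose s hs hs0 using fun k => (hmode k).exists_sign_annihilates hP p
  exact norm_numOp_sub_le hu hu' hv hv' hs (hP p).norm_eq hs0

/-! ### Matrix elements in the occupation number basis -/

theorem onBasis_single (f : Conf L → State L) (s : Conf L) (a : ℂ) :
    onBasis f (Finsupp.single s a) = a • f s := by
  rw [onBasis, Finsupp.linearCombination_single]

theorem ann_apply (j : Fin L) (ψ : State L) (S : Finset (Fin L)) (p : ℤ) :
    ann j ψ (S, p) = if j ∈ S then 0 else fsign j S * ψ (toggle j S, p) := by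
  induction ψ using Finsupp.induction_linear with
  | zero => simp
  | add x y hx hy => rw [map_add, Finsupp.add_apply, hx, hy, Finsupp.add_apply]; split_ifs <;> ring
  | single s a =>
    obtain ⟨T, q⟩ := s
    rw [ann, onBasis_single]
    dsimp only
    by_cases h : j ∈ T
    · rw [if_pos h, ← toggle_of_mem h, Finsupp.smul_apply, Finsupp.single_apply,
        Finsupp.single_apply]
      by_cases hT : T = toggle j S
      · subst hT
        have hS : j ∉ S := mem_toggle_self.1 h
        simp [hS, fsign_toggle, mul_comm]
      · have hT' : toggle j T ≠ S := fun h' => hT (by rw [← h', toggle_toggle])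
        simp [hT, hT']
    · rw [if_neg h, smul_zero, Finsupp.zero_apply]
      split_ifs with hS
      · rfl
      · have : T ≠ toggle j S := by rintro rfl; exact h (mem_toggle_self.2 hS)
        simp [this]

theorem cre_apply (j : Fin L) (ψ : State L) (S : Finset (Fin L)) (p : ℤ) :
    cre j ψ (S, p) = if j ∈ S then fsign j S * ψ (toggle j S, p) else 0 := by
  induction ψ using Finsupp.induction_linear with
  | zero => simp
  | add x y hx hy => rw [map_add, Finsupp.add_apply, hx, hy, Finsupp.add_apply]; split_ifs <;> ring
  | single s a =>
    obtain ⟨T, q⟩ := s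
    rw [cre, onBasis_single]
    dsimp only
    by_cases h : j ∈ T
    · rw [if_pos h, smul_zero, Finsupp.zero_apply]
      split_ifs with hS
      · have : T ≠ toggle j S := by rintro rfl; exact mem_toggle_self.1 h hS
        simp [this]
      · rfl
    · rw [if_neg h, ← toggle_of_notMem h, Finsupp.smul_apply, Finsupp.single_apply,
        Finsupp.single_apply]
      by_cases hT : T = toggle j S
      · subst hT
        have hS : j ∈ S := by simpa using h
        simp [hS, fsign_toggle, mul_comm]
      · have hT' : toggle j T ≠ S := fun h' => hT (by rw [← h', toggle_toggle])
        simp [hT, hT']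

theorem pairNum_apply (ψ : State L) (s : Conf L) : pairNum L ψ s = s.2 * ψ s := by
  induction ψ using Finsupp.induction_linear with
  | zero => simp
  | add x y hx hy => rw [map_add, Finsupp.add_apply, hx, hy, Finsupp.add_apply]; ring
  | single t a =>
    rw [pairNum, onBasis_single, Finsupp.smul_apply, Finsupp.single_apply, Finsupp.single_apply]
    split_ifs with h
    · rw [h, smul_eq_mul, mul_comm]
    · simp

theorem expPhase_apply (k : ℤ) (ψ : State L) (S : Finset (Fin L)) (p : ℤ) :
    expPhase L k ψ (S, p) = ψ (S, p - k) := by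
  induction ψ using Finsupp.induction_linear with
  | zero => simp
  | add x y hx hy => rw [map_add, Finsupp.add_apply, hx, hy, Finsupp.add_apply]
  | single t a =>
    obtain ⟨T, q⟩ := t
    rw [expPhase, onBasis_single, Finsupp.smul_apply, Finsupp.single_apply, Finsupp.single_apply]
    have : (T, q + k) = (S, p) ↔ (T, q) = (S, p - k) := by
      simp only [Prod.mk.injEq]
      constructor <;> rintro ⟨h1, h2⟩ <;> exact ⟨h1, by omega⟩
    simp only [this]
    split_ifs <;> simp

theorem wireNum_apply (ψ : State L) (S : Finset (Fin L)) (p : ℤ) :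
    wireNum L ψ (S, p) = S.card * ψ (S, p) := by
  have h : ∀ j : Fin L, (cre j * ann j) ψ (S, p) = if j ∈ S then ψ (S, p) else 0 := by
    intro j
    rw [Module.End.mul_apply, cre_apply, ann_apply]
    by_cases hj : j ∈ S
    · simp only [hj, if_true, mem_toggle_self, not_true, if_false, fsign_toggle, lt_irrefl,
        toggle_toggle]
      linear_combination ψ (S, p) * fsign_mul_self j S
    · simp [hj]
  rw [wireNum, LinearMap.sum_apply, Finsupp.finsetSum_apply]
  simp only [h]
  simp

theorem totalNum_apply (ψ : State L) (S : Finset (Fin L)) (p : ℤ) :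
    totalNum L ψ (S, p) = ((S.card + 2 * p : ℤ) : ℂ) * ψ (S, p) := by
  rw [totalNum, LinearMap.add_apply, Finsupp.add_apply, wireNum_apply, LinearMap.smul_apply,
    Finsupp.smul_apply, pairNum_apply, smul_eq_mul]
  push_cast
  ring

theorem mem_sector_iff {M : ℤ} {ψ : State L} :
    ψ ∈ sector L M ↔ ∀ (S : Finset (Fin L)) (p : ℤ), (S.card + 2 * p : ℤ) ≠ M → ψ (S, p) = 0 := by
  rw [sector, Module.End.mem_eigenspace_iff]
  constructor
  · intro h S p hM
    have h1 := DFunLike.congr_fun h (S, p)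
    rw [totalNum_apply, Finsupp.smul_apply, smul_eq_mul] at h1
    by_contra h0
    exact hM (by exact_mod_cast mul_right_cancel₀ h0 h1)
  · intro h
    ext ⟨S, p⟩
    rw [totalNum_apply, Finsupp.smul_apply, smul_eq_mul]
    by_cases hM : (S.card + 2 * p : ℤ) = M
    · rw [hM]
    · rw [h S p hM, mul_zero, mul_zero]

/-! ### Amplitudes of the states in a sector -/

/-- Number of Cooper pairs accompanying the configuration `S` in the `M`-particle sector. -/
def pairs (M : ℤ) (S : Finset (Fin L)) : ℤ := (M - S.card) / 2

theorem pairs_eq {M p : ℤ} {S : Finset (Fin L)} (h : (S.card + 2 * p : ℤ) = M) :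
    pairs M S = p := by
  rw [pairs]; omega

theorem card_add_two_mul_pairs {M : ℤ} {S : Finset (Fin L)} (h : par S = (M : ZMod 2)) :
    (S.card + 2 * pairs M S : ℤ) = M := by
  have h1 : ((S.card : ℤ) : ZMod 2) = (M : ZMod 2) := by rw [← h, par]; norm_cast
  rw [ZMod.intCast_eq_intCast_iff_dvd_sub] at h1
  obtain ⟨c, hc⟩ := h1
  rw [pairs]
  push_cast at hc
  omega

theorem par_eq_of_card {M p : ℤ} {S : Finset (Fin L)} (h : (S.card + 2 * p : ℤ) = M) :
    par S = (M : ZMod 2) := by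
  have h2 : (2 : ZMod 2) = 0 := rfl
  rw [← h, par]
  push_cast
  rw [h2, zero_mul, add_zero]

/-- The phase multiplying the amplitude of each fermion. -/
def twist (Δ : ℝ) : ℂ := -Complex.I * gauge Δ

theorem gauge_mul_conj (Δ : ℝ) : gauge Δ * (starRingEnd ℂ) (gauge Δ) = 1 := by
  rw [gauge]; split_ifs <;> simp

theorem twist_mul_conj (Δ : ℝ) : (starRingEnd ℂ) (twist Δ) * twist Δ = 1 := by
  rw [twist]
  simp only [map_mul, map_neg, Complex.conj_I]
  linear_combination (-Complex.I * Complex.I) * gauge_mul_conj Δ - Complex.I_mul_I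

theorem twist_ne_zero (Δ : ℝ) : twist Δ ≠ 0 := by
  intro h
  have := twist_mul_conj Δ
  rw [h, mul_zero] at this
  exact zero_ne_one this

/-- The pairing term changes the number of fermions by two and has amplitude `Δ / 2` in the bare
basis. The phase thus turns it into `-|Δ| / 2`, the sign needed for Perron-Frobenius, whatever the
sign of `Δ`. -/
theorem twist_sq {Δ : ℝ} (hΔ : Δ ≠ 0) : (Δ : ℂ) = -(|Δ| : ℝ) * twist Δ ^ 2 := by
  rw [twist, gauge]
  split_ifs with h
  · rw [abs_of_pos h]
    linear_combination (Δ : ℂ) * Complex.I_mul_I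
  · rw [abs_of_neg (lt_of_le_of_ne (not_lt.1 h) hΔ)]
    push_cast
    linear_combination (-Δ * (Complex.I * Complex.I - 1) : ℂ) * Complex.I_mul_I

/-- The amplitudes of the `M`-particle component of a state. -/
def coord (Δ : ℝ) (M : ℤ) : State L →ₗ[ℂ] Amp L where
  toFun ψ := WithLp.toLp 2 fun S =>
    if par S = (M : ZMod 2) then twist Δ ^ S.card * ψ (S, pairs M S) else 0
  map_add' x y := by
    ext S
    simp only [Finsupp.add_apply, PiLp.add_apply]
    split_ifs <;> ring
  map_smul' c x := by
    ext S
    simp only [Finsupp.smul_apply, PiLp.smul_apply, RingHom.id_apply, smul_eq_mul]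
    split_ifs <;> ring

theorem coord_apply_of_card {Δ : ℝ} {M p : ℤ} {S : Finset (Fin L)}
    (h : (S.card + 2 * p : ℤ) = M) (ψ : State L) :
    coord Δ M ψ S = twist Δ ^ S.card * ψ (S, p) := by
  change (if par S = (M : ZMod 2) then twist Δ ^ S.card * ψ (S, pairs M S) else 0) = _
  rw [if_pos (par_eq_of_card h), pairs_eq h]

theorem coord_mem_parSpace (Δ : ℝ) (M : ℤ) (ψ : State L) : coord Δ M ψ ∈ parSpace L M :=
  fun _ hS => if_neg hS

theorem coord_ext {Δ : ℝ} {M : ℤ} {x : Amp L} (hx : x ∈ parSpace L M) {ψ : State L}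
    (h : ∀ (S : Finset (Fin L)) (p : ℤ), (S.card + 2 * p : ℤ) = M →
      twist Δ ^ S.card * ψ (S, p) = x S) : coord Δ M ψ = x := by
  ext S
  by_cases hS : par S = (M : ZMod 2)
  · rw [coord_apply_of_card (card_add_two_mul_pairs hS), h _ _ (card_add_two_mul_pairs hS)]
  · rw [hx S hS, coord_mem_parSpace Δ M ψ S hS]

theorem mem_sector_iff_coord (Δ : ℝ) {M : ℤ} {ψ : State L} :
    ψ ∈ sector L M ↔ ∀ N, N ≠ M → coord Δ N ψ = 0 := by
  rw [mem_sector_iff]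
  constructor
  · intro h N hN
    refine coord_ext (Submodule.zero_mem _) fun S p hS => ?_
    rw [h S p (hS ▸ hN), mul_zero, PiLp.zero_apply]
  · intro h S p hS
    have h1 := congrArg (fun y : Amp L => y S) (h _ hS)
    simp only [coord_apply_of_card rfl, PiLp.zero_apply] at h1
    exact (mul_eq_zero.1 h1).resolve_left (pow_ne_zero _ (twist_ne_zero Δ))

theorem eq_zero_of_coord (Δ : ℝ) {ψ : State L} (h : ∀ N, coord Δ N ψ = 0) : ψ = 0 := by
  ext ⟨S, p⟩
  have h1 := congrArg (fun y : Amp L => y S) (h (S.card + 2 * p))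
  simp only [coord_apply_of_card rfl, PiLp.zero_apply] at h1
  exact (mul_eq_zero.1 h1).resolve_left (pow_ne_zero _ (twist_ne_zero Δ))

theorem eq_of_coord (Δ : ℝ) {ψ ψ' : State L} (h : ∀ N, coord Δ N ψ = coord Δ N ψ') : ψ = ψ' :=
  sub_eq_zero.1 <| eq_zero_of_coord Δ fun N => by rw [map_sub, h, sub_self]

theorem eq_of_coord_of_mem {Δ : ℝ} {M : ℤ} {ψ ψ' : State L} (hψ : ψ ∈ sector L M)
    (hψ' : ψ' ∈ sector L M) (h : coord Δ M ψ = coord Δ M ψ') : ψ = ψ' := by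
  refine eq_of_coord Δ fun N => ?_
  by_cases hN : N = M
  · rw [hN, h]
  · rw [(mem_sector_iff_coord Δ).1 hψ N hN, (mem_sector_iff_coord Δ).1 hψ' N hN]

theorem exists_coord_eq (Δ : ℝ) {M : ℤ} {x : Amp L} (hx : x ∈ parSpace L M) :
    ∃ ψ ∈ sector L M, coord Δ M ψ = x := by
  set ψ : State L := ∑ S : Finset (Fin L), Finsupp.single (S, pairs M S)
    ((starRingEnd ℂ) (twist Δ) ^ S.card * x S) with hψ
  have hap : ∀ (S : Finset (Fin L)) (p : ℤ), ψ (S, p)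
      = if pairs M S = p then (starRingEnd ℂ) (twist Δ) ^ S.card * x S else 0 := by
    intro S p
    rw [hψ, Finsupp.finsetSum_apply]
    simp only [Finsupp.single_apply, Prod.mk.injEq, ite_and, Finset.sum_ite_eq', Finset.mem_univ,
      if_true]
  refine ⟨ψ, mem_sector_iff.2 fun S p hS => ?_, coord_ext hx fun S p hS => ?_⟩
  · rw [hap]
    split_ifs with h
    · by_cases hpar : par S = (M : ZMod 2)
      · rw [← h] at hS
        exact absurd (card_add_two_mul_pairs hpar) hS
      · rw [hx S hpar, mul_zero]
    · rfl
  · rw [hap, if_pos (pairs_eq hS), ← mul_assoc, ← mul_pow, mul_comm (twist Δ), twist_mul_conj,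
      one_pow, one_mul]

/-- Only `ψ` has to lie in the sector, since the other components of `φ` do not contribute. -/
theorem inn_eq_inner (Δ : ℝ) {M : ℤ} {ψ : State L} (hψ : ψ ∈ sector L M) (φ : State L) :
    inn ψ φ = ⟪coord Δ M ψ, coord Δ M φ⟫_ℂ := by
  have hsub : ψ.support ⊆ Finset.univ.image fun S : Finset (Fin L) => (S, pairs M S) := by
    rintro ⟨S, p⟩ hs
    rw [Finsupp.mem_support_iff] at hs
    have : (S.card + 2 * p : ℤ) = M := by
      by_contra h
      exact hs (mem_sector_iff.1 hψ S p h)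
    exact Finset.mem_image.2 ⟨S, Finset.mem_univ _, by rw [pairs_eq this]⟩
  rw [inn, Finsupp.sum_of_support_subset _ hsub _ (fun i _ => by simp),
    Finset.sum_image (fun S _ T _ h => congrArg Prod.fst h), inner_amp]
  refine Finset.sum_congr rfl fun S _ => ?_
  by_cases hS : par S = (M : ZMod 2)
  · have h := card_add_two_mul_pairs hS
    have h1 : (starRingEnd ℂ) (twist Δ) ^ S.card * twist Δ ^ S.card = 1 := by
      rw [← mul_pow, twist_mul_conj, one_pow]
    rw [coord_apply_of_card h, coord_apply_of_card h, map_mul, map_pow]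
    linear_combination (-(starRingEnd ℂ) (ψ (S, pairs M S)) * φ (S, pairs M S)) * h1
  · have h0 : ψ (S, pairs M S) = 0 :=
      mem_sector_iff.1 hψ _ _ fun h => hS (par_eq_of_card h)
    rw [coord_mem_parSpace Δ M ψ S hS, h0]
    simp

/-! ### The Hamiltonian and the Majorana-like operators in terms of amplitudes -/

theorem coord_wireNum (Δ : ℝ) (M : ℤ) (ψ : State L) :
    coord Δ M (wireNum L ψ) = numOp L (coord Δ M ψ) := by
  refine coord_ext (numOp_mem_parSpace (coord_mem_parSpace Δ M ψ)) fun S p h => ?_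
  rw [wireNum_apply, numOp_apply, coord_apply_of_card h]
  ring

theorem hopping_apply {j k : Fin L} (h : j.val + 1 = k.val) (ψ : State L)
    (S : Finset (Fin L)) (p : ℤ) :
    (cre j * ann k + cre k * ann j) ψ (S, p)
      = if (j ∈ S ↔ k ∈ S) then 0 else ψ (toggle j (toggle k S), p) := by
  have hjk : j < k := by rw [Fin.lt_def]; omega
  have hf := fsign_mul_self j S
  simp only [LinearMap.add_apply, Finsupp.add_apply, Module.End.mul_apply, cre_apply, ann_apply,
    fsign_toggle, mem_toggle_of_ne hjk.ne, mem_toggle_of_ne hjk.ne', hjk.not_gt, if_false,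
    fsign_succ h, toggle_comm k j]
  by_cases h1 : j ∈ S <;> by_cases h2 : k ∈ S <;>
    simp only [h1, h2, if_true, if_false, iff_true, iff_false, not_true, not_false_eq_true,
      mem_toggle_self, lt_irrefl]
  · ring
  · linear_combination ψ (toggle j (toggle k S), p) * hf
  · linear_combination ψ (toggle j (toggle k S), p) * hf
  · ring

theorem pairing_apply {j k : Fin L} (h : j.val + 1 = k.val) (ψ : State L)
    (S : Finset (Fin L)) (p : ℤ) :
    (ann j * ann k * expPhase L 1 + expPhase L (-1) * cre k * cre j) ψ (S, p)
      = if (j ∈ S ↔ k ∈ S) then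
          -ψ (toggle j (toggle k S), if j ∈ S then p + 1 else p - 1) else 0 := by
  have hjk : j < k := by rw [Fin.lt_def]; omega
  have hf := fsign_mul_self j S
  simp only [LinearMap.add_apply, Finsupp.add_apply, Module.End.mul_apply, cre_apply, ann_apply,
    expPhase_apply, sub_neg_eq_add,
    fsign_toggle, mem_toggle_of_ne hjk.ne, mem_toggle_of_ne hjk.ne', hjk.not_gt, if_false,
    fsign_succ h, toggle_comm k j]
  by_cases h1 : j ∈ S <;> by_cases h2 : k ∈ S <;>
    simp only [h1, h2, if_true, if_false, iff_true, iff_false, not_true, not_false_eq_true,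
      mem_toggle_self, lt_irrefl]
  · linear_combination (-ψ (toggle j (toggle k S), p + 1)) * hf
  · ring
  · ring
  · linear_combination (-ψ (toggle j (toggle k S), p - 1)) * hf

theorem hamZero_apply (t Δ μ : ℝ) (ψ : State L) (S : Finset (Fin L)) (p : ℤ) :
    hamZero L t Δ μ ψ (S, p) = (∑ j : Fin L, ∑ k : Fin L, if j.val + 1 = k.val then
        (if (j ∈ S ↔ k ∈ S) then
          ((Δ / 2 : ℝ) : ℂ) * ψ (toggle j (toggle k S), if j ∈ S then p + 1 else p - 1)
        else (-(t / 2 : ℝ) : ℂ) * ψ (toggle j (toggle k S), p)) else 0)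
      + ((-(μ * (S.card - L / 2)) : ℝ) : ℂ) * ψ (S, p) := by
  rw [hamZero, LinearMap.sub_apply, Finsupp.sub_apply, LinearMap.sum_apply,
    Finsupp.finsetSum_apply, sub_eq_add_neg]
  congr 1
  · refine Finset.sum_congr rfl fun j _ => ?_
    rw [LinearMap.sum_apply, Finsupp.finsetSum_apply]
    refine Finset.sum_congr rfl fun k _ => ?_
    by_cases h : j.val + 1 = k.val
    · rw [if_pos h, if_pos h, LinearMap.add_apply, Finsupp.add_apply, LinearMap.smul_apply,
        LinearMap.smul_apply, Finsupp.smul_apply, Finsupp.smul_apply, hopping_apply h,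
        pairing_apply h]
      by_cases h1 : (j ∈ S ↔ k ∈ S)
      · simp only [if_pos h1, smul_eq_mul]; push_cast; ring
      · simp only [if_neg h1, smul_eq_mul]; push_cast; ring
    · simp [h]
  · simp only [LinearMap.smul_apply, Finsupp.smul_apply, LinearMap.sub_apply, Finsupp.sub_apply,
      wireNum_apply, Module.End.one_apply, smul_eq_mul]
    push_cast
    ring

theorem coord_hamZero {t Δ μ : ℝ} (hΔ : Δ ≠ 0) (M : ℤ) (ψ : State L) :
    coord Δ M (hamZero L t Δ μ ψ) = kitaev L t |Δ| μ (coord Δ M ψ) := by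
  refine coord_ext (kitaev_mem_parSpace _ _ _ (coord_mem_parSpace Δ M ψ)) fun S p h => ?_
  rw [hamZero_apply, kitaev_apply, coord_apply_of_card h, mul_add, add_comm,
    sub_eq_add_neg _ (Finset.sum _ _)]
  congr 1
  · ring
  · simp only [Finset.mul_sum, ← Finset.sum_neg_distrib]
    refine Finset.sum_congr rfl fun j _ => Finset.sum_congr rfl fun k _ => ?_
    split_ifs with hjk h1 h2
    · have hne : j ≠ k := by rintro rfl; omega
      have hc := card_toggle j (toggle k S)
      have hc2 := card_toggle k S
      rw [if_pos ((mem_toggle_of_ne hne).2 h2)] at hc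
      rw [if_pos (h1.1 h2)] at hc2
      have hn : S.card = (toggle j (toggle k S)).card + 2 := by omega
      rw [coord_apply_of_card (p := p + 1) (by omega), bond, if_pos h1, hn, pow_add]
      push_cast
      rw [twist_sq hΔ]
      -- In this case `S` has two fermions more than the configuration it is coupled to, so `twist Δ
      -- ^ 2` stands where its inverse would be expected; the two agree.
      have h4 : twist Δ ^ 4 = 1 := by
        have := congrArg (fun z : ℂ => z ^ 2) (twist_sq hΔ)
        have h0 : ((|Δ| : ℝ) : ℂ) ^ 2 = (Δ : ℂ) ^ 2 := by norm_cast; exact sq_abs Δ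
        have h1 : (Δ : ℂ) ^ 2 ≠ 0 := by
          have : (Δ : ℂ) ≠ 0 := by exact_mod_cast hΔ
          exact pow_ne_zero _ this
        apply mul_left_cancel₀ h1
        linear_combination -this - (twist Δ ^ 4) * h0
      linear_combination (-(|Δ| : ℝ) / 2 * twist Δ ^ (toggle j (toggle k S)).card
        * ψ (toggle j (toggle k S), p + 1)) * h4
    · have hne : j ≠ k := by rintro rfl; omega
      have hk : k ∉ S := fun hk => h2 (h1.2 hk)
      have hc := card_toggle j (toggle k S)
      have hc2 := card_toggle k S
      rw [if_neg (fun h => h2 ((mem_toggle_of_ne hne).1 h))] at hc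
      rw [if_neg hk] at hc2
      have hn : (toggle j (toggle k S)).card = S.card + 2 := by omega
      rw [coord_apply_of_card (p := p - 1) (by omega), bond, if_pos h1, hn, pow_add]
      push_cast
      rw [twist_sq hΔ]
      ring
    · have hne : j ≠ k := by rintro rfl; omega
      have hc := card_toggle j (toggle k S)
      have hc2 := card_toggle k S
      have hn : (toggle j (toggle k S)).card = S.card := by
        by_cases h2 : j ∈ S
        · have hk : k ∉ S := fun hk => h1 ⟨fun _ => hk, fun _ => h2⟩
          rw [if_pos ((mem_toggle_of_ne hne).2 h2)] at hc
          rw [if_neg hk] at hc2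
          omega
        · have hk : k ∈ S := by
            by_contra hk
            exact h1 ⟨fun h => absurd h h2, fun h => absurd h hk⟩
          rw [if_neg (fun h => h2 ((mem_toggle_of_ne hne).1 h))] at hc
          rw [if_pos hk] at hc2
          omega
      rw [coord_apply_of_card (p := p) (by omega), bond, if_neg h1, hn]
      push_cast
      ring
    · simp

theorem coord_majA (Δ : ℝ) (M : ℤ) (j : Fin L) (ψ : State L) :
    coord Δ (M - 1) (majA Δ j ψ) = majX j (coord Δ M ψ) := by
  have hM : (((M - 1 : ℤ) : ℤ) : ZMod 2) = (M : ZMod 2) + 1 := by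
    push_cast; rw [sub_eq_add_neg]; rfl
  refine coord_ext (hM ▸ wflip_mem_parSpace (coord_mem_parSpace Δ M ψ) j _) fun S p h => ?_
  have hc := card_toggle j S
  simp only [majA, LinearMap.smul_apply, LinearMap.sub_apply, Finsupp.smul_apply,
    Finsupp.sub_apply, Module.End.mul_apply, ann_apply, cre_apply, expPhase_apply, majX_apply,
    smul_eq_mul, sub_neg_eq_add]
  by_cases hj : j ∈ S
  · rw [if_pos hj] at hc
    have hn : S.card = (toggle j S).card + 1 := by omega
    rw [coord_apply_of_card (p := p + 1) (by omega), hn, pow_succ, twist]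
    simp only [hj, if_true]
    linear_combination ((-Complex.I * gauge Δ) ^ (toggle j S).card * fsign j S
      * ψ (toggle j S, p + 1)) * (-Complex.I * Complex.I * gauge_mul_conj Δ - Complex.I_mul_I)
  · rw [if_neg hj] at hc
    have hn : (toggle j S).card = S.card + 1 := by omega
    rw [coord_apply_of_card (p := p) (by omega), hn, pow_succ, twist]
    simp only [hj, if_false]
    ring

theorem coord_majB (Δ : ℝ) (M : ℤ) (j : Fin L) (ψ : State L) :
    coord Δ (M - 1) (majB Δ j ψ) = Complex.I • majY j (coord Δ M ψ) := by
  have hM : (((M - 1 : ℤ) : ℤ) : ZMod 2) = (M : ZMod 2) + 1 := by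
    push_cast; rw [sub_eq_add_neg]; rfl
  refine coord_ext (Submodule.smul_mem _ _
    (hM ▸ wflip_mem_parSpace (coord_mem_parSpace Δ M ψ) j _)) fun S p h => ?_
  have hc := card_toggle j S
  simp only [majB, LinearMap.smul_apply, LinearMap.add_apply, Finsupp.smul_apply,
    Finsupp.add_apply, Module.End.mul_apply, ann_apply, cre_apply, expPhase_apply, majY_apply,
    smul_eq_mul, sub_neg_eq_add, PiLp.smul_apply]
  by_cases hj : j ∈ S
  · rw [if_pos hj] at hc
    have hn : S.card = (toggle j S).card + 1 := by omega
    rw [coord_apply_of_card (p := p + 1) (by omega), hn, pow_succ, twist]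
    simp only [hj, if_true]
    linear_combination ((-Complex.I * gauge Δ) ^ (toggle j S).card * fsign j S
      * ψ (toggle j S, p + 1)) * (-Complex.I * gauge_mul_conj Δ)
  · rw [if_neg hj] at hc
    have hn : (toggle j S).card = S.card + 1 := by omega
    rw [coord_apply_of_card (p := p) (by omega), hn, pow_succ, twist]
    simp only [hj, if_false]
    linear_combination ((-Complex.I * gauge Δ) ^ S.card * fsign j S
      * ψ (toggle j S, p) * gauge Δ) * Complex.I_mul_I

theorem coord_majADag (Δ : ℝ) (M : ℤ) (j : Fin L) (ψ : State L) :
    coord Δ M (majADag Δ j ψ) = majX j (coord Δ (M - 1) ψ) := by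
  have hM : ((M - 1 : ℤ) : ZMod 2) + 1 = (M : ZMod 2) := by
    push_cast; ring
  refine coord_ext (hM ▸ wflip_mem_parSpace (coord_mem_parSpace Δ (M - 1) ψ) j _)
    fun S p h => ?_
  have hc := card_toggle j S
  simp only [majADag, LinearMap.smul_apply, LinearMap.sub_apply, Finsupp.smul_apply,
    Finsupp.sub_apply, Module.End.mul_apply, ann_apply, cre_apply, expPhase_apply, majX_apply,
    smul_eq_mul]
  by_cases hj : j ∈ S
  · rw [if_pos hj] at hc
    have hn : S.card = (toggle j S).card + 1 := by omega
    rw [coord_apply_of_card (p := p) (by omega), hn, pow_succ, twist]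
    simp only [hj, if_true]
    linear_combination ((-Complex.I * gauge Δ) ^ (toggle j S).card * fsign j S
      * ψ (toggle j S, p)) * (-Complex.I * Complex.I * gauge_mul_conj Δ - Complex.I_mul_I)
  · rw [if_neg hj] at hc
    have hn : (toggle j S).card = S.card + 1 := by omega
    rw [coord_apply_of_card (p := p - 1) (by omega), hn, pow_succ, twist]
    simp only [hj, if_false]
    ring

theorem coord_gammaL (Δ : ℝ) (M : ℤ) (u : Fin L → ℝ) (ψ : State L) :
    coord Δ (M - 1) (gammaL Δ u ψ) = combX u (coord Δ M ψ) := by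
  simp only [gammaL, combX, LinearMap.sum_apply, LinearMap.smul_apply, map_sum, map_smul,
    coord_majA]

theorem coord_gammaLDag (Δ : ℝ) (M : ℤ) (u : Fin L → ℝ) (ψ : State L) :
    coord Δ M (gammaLDag Δ u ψ) = combX u (coord Δ (M - 1) ψ) := by
  simp only [gammaLDag, combX, LinearMap.sum_apply, LinearMap.smul_apply, map_sum, map_smul,
    coord_majADag]

theorem coord_gammaR (Δ : ℝ) (M : ℤ) (v : Fin L → ℝ) (ψ : State L) :
    coord Δ (M - 1) (gammaR Δ v ψ) = Complex.I • combY v (coord Δ M ψ) := by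
  simp only [gammaR, combY, LinearMap.sum_apply, LinearMap.smul_apply, map_sum, map_smul,
    coord_majB, Finset.smul_sum]
  exact Finset.sum_congr rfl fun j _ => smul_comm _ _ _

/-! ### The charging energy in terms of amplitudes -/

/-- Deviation of the particle number on the wire from `c`. -/
def numDev (L : ℕ) (c : ℝ) : Module.End ℂ (Amp L) := numOp L - (c : ℂ) • 1

theorem numDev_apply (c : ℝ) (x : Amp L) (S : Finset (Fin L)) :
    numDev L c x S = ((S.card - c : ℝ) : ℂ) * x S := by
  simp only [numDev, LinearMap.sub_apply, LinearMap.smul_apply, Module.End.one_apply,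
    PiLp.sub_apply, PiLp.smul_apply, numOp_apply, smul_eq_mul]
  push_cast
  ring

theorem numDev_mem_parSpace {p : ZMod 2} {x : Amp L} (hx : x ∈ parSpace L p) (c : ℝ) :
    numDev L c x ∈ parSpace L p := fun S hS => by rw [numDev_apply, hx S hS, mul_zero]

theorem coord_charging (Δ Ec nc : ℝ) (M : ℤ) (ψ : State L) :
    coord Δ M (charging L Ec nc ψ)
      = (Ec : ℂ) • numDev L (M - 2 * nc) (numDev L (M - 2 * nc) (coord Δ M ψ)) := by
  refine coord_ext ?_ fun S p h => ?_
  · exact Submodule.smul_mem _ _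
      (numDev_mem_parSpace (numDev_mem_parSpace (coord_mem_parSpace Δ M ψ) _) _)
  · have hp : (M : ℂ) = S.card + 2 * p := by exact_mod_cast h.symm
    simp only [charging, LinearMap.smul_apply, Finsupp.smul_apply, pow_two, Module.End.mul_apply,
      LinearMap.sub_apply, Finsupp.sub_apply, pairNum_apply, Module.End.one_apply, smul_eq_mul,
      PiLp.smul_apply, numDev_apply, coord_apply_of_card h]
    push_cast
    rw [hp]
    ring

/-! ### Energy levels in a sector -/

theorem finiteDimensional_sector (M : ℤ) : FiniteDimensional ℂ (sector L M) := by
  refine FiniteDimensional.of_injective ((coord 1 M).comp (sector L M).subtype) ?_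
  intro x y h
  exact Subtype.ext (eq_of_coord_of_mem x.2 y.2 h)

theorem lowSpace_le_sector (H : Op L) (M : ℤ) (E : ℝ) : lowSpace H M E ≤ sector L M :=
  iSup_le fun _ => inf_le_right

theorem finiteDimensional_lowSpace (H : Op L) (M : ℤ) (E : ℝ) :
    FiniteDimensional ℂ (lowSpace H M E) :=
  have := finiteDimensional_sector (L := L) M
  Submodule.finiteDimensional_of_le (lowSpace_le_sector H M E)

theorem mem_lowSpace {H : Op L} {M : ℤ} {e E : ℝ} (he : e ≤ E) {ψ : State L}
    (hψ : ψ ∈ sector L M) (hH : H ψ = (e : ℂ) • ψ) : ψ ∈ lowSpace H M E :=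
  Submodule.mem_iSup_of_mem ⟨e, he⟩ ⟨Module.End.mem_eigenspace_iff.2 hH, hψ⟩

section Levels

variable {Δ : ℝ} {H : Op L} {k : ℤ → Module.End ℂ (Amp L)} {M : ℤ}

theorem exists_eigenstate (hint : ∀ N ψ, coord Δ N (H ψ) = k N (coord Δ N ψ)) {e : ℝ}
    {x : Amp L} (hx : x ∈ parSpace L M) (he : k M x = (e : ℂ) • x) :
    ∃ ψ ∈ sector L M, H ψ = (e : ℂ) • ψ ∧ coord Δ M ψ = x := by
  obtain ⟨ψ, hψ, hc⟩ := exists_coord_eq Δ hx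
  refine ⟨ψ, hψ, eq_of_coord Δ fun N => ?_, hc⟩
  rw [hint, map_smul]
  by_cases hN : N = M
  · rw [hN, hc, he]
  · rw [(mem_sector_iff_coord Δ).1 hψ N hN, map_zero, smul_zero]

theorem le_of_one_le_finrank (hint : ∀ N ψ, coord Δ N (H ψ) = k N (coord Δ N ψ)) {e : ℝ}
    (hmin : ∀ y ∈ parSpace L M, e * ‖y‖ ^ 2 ≤ (⟪y, k M y⟫_ℂ).re) {E : ℝ}
    (hE : 1 ≤ Module.finrank ℂ (lowSpace H M E)) : e ≤ E := by
  by_contra hlt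
  rw [not_le] at hlt
  have hbot : lowSpace H M E = ⊥ := by
    rw [lowSpace, iSup_eq_bot]
    rintro ⟨e', he'⟩
    rw [Submodule.eq_bot_iff]
    rintro ψ ⟨hψ, hs⟩
    rw [SetLike.mem_coe, Module.End.mem_eigenspace_iff] at hψ
    have h1 := hmin (coord Δ M ψ) (coord_mem_parSpace Δ M ψ)
    rw [← hint, hψ, map_smul, inner_smul_right, sq_norm_amp, Complex.re_ofReal_mul,
      Complex.ofReal_re] at h1
    have h2 : coord Δ M ψ = 0 := by
      by_contra h0
      have hn : 0 < ‖coord Δ M ψ‖ ^ 2 := by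
        have := norm_pos_iff.2 h0
        positivity
      have := le_of_mul_le_mul_right h1 hn
      linarith
    refine eq_of_coord_of_mem (Δ := Δ) hs (Submodule.zero_mem _) ?_
    rw [h2, map_zero]
  rw [hbot, finrank_bot] at hE
  exact absurd hE (by norm_num)

theorem level_zero_eq (hint : ∀ N ψ, coord Δ N (H ψ) = k N (coord Δ N ψ)) {e : ℝ}
    (hmin : ∀ y ∈ parSpace L M, e * ‖y‖ ^ 2 ≤ (⟪y, k M y⟫_ℂ).re) {x : Amp L}
    (hx : x ∈ parSpace L M) (he : k M x = (e : ℂ) • x) (h0 : x ≠ 0) : level H M 0 = e := by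
  refine IsLeast.csInf_eq ⟨?_, fun E hE => ?_⟩
  · obtain ⟨ψ, hψ, hH, hc⟩ := exists_eigenstate hint hx he
    have := finiteDimensional_lowSpace H M e
    change 1 ≤ _
    rw [Submodule.one_le_finrank_iff]
    intro h
    have hm := mem_lowSpace le_rfl hψ hH
    rw [h, Submodule.mem_bot] at hm
    exact h0 (by rw [← hc, hm, map_zero])
  · exact le_of_one_le_finrank hint hmin (by simpa using hE)

/-- Two orthogonal eigenvectors make the low-energy space at `e'` at least two-dimensional. An upper
bound on the second level suffices, because the gap is only ever used as a lower bound for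
excitation energies. -/
theorem level_one_le (hint : ∀ N ψ, coord Δ N (H ψ) = k N (coord Δ N ψ)) {e e' : ℝ}
    (hmin : ∀ y ∈ parSpace L M, e * ‖y‖ ^ 2 ≤ (⟪y, k M y⟫_ℂ).re) (hee : e ≤ e') {x y : Amp L}
    (hx : x ∈ parSpace L M) (hex : k M x = (e : ℂ) • x) (hx0 : x ≠ 0)
    (hy : y ∈ parSpace L M) (hey : k M y = (e' : ℂ) • y) (hy0 : y ≠ 0) (hxy : ⟪x, y⟫_ℂ = 0) :
    level H M 1 ≤ e' := by
  refine csInf_le ⟨e, fun E hE => ?_⟩ ?_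
  · have hE' : 2 ≤ Module.finrank ℂ (lowSpace H M E) := hE
    exact le_of_one_le_finrank hint hmin (by omega)
  · obtain ⟨ψ, hψ, hH, hc⟩ := exists_eigenstate hint hx hex
    obtain ⟨φ, hφ, hH', hc'⟩ := exists_eigenstate hint hy hey
    have := finiteDimensional_lowSpace H M e'
    have hli : LinearIndependent ℂ ![x, y] := by
      refine linearIndependent_of_ne_zero_of_inner_eq_zero ?_ ?_
      · intro i
        fin_cases i
        · exact hx0
        · exact hy0
      · intro i j hij
        fin_cases i <;> fin_cases j
        · exact absurd rfl hij
        · exact hxy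
        · exact inner_eq_zero_symm.1 hxy
        · exact absurd rfl hij
    have hspan : Submodule.span ℂ (Set.range ![x, y]) ≤ (lowSpace H M e').map (coord Δ M) := by
      rw [Submodule.span_le]
      rintro _ ⟨i, rfl⟩
      fin_cases i
      · exact ⟨ψ, mem_lowSpace hee hψ hH, hc⟩
      · exact ⟨φ, mem_lowSpace le_rfl hφ hH', hc'⟩
    have h1 := finrank_span_eq_card hli
    rw [Fintype.card_fin] at h1
    have h2 := Submodule.finrank_mono hspan
    have h3 := Submodule.finrank_map_le (coord Δ M) (lowSpace H M e')
    change 2 ≤ _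
    omega

end Levels

theorem IsPerron.level_zero {t Δ μ e : ℝ} (hΔ : Δ ≠ 0) {M : ℤ} {r : Finset (Fin L) → ℝ}
    (h : IsPerron t |Δ| μ (M : ZMod 2) e r) : level (hamZero L t Δ μ) M 0 = e :=
  level_zero_eq (k := fun _ => kitaev L t |Δ| μ) (fun N ψ => coord_hamZero hΔ N ψ) h.le h.mem
    h.eigen h.ne_zero

/-- Above the ground state the energies exceed the ground state energy by at least the gap. -/
theorem IsPerron.gap_le {t Δ μ e : ℝ} (hΔ : Δ ≠ 0) {M : ℤ} {r : Finset (Fin L) → ℝ}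
    (h : IsPerron t |Δ| μ (M : ZMod 2) e r) {y : Amp L} (hy : y ∈ parSpace L M)
    (horth : ⟪ofRe r, y⟫_ℂ = 0) :
    (e + gap (hamZero L t Δ μ) M) * ‖y‖ ^ 2 ≤ (⟪y, kitaev L t |Δ| μ y⟫_ℂ).re := by
  by_cases hy0 : y = 0
  · simp [hy0]
  -- The lowest eigenvector in the orthogonal complement of the ground state has energy at least the
  -- second level.
  set W : Submodule ℂ (Amp L) := parSpace L M ⊓ (ℂ ∙ ofRe r)ᗮ with hW
  have hmem : ∀ z, z ∈ W ↔ z ∈ parSpace L M ∧ ⟪ofRe r, z⟫_ℂ = 0 := fun z => by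
    rw [hW, Submodule.mem_inf, Submodule.mem_orthogonal_singleton_iff_inner_right]
  have hyW : y ∈ W := (hmem y).2 ⟨hy, horth⟩
  have hinv : ∀ z ∈ W, kitaev L t |Δ| μ z ∈ W := by
    intro z hz
    obtain ⟨h1, h2⟩ := (hmem z).1 hz
    refine (hmem _).2 ⟨kitaev_mem_parSpace _ _ _ h1, ?_⟩
    rw [← kitaev_isSymmetric t |Δ| μ (ofRe r) z, h.eigen, inner_smul_left, h2, mul_zero]
  obtain ⟨e', z, hzW, hz1, hez, hmin⟩ := exists_lowest (kitaev_isSymmetric t |Δ| μ) hinv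
    fun hbot => hy0 (by rwa [hbot, Submodule.mem_bot] at hyW)
  obtain ⟨hzp, hzo⟩ := (hmem z).1 hzW
  have hz0 : z ≠ 0 := norm_ne_zero_iff.1 (by rw [hz1]; exact one_ne_zero)
  have hlev := level_one_le (k := fun _ => kitaev L t |Δ| μ)
    (fun N ψ => coord_hamZero hΔ N ψ) h.le (h.le_of_eigen hzp hez hz0) h.mem h.eigen h.ne_zero
    hzp hez hz0 hzo
  rw [gap, h.level_zero hΔ]
  refine le_trans ?_ (hmin y hyW)
  refine mul_le_mul_of_nonneg_right ?_ (sq_nonneg _)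
  linarith

theorem norm_sq_add_of_inner_eq_zero {x y : Amp L} (h : ⟪x, y⟫_ℂ = 0) :
    ‖x + y‖ ^ 2 = ‖x‖ ^ 2 + ‖y‖ ^ 2 := by
  have := norm_add_sq (𝕜 := ℂ) x y
  rw [h] at this
  simpa using this

theorem inn_self_eq (Δ : ℝ) {M : ℤ} {ψ : State L} (hψ : ψ ∈ sector L M) :
    inn ψ ψ = 1 ↔ ‖coord Δ M ψ‖ = 1 := by
  rw [inn_eq_inner Δ hψ, sq_norm_amp]
  constructor
  · intro h
    have h1 : ‖coord Δ M ψ‖ ^ 2 = 1 := by exact_mod_cast h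
    nlinarith [norm_nonneg (coord Δ M ψ)]
  · intro h
    rw [h]; norm_num

/-! ### The mean particle number of the wire -/

/-- Whatever vector the choice operator returns, it is the Perron vector up to a phase, which drops
out of the expectation value. -/
theorem IsPerron.filling_eq {t Δ μ e : ℝ} (hΔ : Δ ≠ 0) {M : ℤ} {r : Finset (Fin L) → ℝ}
    (h : IsPerron t |Δ| μ (M : ZMod 2) e r) :
    filling L t Δ M μ = (⟪ofRe r, numOp L (ofRe r)⟫_ℂ).re := by
  have hex : ∃ ψ, IsGroundState (hamZero L t Δ μ) M ψ := by
    obtain ⟨ψ, hψ, hH, hc⟩ := exists_eigenstate (H := hamZero L t Δ μ)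
      (k := fun _ => kitaev L t |Δ| μ) (fun N ψ => coord_hamZero hΔ N ψ) h.mem h.eigen
    refine ⟨ψ, hψ, ?_, (inn_self_eq Δ hψ).2 ?_⟩
    · rw [hH, h.level_zero hΔ]
    · rw [hc, h.norm_eq]
  have hspec := Classical.epsilon_spec hex
  rw [filling]
  set χ := Classical.epsilon (IsGroundState (hamZero L t Δ μ) M)
  obtain ⟨hs, hH, h1⟩ := hspec
  rw [inn_self_eq Δ hs] at h1
  rw [h.level_zero hΔ] at hH
  obtain ⟨z, hz⟩ := h.unique (coord Δ M χ) (coord_mem_parSpace Δ M χ)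
    (by rw [← coord_hamZero hΔ, hH, map_smul])
  have hz1 : ‖z‖ = 1 := by rwa [hz, norm_smul, h.norm_eq, mul_one] at h1
  change (inn χ (wireNum L χ)).re = _
  rw [inn_eq_inner Δ hs, coord_wireNum, hz, map_smul, inner_smul_left, inner_smul_right,
    ← mul_assoc, Complex.conj_mul', hz1]
  norm_num

theorem kitaev_sub (t D μ μ' : ℝ) (x : Amp L) :
    kitaev L t D μ' x = kitaev L t D μ x + ((μ - μ' : ℝ) : ℂ) • numOp L x
      + (((μ' - μ) * (L / 2) : ℝ) : ℂ) • x := by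
  ext S
  rw [PiLp.add_apply, PiLp.add_apply, PiLp.smul_apply, PiLp.smul_apply, kitaev_apply,
    kitaev_apply, numOp_apply]
  simp only [smul_eq_mul]
  push_cast
  ring

theorem re_inner_kitaev_sub (t D μ μ' : ℝ) (x : Amp L) :
    (⟪x, kitaev L t D μ' x⟫_ℂ).re = (⟪x, kitaev L t D μ x⟫_ℂ).re
      + (μ - μ') * (⟪x, numOp L x⟫_ℂ).re + (μ' - μ) * (L / 2) * ‖x‖ ^ 2 := by
  rw [kitaev_sub t D μ μ' x, inner_add_right, inner_add_right, inner_smul_right,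
    inner_smul_right, sq_norm_amp, Complex.add_re, Complex.add_re, Complex.re_ofReal_mul,
    Complex.re_ofReal_mul, Complex.ofReal_re]

theorem IsPerron.re_inner_kitaev {t D μ e : ℝ} {p : ZMod 2} {r : Finset (Fin L) → ℝ}
    (h : IsPerron t D μ p e r) : (⟪ofRe r, kitaev L t D μ (ofRe r)⟫_ℂ).re = e := by
  rw [h.eigen, inner_smul_right, h.inner_self, mul_one, Complex.ofReal_re]

/-- The variational principle at `μ'` with trial vector `r`, rewritten at `μ` because the two
Hamiltonians differ by a multiple of `N_w` and a constant. Together with the variational principle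
at `μ` it gives monotonicity of the filling; as `μ'` tends to `μ` it gives continuity. -/
theorem IsPerron.energy_sub_le {t D μ μ' e e' : ℝ} {p : ZMod 2} {r r' : Finset (Fin L) → ℝ}
    (h : IsPerron t D μ p e r) (h' : IsPerron t D μ' p e' r') :
    (⟪ofRe r', kitaev L t D μ (ofRe r')⟫_ℂ).re
      ≤ e + (μ - μ') * ((⟪ofRe r, numOp L (ofRe r)⟫_ℂ).re
        - (⟪ofRe r', numOp L (ofRe r')⟫_ℂ).re) := by
  have h1 := h'.le (ofRe r) h.mem
  rw [re_inner_kitaev_sub t D μ μ', h.re_inner_kitaev, h.norm_eq] at h1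
  have h2 := h'.re_inner_kitaev
  rw [re_inner_kitaev_sub t D μ μ', h'.norm_eq] at h2
  linarith

theorem filling_mono (hL : 0 < L) {t Δ : ℝ} (ht : 0 < t) (hΔ : Δ ≠ 0) (M : ℤ) :
    Monotone (filling L t Δ M) := by
  intro μ μ' hle
  obtain ⟨e, r, h⟩ := exists_isPerron hL ht (abs_pos.2 hΔ) μ (M : ZMod 2)
  obtain ⟨e', r', h'⟩ := exists_isPerron hL ht (abs_pos.2 hΔ) μ' (M : ZMod 2)
  rw [h.filling_eq hΔ, h'.filling_eq hΔ]
  have h1 := h.energy_sub_le h'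
  have h2 := h.le _ h'.mem
  rw [h'.norm_eq] at h2
  rcases hle.eq_or_lt with rfl | hlt
  -- Here `r` and `r'` are separately chosen ground states at the same `μ`, so uniqueness is needed
  -- to identify their fillings.
  · obtain ⟨z, hz⟩ := h.unique _ h'.mem (eigenvector_of_minimal (kitaev_isSymmetric _ _ _)
      (fun x hx => kitaev_mem_parSpace _ _ _ hx) h.le h'.mem
      (by rw [h'.norm_eq]; linarith))
    have hz1 : ‖z‖ = 1 := by
      have := h'.norm_eq
      rwa [hz, norm_smul, h.norm_eq, mul_one] at this
    rw [hz, map_smul, inner_smul_left, inner_smul_right, ← mul_assoc, Complex.conj_mul', hz1]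
    norm_num
  · nlinarith

/-- By compactness of the unit sphere the ground states at `μ'` converge along every ultrafilter
tending to `μ`. The limit attains the minimal energy at `μ`, so by uniqueness it is the ground state
there up to a phase. -/
theorem filling_continuous (hL : 0 < L) {t Δ : ℝ} (ht : 0 < t) (hΔ : Δ ≠ 0) (M : ℤ) :
    Continuous (filling L t Δ M) := by
  choose e r hP using fun μ => exists_isPerron hL ht (abs_pos.2 hΔ) μ (M : ZMod 2)
  rw [continuous_iff_continuousAt]
  intro μ
  rw [ContinuousAt, Filter.tendsto_iff_ultrafilter]
  intro U hU
  obtain ⟨x, hx1, hUx⟩ := (isCompact_sphere (0 : Amp L) 1).ultrafilter_le_nhds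
    (U.map fun μ' => ofRe (r μ')) (by
      rw [Filter.le_principal_iff, Ultrafilter.mem_coe, Ultrafilter.mem_map]
      exact Filter.univ_mem' fun μ' => mem_sphere_zero_iff_norm.2 (hP μ').norm_eq)
  have hlim : Filter.Tendsto (fun μ' => ofRe (r μ')) U (nhds x) := hUx
  have hcont : ∀ A : Module.End ℂ (Amp L), Filter.Tendsto
      (fun μ' => (⟪ofRe (r μ'), A (ofRe (r μ'))⟫_ℂ).re) U (nhds (⟪x, A x⟫_ℂ).re) := by
    intro A
    have hA : Continuous A := A.continuous_of_finiteDimensional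
    have hc : Continuous fun y : Amp L => (⟪y, A y⟫_ℂ).re :=
      Complex.continuous_re.comp (continuous_id.inner hA)
    exact (hc.tendsto x).comp hlim
  have hxp : x ∈ parSpace L (M : ZMod 2) :=
    (parSpace L (M : ZMod 2)).closed_of_finiteDimensional.mem_of_tendsto hlim
      (Filter.Eventually.of_forall fun μ' => (hP μ').mem)
  have hle : (⟪x, kitaev L t |Δ| μ x⟫_ℂ).re ≤ e μ := by
    have hid : Filter.Tendsto (fun μ' : ℝ => μ - μ') U (nhds (μ - μ)) :=
      tendsto_const_nhds.sub hU
    have h2 := (tendsto_const_nhds (x := e μ)).add (hid.mul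
      ((tendsto_const_nhds (x := (⟪ofRe (r μ), numOp L (ofRe (r μ))⟫_ℂ).re)).sub
        (hcont (numOp L))))
    rw [sub_self, zero_mul, add_zero] at h2
    exact le_of_tendsto_of_tendsto' (hcont _) h2 fun μ' => (hP μ).energy_sub_le (hP μ')
  have hx1' : ‖x‖ = 1 := mem_sphere_zero_iff_norm.1 hx1
  obtain ⟨z, hz⟩ := (hP μ).unique x hxp (eigenvector_of_minimal (kitaev_isSymmetric _ _ _)
    (fun x hx => kitaev_mem_parSpace _ _ _ hx) (hP μ).le hxp (by rw [hx1']; linarith))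
  have hz1 : ‖z‖ = 1 := by
    rwa [hz, norm_smul, (hP μ).norm_eq, mul_one] at hx1'
  have hfx : filling L t Δ M μ = (⟪x, numOp L x⟫_ℂ).re := by
    rw [(hP μ).filling_eq hΔ, hz, map_smul, inner_smul_left, inner_smul_right, ← mul_assoc,
      Complex.conj_mul', hz1]
    norm_num
  rw [hfx]
  exact (hcont _).congr fun μ' => ((hP μ').filling_eq hΔ).symm

/-- The function `m + 2 Ec f(m)` is continuous and strictly increasing. The prescribed value equals
`μ₀ + 2 Ec f(μ)`, which by monotonicity of `f` lies between the values at `μ` and at `μ₀`; both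
points are in `(-t, t)`, hence so is the solution. -/
theorem existsUnique_effectivePotential (hL : 0 < L) {t Δ μ Ec nc : ℝ} (hμ : |μ| < t)
    (hΔ : Δ ≠ 0) (hEc : 0 ≤ Ec) (M : ℤ)
    (hfill : |μ + 2 * Ec * (M - 2 * nc - filling L t Δ M μ)| < t) :
    ∃! μ' : ℝ, IsEffectivePotential L t Δ μ Ec nc M μ' := by
  have ht : 0 < t := (abs_nonneg μ).trans_lt hμ
  have hmono := filling_mono hL ht hΔ M
  set f := filling L t Δ M with hf
  set μ₀ := μ + 2 * Ec * (M - 2 * nc - f μ) with hμ₀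
  have hg : Continuous fun m => m + 2 * Ec * f m :=
    continuous_id.add (continuous_const.mul (filling_continuous hL ht hΔ M))
  obtain ⟨h1, h2⟩ := abs_lt.1 hμ
  obtain ⟨h3, h4⟩ := abs_lt.1 hfill
  have hex : ∃ μ' : ℝ, IsEffectivePotential L t Δ μ Ec nc M μ' := by
    rcases le_total μ μ₀ with hle | hle
    · have hm : 2 * Ec * f μ ≤ 2 * Ec * f μ₀ :=
        mul_le_mul_of_nonneg_left (hmono hle) (by linarith)
      obtain ⟨m, ⟨hm1, hm2⟩, hm3⟩ := intermediate_value_Icc hle hg.continuousOn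
        (show μ + 2 * Ec * (M - 2 * nc) ∈ Set.Icc _ _ from
          ⟨by linarith, by linarith⟩)
      exact ⟨m, abs_lt.2 ⟨by linarith, by linarith⟩, hm3⟩
    · have hm : 2 * Ec * f μ₀ ≤ 2 * Ec * f μ :=
        mul_le_mul_of_nonneg_left (hmono hle) (by linarith)
      obtain ⟨m, ⟨hm1, hm2⟩, hm3⟩ := intermediate_value_Icc hle hg.continuousOn
        (show μ + 2 * Ec * (M - 2 * nc) ∈ Set.Icc _ _ from
          ⟨by linarith, by linarith⟩)
      exact ⟨m, abs_lt.2 ⟨by linarith, by linarith⟩, hm3⟩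
  refine existsUnique_of_exists_of_unique hex fun a b ha hb => ?_
  have heq : a + 2 * Ec * f a = b + 2 * Ec * f b := ha.2.trans hb.2.symm
  rcases lt_trichotomy a b with h | h | h
  · have := mul_le_mul_of_nonneg_left (hmono h.le) (show 0 ≤ 2 * Ec by linarith)
    linarith
  · exact h
  · have := mul_le_mul_of_nonneg_left (hmono h.le) (show 0 ≤ 2 * Ec by linarith)
    linarith

/-! ### Edge modes of the particle number conserving model -/

theorem amp_end_ext {A B : Module.End ℂ (Amp L)} (h : ∀ p, ∀ x ∈ parSpace L p, A x = B x) :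
    A = B := by
  ext1 x
  have hx : x = ∑ p : ZMod 2, (WithLp.toLp 2 fun S => if par S = p then x S else 0 : Amp L) := by
    ext S
    simp
  rw [hx, map_sum, map_sum]
  exact Finset.sum_congr rfl fun p _ => h p _ fun S hS => if_neg hS

/-- A state is determined by all its components `coord Δ N`, and conversely every amplitude vector
of definite parity occurs as such a component, so the commutator identities carry over in both
directions. -/
theorem isMode_iff_isFockMode {t Δ μ ε : ℝ} (hΔ : Δ ≠ 0) {u v : Fin L → ℝ} :
    IsMode t Δ μ ε u v ↔ IsFockMode t |Δ| μ ε u v := by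
  have hL : ∀ (N : ℤ) (ψ : State L),
      coord Δ (N - 1) ((hamZero L t Δ μ * gammaL Δ u - gammaL Δ u * hamZero L t Δ μ) ψ)
        = (kitaev L t |Δ| μ * combX u - combX u * kitaev L t |Δ| μ) (coord Δ N ψ) := by
    intro N ψ
    simp only [LinearMap.sub_apply, Module.End.mul_apply, map_sub, coord_hamZero hΔ,
      coord_gammaL]
  have hR : ∀ (N : ℤ) (ψ : State L),
      coord Δ (N - 1) ((hamZero L t Δ μ * gammaR Δ v - gammaR Δ v * hamZero L t Δ μ) ψ)
        = Complex.I • (kitaev L t |Δ| μ * combY v - combY v * kitaev L t |Δ| μ)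
          (coord Δ N ψ) := by
    intro N ψ
    simp only [LinearMap.sub_apply, Module.End.mul_apply, map_sub, coord_hamZero hΔ,
      coord_gammaR, map_smul, smul_sub]
  have hL' : ∀ (N : ℤ) (ψ : State L), coord Δ (N - 1) (((Complex.I * (ε : ℂ)) • gammaR Δ v) ψ)
      = ((-(ε : ℂ)) • combY v) (coord Δ N ψ) := by
    intro N ψ
    rw [LinearMap.smul_apply, map_smul, coord_gammaR, smul_smul, LinearMap.smul_apply]
    congr 1
    linear_combination (ε : ℂ) * Complex.I_mul_I
  have hR' : ∀ (N : ℤ) (ψ : State L), coord Δ (N - 1) (((-(Complex.I * (ε : ℂ))) • gammaL Δ u) ψ)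
      = Complex.I • ((-(ε : ℂ)) • combX u) (coord Δ N ψ) := by
    intro N ψ
    rw [LinearMap.smul_apply, map_smul, coord_gammaL, LinearMap.smul_apply, smul_smul]
    congr 1
    ring
  have hp : ∀ p : ZMod 2, ∀ x ∈ parSpace L p, ∃ (N : ℤ) (ψ : State L), coord Δ N ψ = x := by
    intro p x hx
    obtain ⟨N, rfl⟩ := ZMod.intCast_surjective p
    obtain ⟨ψ, -, h⟩ := exists_coord_eq Δ hx
    exact ⟨N, ψ, h⟩
  constructor
  · rintro ⟨h1, h2, h3, h4⟩
    refine ⟨h1, h2, amp_end_ext fun p x hx => ?_, amp_end_ext fun p x hx => ?_⟩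
    · obtain ⟨N, ψ, rfl⟩ := hp p x hx
      rw [← hL, ← hL', h3]
    · obtain ⟨N, ψ, rfl⟩ := hp p x hx
      apply smul_right_injective _ Complex.I_ne_zero
      change Complex.I • _ = Complex.I • _
      rw [← hR, ← hR', h4]
  · rintro ⟨h1, h2, h3, h4⟩
    refine ⟨h1, h2, LinearMap.ext fun ψ => eq_of_coord Δ fun N => ?_,
      LinearMap.ext fun ψ => eq_of_coord Δ fun N => ?_⟩
    · rw [show N = N + 1 - 1 by ring, hL, hL', h3]
    · rw [show N = N + 1 - 1 by ring, hR, hR', h4]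

section Edge

variable {t Δ μ : ℝ} {e : ZMod 2 → ℝ} {r : ZMod 2 → Finset (Fin L) → ℝ}

theorem IsEdgePair.eq_edge (hL : 0 < L) (hΔ : Δ ≠ 0)
    (hP : ∀ p, IsPerron t |Δ| μ p (e p) (r p)) {u v : Fin L → ℝ} (h : IsEdgePair t Δ μ u v) :
    (∑ j, u j ^ 2 = 1 ∧ ∑ j, v j ^ 2 = 1) ∧
    u = edgeX r ∧ v = edgeY r ∧ combX u (ofRe (r 0)) = ofRe (r 1) ∧
      combY v (ofRe (r 0)) = -ofRe (r 1) := by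
  obtain ⟨⟨ε, hm, hmin⟩, hu, hv⟩ := h
  have hm' := (isMode_iff_isFockMode hΔ).1 hm
  obtain ⟨u', v', hm0, -, -⟩ := exists_edge_mode hL hP
  have h1 := hmin _ _ _ ((isMode_iff_isFockMode hΔ).2 hm0)
  have h2 := hm'.abs_sub_le_abs hP
  exact ⟨⟨hm'.norm_u, hm'.norm_v⟩, hm'.eq_edge hL hP (le_antisymm h1 h2) hu hv⟩

theorem existsUnique_isEdgePair (hL : 0 < L) (hΔ : Δ ≠ 0)
    (hP : ∀ p, IsPerron t |Δ| μ p (e p) (r p)) :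
    ∃! uv : (Fin L → ℝ) × (Fin L → ℝ), IsEdgePair t Δ μ uv.1 uv.2 := by
  obtain ⟨u, v, hm, hu, hv⟩ := exists_edge_mode hL hP
  refine existsUnique_of_exists_of_unique ⟨(u, v), ⟨e 1 - e 0, (isMode_iff_isFockMode hΔ).2 hm,
    fun ε' u' v' h => ((isMode_iff_isFockMode hΔ).1 h).abs_sub_le_abs hP⟩, hu, hv⟩ ?_
  rintro ⟨u₁, v₁⟩ ⟨u₂, v₂⟩ h₁ h₂
  obtain ⟨-, h1, h2, -⟩ := h₁.eq_edge hL hΔ hP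
  obtain ⟨-, h3, h4, -⟩ := h₂.eq_edge hL hΔ hP
  exact Prod.ext (h1.trans h3.symm) (h2.trans h4.symm)

theorem IsEdgePair.apply_ground (hL : 0 < L) (hΔ : Δ ≠ 0)
    (hP : ∀ p, IsPerron t |Δ| μ p (e p) (r p)) {u v : Fin L → ℝ} (h : IsEdgePair t Δ μ u v)
    (M : ℤ) :
    combX u (ofRe (r M)) = ofRe (r (M + 1)) ∧
      combY v (ofRe (r M)) = (((-(-1) ^ M : ℝ)) : ℂ) • ofRe (r (M + 1)) := by
  obtain ⟨⟨hu, hv⟩, -, -, h1, h2⟩ := h.eq_edge hL hΔ hP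
  rcases Int.even_or_odd M with hM | hM
  · rw [ZMod.intCast_eq_zero_iff_even.2 hM, hM.neg_one_zpow, zero_add]
    exact ⟨h1, by rw [h2]; simp⟩
  -- The action on `r 1` follows from that on `r 0`. The relative sign between even and odd `M`
  -- arises because `combX u` squares to `1` but `combY v` to `-1`.
  · rw [ZMod.intCast_eq_one_iff_odd.2 hM, hM.neg_one_zpow,
      show (1 + 1 : ZMod 2) = 0 from rfl, ← h1, combX_sq hu]
    refine ⟨rfl, ?_⟩
    have h3 := combY_sq hv (ofRe (r 0))
    rw [h2, map_neg, neg_inj] at h3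
    rw [h1, h3]
    simp

end Edge

/-! ### The edge correlation near an unperturbed ground state -/

theorem inn_edge_correlation (Δ : ℝ) {M : ℤ} {ψ : State L} (hψ : ψ ∈ sector L M)
    (u v : Fin L → ℝ) :
    inn ψ ((Complex.I • (gammaLDag Δ u * gammaR Δ v)) ψ)
      = -⟪combX u (coord Δ M ψ), combY v (coord Δ M ψ)⟫_ℂ := by
  rw [inn_eq_inner Δ hψ, LinearMap.smul_apply, Module.End.mul_apply, map_smul, coord_gammaLDag,
    coord_gammaR, map_smul, inner_smul_right, inner_smul_right, inner_combX]
  linear_combination ⟪coord Δ M ψ, combX u (combY v (coord Δ M ψ))⟫_ℂ * Complex.I_mul_I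

theorem inner_combX_combY_im (u v : Fin L → ℝ) (x : Amp L) :
    (⟪combX u x, combY v x⟫_ℂ).im = 0 := by
  rw [← Complex.conj_eq_iff_im, inner_conj_symm, inner_combY, inner_combX]
  have h := LinearMap.congr_fun (combX_combY_anticomm u v) x
  simp only [LinearMap.add_apply, Module.End.mul_apply, LinearMap.zero_apply] at h
  rw [eq_neg_of_add_eq_zero_left h, inner_neg_right]

theorem norm_combX {u : Fin L → ℝ} (hu : ∑ j, u j ^ 2 = 1) (x : Amp L) : ‖combX u x‖ = ‖x‖ := by
  have h := inner_combX u x (combX u x)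
  rw [combX_sq hu, sq_norm_amp, sq_norm_amp] at h
  have h2 : ‖combX u x‖ ^ 2 = ‖x‖ ^ 2 := by exact_mod_cast h
  exact (sq_eq_sq₀ (norm_nonneg _) (norm_nonneg _)).1 h2

theorem norm_combY {u : Fin L → ℝ} (hu : ∑ j, u j ^ 2 = 1) (x : Amp L) : ‖combY u x‖ = ‖x‖ := by
  have h := inner_combY u x (combY u x)
  rw [combY_sq hu, inner_neg_right, neg_neg, sq_norm_amp, sq_norm_amp] at h
  have h2 : ‖combY u x‖ ^ 2 = ‖x‖ ^ 2 := by exact_mod_cast h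
  exact (sq_eq_sq₀ (norm_nonneg _) (norm_nonneg _)).1 h2

/-- The edge correlation of a vector `x` which is close to the eigenvector `χ`. -/
theorem edge_correlation_ge {u v : Fin L → ℝ} (hu : ∑ j, u j ^ 2 = 1) (hv : ∑ j, v j ^ 2 = 1)
    {χ χ' x : Amp L} {s : ℝ} (hs : s * s = 1) (hX : combX u χ = χ')
    (hY : combY v χ = ((-s : ℝ) : ℂ) • χ') (hχ : ‖χ‖ = 1) :
    2 * ‖⟪χ, x⟫_ℂ‖ ^ 2 - ‖x‖ ^ 2 ≤ s * -(⟪combX u x, combY v x⟫_ℂ).re := by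
  set a := ⟪χ, x⟫_ℂ with ha
  set y := x - a • χ with hy
  have hχχ : ⟪χ, χ⟫_ℂ = 1 := by rw [sq_norm_amp, hχ]; norm_num
  have hyo : ⟪χ, y⟫_ℂ = 0 := by
    rw [hy, inner_sub_right, inner_smul_right, hχχ, mul_one, ← ha, sub_self]
  have hx : x = a • χ + y := by rw [hy]; abel
  have hχ' : ‖χ'‖ = 1 := by rw [← hX, norm_combX hu, hχ]
  have hχχ' : ⟪χ', χ'⟫_ℂ = 1 := by rw [sq_norm_amp, hχ']; norm_num
  -- Both operators preserve orthogonality and take `χ` to a multiple of `χ'`, so there are no cross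
  -- terms. What remains is `‖a‖²` from `χ` and a term of modulus at most `‖y‖²` from the rest.
  have h1 : ⟪combX u y, χ'⟫_ℂ = 0 := by
    rw [inner_combX, ← hX, combX_sq hu]
    exact inner_eq_zero_symm.1 hyo
  have hs0 : (s : ℂ) ≠ 0 := by
    have : s ≠ 0 := by rintro rfl; norm_num at hs
    exact_mod_cast this
  have h2 : ⟪χ', combY v y⟫_ℂ = 0 := by
    have h3 := inner_combY v χ (combY v y)
    rw [combY_sq hv, inner_neg_right, hyo, hY, inner_smul_left, Complex.conj_ofReal] at h3
    simpa [hs0] using h3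
  have hnorm : ‖x‖ ^ 2 = ‖a‖ ^ 2 + ‖y‖ ^ 2 := by
    have h3 : ⟪a • χ, y⟫_ℂ = 0 := by rw [inner_smul_left, hyo, mul_zero]
    conv_lhs => rw [hx]
    rw [norm_sq_add_of_inner_eq_zero h3, norm_smul, hχ, mul_one]
  have hmain : ⟪combX u x, combY v x⟫_ℂ
      = ((-s * ‖a‖ ^ 2 : ℝ) : ℂ) + ⟪combX u y, combY v y⟫_ℂ := by
    rw [hx, map_add, map_add, map_smul, map_smul, hX, hY, inner_add_left, inner_add_right,
      inner_add_right, inner_smul_left, inner_smul_left, inner_smul_right, inner_smul_right,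
      inner_smul_right, inner_smul_right, h1, h2, hχχ']
    have h3 := Complex.conj_mul' a
    push_cast
    linear_combination (-s : ℂ) * h3
  have hb : |(⟪combX u y, combY v y⟫_ℂ).re| ≤ ‖y‖ ^ 2 := by
    refine (Complex.abs_re_le_norm _).trans ((norm_inner_le_norm _ _).trans ?_)
    rw [norm_combX hu, norm_combY hv, pow_two]
  have hsabs : |s| = 1 := by
    have : |s| * |s| = 1 := by rw [← abs_mul, hs, abs_one]
    nlinarith [abs_nonneg s]
  have hb2 : s * (⟪combX u y, combY v y⟫_ℂ).re ≤ ‖y‖ ^ 2 :=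
    (le_abs_self _).trans (by rw [abs_mul, hsabs, one_mul]; exact hb)
  rw [hmain, Complex.add_re, Complex.ofReal_re, hnorm]
  have h4 : s * -(-s * ‖a‖ ^ 2 + (⟪combX u y, combY v y⟫_ℂ).re)
      = (s * s) * ‖a‖ ^ 2 - s * (⟪combX u y, combY v y⟫_ℂ).re := by ring
  rw [h4, hs]
  linarith

/-! ### The charging energy as a perturbation -/

theorem numDev_isSymmetric (c : ℝ) : (numDev L c).IsSymmetric := by
  intro x y
  simp only [numDev, LinearMap.sub_apply, LinearMap.smul_apply, Module.End.one_apply,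
    inner_sub_left, inner_sub_right, inner_smul_left, inner_smul_right, Complex.conj_ofReal]
  rw [numOp_isSymmetric x y]

/-- The mean minimizes the quadratic deviation of the particle number. -/
theorem norm_numDev_mean_le {x : Amp L} (hx : ‖x‖ = 1) (c : ℝ) :
    ‖numDev L (⟪x, numOp L x⟫_ℂ).re x‖ ^ 2 ≤ ‖numOp L x - (c : ℂ) • x‖ ^ 2 := by
  set f := (⟪x, numOp L x⟫_ℂ).re with hf
  have hxx : ⟪x, x⟫_ℂ = 1 := by rw [sq_norm_amp, hx]; norm_num
  have hfc : ⟪x, numOp L x⟫_ℂ = (f : ℂ) := by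
    rw [hf, eq_comm, ← Complex.conj_eq_iff_re, inner_conj_symm, numOp_isSymmetric x x]
  have h1 : ⟪numDev L f x, ((f - c : ℝ) : ℂ) • x⟫_ℂ = 0 := by
    rw [numDev_isSymmetric, map_smul, inner_smul_right, numDev, LinearMap.sub_apply,
      LinearMap.smul_apply, Module.End.one_apply, inner_sub_right, inner_smul_right, hfc, hxx,
      mul_one, sub_self, mul_zero]
  have h2 : numOp L x - (c : ℂ) • x = numDev L f x + ((f - c : ℝ) : ℂ) • x := by
    rw [numDev, LinearMap.sub_apply, LinearMap.smul_apply, Module.End.one_apply]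
    push_cast
    module
  rw [h2, norm_sq_add_of_inner_eq_zero h1]
  linarith [sq_nonneg ‖((f - c : ℝ) : ℂ) • x‖]

/-- The Hamiltonian with charging energy in the `M`-particle sector. -/
def chargedKitaev (L : ℕ) (t D μ Ec c : ℝ) : Module.End ℂ (Amp L) :=
  kitaev L t D μ + (Ec : ℂ) • (numDev L c * numDev L c)

theorem coord_ham {t Δ μ Ec nc : ℝ} (hΔ : Δ ≠ 0) (N : ℤ) (ψ : State L) :
    coord Δ N (ham L t Δ μ Ec nc ψ)
      = chargedKitaev L t |Δ| μ Ec (N - 2 * nc) (coord Δ N ψ) := by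
  rw [ham, LinearMap.add_apply, map_add, coord_hamZero hΔ, coord_charging, chargedKitaev,
    LinearMap.add_apply, LinearMap.smul_apply, Module.End.mul_apply]

theorem chargedKitaev_isSymmetric (t D μ Ec c : ℝ) :
    (chargedKitaev L t D μ Ec c).IsSymmetric := by
  intro x y
  simp only [chargedKitaev, LinearMap.add_apply, LinearMap.smul_apply, Module.End.mul_apply,
    inner_add_left, inner_add_right, inner_smul_left, inner_smul_right, Complex.conj_ofReal]
  rw [kitaev_isSymmetric t D μ x y, numDev_isSymmetric c _ y, numDev_isSymmetric c x]

theorem chargedKitaev_mem_parSpace (t D μ Ec c : ℝ) {p : ZMod 2} {x : Amp L}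
    (hx : x ∈ parSpace L p) : chargedKitaev L t D μ Ec c x ∈ parSpace L p :=
  Submodule.add_mem _ (kitaev_mem_parSpace _ _ _ hx)
    (Submodule.smul_mem _ _ (numDev_mem_parSpace (numDev_mem_parSpace hx c) c))

/-- Recentring the square from `c` to `f` produces a term linear in `N_w`; the condition on `μ'`
says that a shift of the chemical potential absorbs it. -/
theorem chargedKitaev_eq {t D μ μ' Ec c f : ℝ} (h : μ' + 2 * Ec * f = μ + 2 * Ec * c)
    (x : Amp L) :
    chargedKitaev L t D μ Ec c x = kitaev L t D μ' x + (Ec : ℂ) • numDev L f (numDev L f x)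
      + (((μ - μ') * (L / 2) + Ec * (c ^ 2 - f ^ 2) : ℝ) : ℂ) • x := by
  have h' : (μ' : ℂ) + 2 * Ec * f = μ + 2 * Ec * c := by exact_mod_cast h
  ext S
  rw [chargedKitaev, LinearMap.add_apply, kitaev_sub t D μ' μ x, LinearMap.smul_apply,
    Module.End.mul_apply]
  simp only [PiLp.add_apply, PiLp.smul_apply, numDev_apply, numOp_apply, smul_eq_mul]
  push_cast
  linear_combination (S.card * x S) * h'

theorem re_inner_chargedKitaev {t D μ μ' Ec c f : ℝ}
    (h : μ' + 2 * Ec * f = μ + 2 * Ec * c) (x : Amp L) :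
    (⟪x, chargedKitaev L t D μ Ec c x⟫_ℂ).re = (⟪x, kitaev L t D μ' x⟫_ℂ).re
      + Ec * ‖numDev L f x‖ ^ 2
      + ((μ - μ') * (L / 2) + Ec * (c ^ 2 - f ^ 2)) * ‖x‖ ^ 2 := by
  rw [chargedKitaev_eq h, inner_add_right, inner_add_right, inner_smul_right, inner_smul_right,
    ← numDev_isSymmetric f x, sq_norm_amp, sq_norm_amp, Complex.add_re, Complex.add_re,
    Complex.re_ofReal_mul, Complex.re_ofReal_mul, Complex.ofReal_re, Complex.ofReal_re]

/-- The ground states of the Hamiltonian with charging energy are close to the ground state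
without charging energy. -/
theorem gap_mul_le_of_ground {t Δ μ μ' Ec c f e E w : ℝ} (hΔ : Δ ≠ 0) (hEc : 0 ≤ Ec) {M : ℤ}
    {r : Finset (Fin L) → ℝ} (hP : IsPerron t |Δ| μ' (M : ZMod 2) e r)
    (h : μ' + 2 * Ec * f = μ + 2 * Ec * c) (hw : Ec * ‖numDev L f (ofRe r)‖ ^ 2 ≤ w)
    (hmin : ∀ y ∈ parSpace L M, E * ‖y‖ ^ 2 ≤ (⟪y, chargedKitaev L t |Δ| μ Ec c y⟫_ℂ).re)
    {x : Amp L} (hx : x ∈ parSpace L M)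
    (hxE : chargedKitaev L t |Δ| μ Ec c x = (E : ℂ) • x) :
    gap (hamZero L t Δ μ') M * (‖x‖ ^ 2 - ‖⟪ofRe r, x⟫_ℂ‖ ^ 2) ≤ w * ‖x‖ ^ 2 := by
  set C := (μ - μ') * (L / 2) + Ec * (c ^ 2 - f ^ 2) with hC
  set δ := gap (hamZero L t Δ μ') M with hδ
  have h1 := hmin _ hP.mem
  rw [re_inner_chargedKitaev h, hP.re_inner_kitaev, hP.norm_eq, ← hC] at h1
  have h2 := re_inner_chargedKitaev (t := t) (D := |Δ|) h x
  rw [hxE, inner_smul_right, sq_norm_amp, Complex.re_ofReal_mul, Complex.ofReal_re, ← hC] at h2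
  set a := ⟪ofRe r, x⟫_ℂ with ha
  set y := x - a • ofRe r with hy
  have hyp : y ∈ parSpace L M := Submodule.sub_mem _ hx (Submodule.smul_mem _ _ hP.mem)
  have hyo : ⟪ofRe r, y⟫_ℂ = 0 := by
    rw [hy, inner_sub_right, inner_smul_right, hP.inner_self, mul_one, ← ha, sub_self]
  have hxy : x = a • ofRe r + y := by rw [hy]; abel
  have hnorm : ‖x‖ ^ 2 = ‖a‖ ^ 2 + ‖y‖ ^ 2 := by
    have h3 : ⟪a • ofRe r, y⟫_ℂ = 0 := by rw [inner_smul_left, hyo, mul_zero]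
    conv_lhs => rw [hxy]
    rw [norm_sq_add_of_inner_eq_zero h3, norm_smul, hP.norm_eq, mul_one]
  have hq : (⟪x, kitaev L t |Δ| μ' x⟫_ℂ).re
      = e * ‖a‖ ^ 2 + (⟪y, kitaev L t |Δ| μ' y⟫_ℂ).re := by
    have h3 : ⟪ofRe r, kitaev L t |Δ| μ' y⟫_ℂ = 0 := by
      rw [← kitaev_isSymmetric t |Δ| μ' (ofRe r) y, hP.eigen, inner_smul_left, hyo, mul_zero]
    have h4 : ⟪x, kitaev L t |Δ| μ' x⟫_ℂ
        = ((e * ‖a‖ ^ 2 : ℝ) : ℂ) + ⟪y, kitaev L t |Δ| μ' y⟫_ℂ := by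
      rw [hxy, map_add, map_smul, hP.eigen, inner_add_left, inner_add_right, inner_add_right,
        inner_smul_left, inner_smul_left, inner_smul_right, inner_smul_right, inner_smul_right,
        inner_smul_right, h3, hP.inner_self, inner_eq_zero_symm.1 hyo]
      have h5 := Complex.conj_mul' a
      push_cast
      linear_combination (e : ℂ) * h5
    rw [h4, Complex.add_re, Complex.ofReal_re]
  have hgap := hP.gap_le hΔ hyp hyo
  rw [← hδ] at hgap
  have hpos : 0 ≤ Ec * ‖numDev L f x‖ ^ 2 := mul_nonneg hEc (sq_nonneg _)
  -- This upper bound uses the unperturbed ground state as a trial state. It is compared with the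
  -- energy of `x`, which is at least `e ‖a‖² + (e + δ) ‖y‖² + C ‖x‖²` once the nonnegative charging
  -- term is dropped.
  have hE : E ≤ e + w + C := by linarith
  have h6 := mul_le_mul_of_nonneg_right hE (sq_nonneg ‖x‖)
  rw [hnorm] at h2 h6 ⊢
  nlinarith

end Wire

end

/-! ### Conclusion: perturbation bound and edge correlation combined -/

theorem theorem4 (L : ℕ) (hL : Even L) (hL0 : 0 < L) (t Δ μ : ℝ) (hμ : |μ| < t) (hΔ : Δ ≠ 0)
    (calE Ec nc : ℝ) (hE : 0 ≤ calE) (hEc : Ec = calE / L) (M : ℤ)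
    (hfill : |μ + 2 * Ec * (M - 2 * nc - Wire.filling L t Δ M μ)| < t) :
    (∃! μ' : ℝ, Wire.IsEffectivePotential L t Δ μ Ec nc M μ') ∧
    ∀ μ' : ℝ, Wire.IsEffectivePotential L t Δ μ Ec nc M μ' →
      calE * (1 / 2 + 8 / (L : ℝ)) < Wire.gap (Wire.hamZero L t Δ μ') M →
      (∃ ψ, Wire.IsGroundState (Wire.ham L t Δ μ Ec nc) M ψ ∧
        ∀ ψ', Wire.IsGroundState (Wire.ham L t Δ μ Ec nc) M ψ' → ∃ z : ℂ, ψ' = z • ψ) ∧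
      (∃! uv : (Fin L → ℝ) × (Fin L → ℝ), Wire.IsEdgePair t Δ μ' uv.1 uv.2) ∧
      ∀ (ψ : Wire.State L) (u v : Fin L → ℝ),
        Wire.IsGroundState (Wire.ham L t Δ μ Ec nc) M ψ →
        Wire.IsEdgePair t Δ μ' u v →
        (Wire.inn ψ ((Complex.I • (Wire.gammaLDag Δ u * Wire.gammaR Δ v)) ψ)).im = 0 ∧
        1 - 2 * (calE * (1 / 2 + 8 / (L : ℝ))) / Wire.gap (Wire.hamZero L t Δ μ') M
          ≤ (-1 : ℝ) ^ M *
            (Wire.inn ψ ((Complex.I • (Wire.gammaLDag Δ u * Wire.gammaR Δ v)) ψ)).re := by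
  open Wire InnerProductSpace in
  have ht : 0 < t := (abs_nonneg μ).trans_lt hμ
  have hLpos : (0 : ℝ) < L := by exact_mod_cast hL0
  have hEc0 : 0 ≤ Ec := by rw [hEc]; positivity
  refine ⟨existsUnique_effectivePotential hL0 hμ hΔ hEc0 M hfill, ?_⟩
  rintro μ' ⟨hμ', heff⟩ hgap
  choose e r hP using fun p => exists_isPerron hL0 ht (abs_pos.2 hΔ) μ' p
  have hPM := hP (M : ZMod 2)
  set χ := ofRe (r (M : ZMod 2)) with hχ
  set f := filling L t Δ M μ' with hf
  set δ := gap (hamZero L t Δ μ') M with hδ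
  set w := calE * (1 / 2 + 8 / (L : ℝ)) with hw
  have hw0 : 0 ≤ w := by positivity
  have hδ0 : 0 < δ := hw0.trans_lt hgap
  -- The variance bound `L / 2` already gives `calE / 2`; the contribution `8 / L` in `w` is slack.
  have hvar : Ec * ‖numDev L f χ‖ ^ 2 ≤ w := by
    obtain ⟨c, hc⟩ := exists_norm_numOp_sub_le hP (M : ZMod 2)
    have h1 := (norm_numDev_mean_le hPM.norm_eq c).trans hc
    rw [← hPM.filling_eq hΔ] at h1
    calc Ec * ‖numDev L f χ‖ ^ 2 ≤ Ec * (L / 2) := mul_le_mul_of_nonneg_left h1 hEc0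
      _ = calE * (1 / 2) := by rw [hEc]; field_simp
      _ ≤ w := mul_le_mul_of_nonneg_left (by linarith [show 0 ≤ 8 / (L : ℝ) by positivity]) hE
  set k := chargedKitaev L t |Δ| μ Ec (M - 2 * nc) with hk
  have hint : ∀ N (ψ : State L), coord Δ N (ham L t Δ μ Ec nc ψ)
      = chargedKitaev L t |Δ| μ Ec (N - 2 * nc) (coord Δ N ψ) := fun N ψ => coord_ham hΔ N ψ
  obtain ⟨E, x, hxp, hx1, hxE, hmin⟩ := exists_lowest
    (chargedKitaev_isSymmetric t |Δ| μ Ec (M - 2 * nc)) (W := parSpace L (M : ZMod 2))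
    (fun y hy => chargedKitaev_mem_parSpace _ _ _ _ _ hy) (parSpace_ne_bot hL0 _)
  have hx0 : x ≠ 0 := norm_ne_zero_iff.1 (by rw [hx1]; exact one_ne_zero)
  have hlev : level (ham L t Δ μ Ec nc) M 0 = E :=
    level_zero_eq (k := fun N => chargedKitaev L t |Δ| μ Ec (N - 2 * nc)) hint hmin hxp hxE hx0
  have hclose : ∀ y ∈ parSpace L (M : ZMod 2), k y = (E : ℂ) • y →
      δ * (‖y‖ ^ 2 - ‖⟪χ, y⟫_ℂ‖ ^ 2) ≤ w * ‖y‖ ^ 2 := fun y hy hyE =>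
    gap_mul_le_of_ground hΔ hEc0 hPM heff hvar hmin hy hyE
  -- Since `w < δ`, the overlap with `χ` is an injective functional on the ground eigenspace, so
  -- this space is at most one-dimensional.
  have hzero : ∀ y ∈ parSpace L (M : ZMod 2), k y = (E : ℂ) • y → ⟪χ, y⟫_ℂ = 0 → y = 0 := by
    intro y hy hyE h0
    have h1 := hclose y hy hyE
    rw [h0, norm_zero] at h1
    by_contra hne
    have : 0 < ‖y‖ ^ 2 := by
      have := norm_pos_iff.2 hne
      positivity
    nlinarith
  have hground : ∀ ψ, IsGroundState (ham L t Δ μ Ec nc) M ψ →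
      ψ ∈ sector L M ∧ k (coord Δ M ψ) = (E : ℂ) • coord Δ M ψ ∧ ‖coord Δ M ψ‖ = 1 := by
    rintro ψ ⟨hs, hH, h1⟩
    refine ⟨hs, ?_, (inn_self_eq Δ hs).1 h1⟩
    rw [hk, ← hint, hH, hlev, map_smul]
  refine ⟨?_, existsUnique_isEdgePair hL0 hΔ hP, ?_⟩
  · obtain ⟨ψ, hs, hH, hc⟩ := exists_eigenstate
      (k := fun N => chargedKitaev L t |Δ| μ Ec (N - 2 * nc)) hint hxp hxE
    refine ⟨ψ, ⟨hs, by rw [hH, hlev], (inn_self_eq Δ hs).2 (by rw [hc, hx1])⟩, ?_⟩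
    intro ψ' hψ'
    obtain ⟨hs', hE', -⟩ := hground ψ' hψ'
    have ha0 : ⟪χ, x⟫_ℂ ≠ 0 := fun h => hx0 (hzero x hxp hxE h)
    refine ⟨⟪χ, coord Δ M ψ'⟫_ℂ / ⟪χ, x⟫_ℂ, ?_⟩
    refine eq_of_coord_of_mem (Δ := Δ) hs' (Submodule.smul_mem _ _ hs) ?_
    rw [map_smul, hc, ← sub_eq_zero]
    refine hzero _ (Submodule.sub_mem _ (coord_mem_parSpace Δ M ψ')
      (Submodule.smul_mem _ _ hxp)) ?_ ?_
    · rw [map_sub, map_smul, hE', hxE, smul_sub, smul_comm]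
    · rw [inner_sub_right, inner_smul_right, div_mul_cancel₀ _ ha0, sub_self]
  · intro ψ u v hψ huv
    obtain ⟨hs, hEψ, h1⟩ := hground ψ hψ
    obtain ⟨⟨hu, hv⟩, -⟩ := huv.eq_edge hL0 hΔ hP
    obtain ⟨hX, hY⟩ := huv.apply_ground hL0 hΔ hP M
    rw [inn_edge_correlation Δ hs, Complex.neg_im, Complex.neg_re, inner_combX_combY_im, neg_zero]
    refine ⟨rfl, ?_⟩
    have hss : ((-1 : ℝ) ^ M) * (-1) ^ M = 1 := by
      rw [← mul_zpow]; norm_num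
    have h2 := edge_correlation_ge hu hv (x := coord Δ M ψ) hss hX hY hPM.norm_eq
    have h3 := hclose _ (coord_mem_parSpace Δ M ψ) hEψ
    rw [h1] at h2 h3
    refine le_trans ?_ h2
    -- The weight outside `χ` enters twice: it is missing from the favourable part and may count
    -- fully against it in the remainder.
    have h4 : 1 - ‖⟪χ, coord Δ M ψ⟫_ℂ‖ ^ 2 ≤ w / δ := by
      rw [le_div_iff₀ hδ0]; linarith
    have h5 : 2 * w / δ = 2 * (w / δ) := by ring
    rw [h5]
    linarith
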